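/- **Setting.** Let $G$ be a bipartite graph with $n$ candidates, $\ell\ge 1$ positions and edge set $E$, which has a matching of cardinality $\ell$. Let $\mathcal M$ be the set of maximum matchings, let $E_j$ be the set of edges at position $j$, and let $e(M,j)$ be the edge of $M\in\mathcal M$ at position $j$. Two edges are comparable if they have the same position, and $K=\sum_{j}|E_j|(|E_j|-1)/2$. For comparable $e,e'$ the unknown preference probability $P_{e,e'}=1-P_{e',e}\in[0,1]$ is the probability that $e$ wins the duel $(e,e')$ (so $P_{e,e}=\tfrac12$); $P_{e,e'}=0$ for incomparable edges. All sampled duels have independent outcomes. For a matrix $Q$ put $f(M_1,M_2,Q)=\frac1\ell\sum_{j}Q_{e(M_1,j),e(M_2,j)}$. Assume that a Condorcet winner $M_*\in\mathcal M$ exists: $f(M_*,M,P)>\tfrac12$ for all $M\in\mathcal M\setminus\{M_*\}$. **Gaps.** For $e\in E$ let $\Delta_e=\tfrac12-\max_M f(M,M_*,P)$, the maximum being over all $M\in\mathcal M$ with $e\in M$ if $e\notin M_*$, and over all $M\in\mathcal M$ with $e\notin M$ if $e\in M_*$ (the maximum over an empty family is read as $0$). Let $\Delta_{e,e'}=\max\{\Delta_e,\Delta_{e'}\}$.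 For $e\notin M_*$ that lies in some maximum matching let $$\tilde\Delta_e=\min_{M\in\mathcal M\setminus\{M_*\}:\,e\in M}\ \frac{\ell}{d_{M_*,M}}\Bigl(\tfrac12-f(M,M_*,P)\Bigr),$$ where $d_{M_*,M}$ is the number of positions at which $M_*$ and $M$ have different edges, and let $H=\sum_e \tilde\Delta_e^{-2}$ be the sum over these $e$. **Oracle.** For $A,R\subseteq E$ let $\mathcal P(A,R)$ be the convex hull of the indicator vectors $\chi_M$ of the $M\in\mathcal M$ with $A\subseteq M$ and $R\cap M=\emptyset$. The learner may call an oracle $\mathsf O_\varepsilon(A_1,R_1,A_2,R_2,Q)$, $\varepsilon>0$, $Q\in[0,1]^{E\times E}$, that returns $\min_{y\in\mathcal P(A_2,R_2)}\frac1\ell x_0^{T}Qy$ for some $x_0\in\mathcal P(A_1,R_1)$ for which this value is at least $\max_{x\in\mathcal P(A_1,R_1)}\min_{y\in\mathcal P(A_2,R_2)}\frac1\ell x^{T}Qy-\varepsilon$, and that returns $-\infty$ if $\mathcal P(A_1,R_1)=\emptyset$. **Confidence bounds.** With confidence $\delta'$, in round $t$, for comparable $e\ne e'$ with $T\ge1$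 duels so far and empirical winning probability $\hat p$, let $c_t(e,e')=\sqrt{\ln(4Kt^3/\delta')/(2T)}$, $\bar P_t(e,e')=\min\{1,\hat p+c_t(e,e')\}$ and $\underline P_t(e,e')=\max\{0,\hat p-c_t(e,e')\}$; if $T=0$ these are $\infty$, $1$ and $0$. Diagonal entries are $\tfrac12$ and incomparable entries are $0$. **CAR-Cond($\delta'$).** Start with $A=R=\emptyset$. In rounds $t=1,2,\dots$, with $\varepsilon=2^{-q}$, where $q\ge1$ is least with $t\le4^q$: sample once each duel between two distinct comparable edges of $U=E\setminus(A\cup R)$; compute $\bar P_t,\underline P_t$ from all duels so far; for each $e\in U$ accept $e$ if $\mathsf O_\varepsilon(A\cup\{e\},R,A,R,\underline P_t)>\mathsf O_\varepsilon(A,R\cup\{e\},A,R,\bar P_t)+\varepsilon$, and otherwise reject $e$ if $\mathsf O_\varepsilon(A,R\cup\{e\},A,R,\underline P_t)>\mathsf O_\varepsilon(A\cup\{e\},R,A,R,\bar P_t)+\varepsilon$; then add the accepted edges to $A$ and the rejected ones to $R$, and return $A$ if $|A|=\ell$. **CAR-Verify($\delta'$).** Let $\hat M$ be the result of CAR-Cond($0.01$).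 With new statistics, in rounds $t=1,2,\dots$: compute $\bar P_t,\underline P_t$ with confidence $\delta'$; if $f(M,\hat M,\underline P_t)\ge\frac12$ for some $M\in\mathcal M\setminus\{\hat M\}$, return an error; if $f(M,\hat M,\bar P_t)\le\frac12$ for all $M\in\mathcal M\setminus\{\hat M\}$, return $\hat M$; otherwise let $M_t$ maximise $f(M,\hat M,\bar P_t)$ over $\mathcal M\setminus\{\hat M\}$, and sample a duel $(e,e')$ with $e\in M_t\setminus\hat M$, $e'\in\hat M\setminus M_t$ at the same position for which $c_t(e,e')$ is largest. **CAR-Parallel($\delta$).** Run independent copies $k=0,1,2,\dots$ of CAR-Verify in parallel, copy $k$ with confidence $\delta/2^{k+1}$. At $t=1,2,\dots$, for each $k$ with $2^k\mid t$ in increasing order, start or resume copy $k$, allowing one sample, and suspend it; if it returns a matching (not an error), return this matching. (A copy that would compute forever without sampling does not hold up the others.) **Theorem 5 (CAR-Parallel).** There is an absolute constant $C>0$ such that for every such graph, oracle, tie-breaking rule and preference matrix with a Condorcet winner $M_*$, and every $0<\delta<0.01$: with probability at least $1-\delta$, CAR-Parallel($\delta$) returns $M_*$, and the expected total number of samples that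 it takes is at most $$C\left(\sum_{j=1}^{\ell}\ \sum_{\substack{e\ne e'\\ e,e'\in E_j}}\frac{\ln\bigl(K/\Delta_{e,e'}^2\bigr)}{\Delta_{e,e'}^2}+H\ln\Bigl(\frac H\delta\Bigr)\right),$$ where the second term is $0$ if $H=0$. -/

import Mathlib

namespace CPEDB

/-! ### The model: candidates, positions, matchings, preferences -/

/-- An edge `(c, s)` joins a candidate `c` and a position `s`. -/
abbrev Edge (n ℓ : ℕ) := Fin n × Fin ℓ

/-- A real matrix indexed by edges. -/
abbrev EdgeMatrix (n ℓ : ℕ) := Edge n ℓ → Edge n ℓ → ℝ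

section Model

variable {n ℓ : ℕ}

/-- The edges of the graph `E` at position `j`. -/
def edgesAt (E : Finset (Edge n ℓ)) (j : Fin ℓ) : Finset (Edge n ℓ) := E.filter (fun e => e.2 = j)

/-- Two edges of the graph are comparable if they have the same position. -/
def Comparable (E : Finset (Edge n ℓ)) (e f : Edge n ℓ) : Prop := e ∈ E ∧ f ∈ E ∧ e.2 = f.2

/-- The number of duels, `K = ∑ⱼ |Eⱼ| (|Eⱼ| - 1) / 2`. -/
noncomputable def numDuels (E : Finset (Edge n ℓ)) : ℝ :=
  ∑ j : Fin ℓ, ((edgesAt E j).card : ℝ) * (((edgesAt E j).card : ℝ) - 1) / 2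

/-- `P` is a preference matrix for `E`: `P e f` is the probability that `e` wins against `f`.
The diagonal entries `P e e = 1 / 2` (`e ∈ E`) follow from `add_eq_one`. -/
structure IsPreference (E : Finset (Edge n ℓ)) (P : EdgeMatrix n ℓ) : Prop where
  nonneg : ∀ e f, 0 ≤ P e f
  le_one : ∀ e f, P e f ≤ 1
  add_eq_one : ∀ e f, Comparable E e f → P e f + P f e = 1
  eq_zero : ∀ e f, ¬ Comparable E e f → P e f = 0

/-- A matching of the bipartite graph `E`. -/
def IsMatching (E M : Finset (Edge n ℓ)) : Prop :=
  M ⊆ E ∧ ∀ e ∈ M, ∀ f ∈ M, e ≠ f → e.1 ≠ f.1 ∧ e.2 ≠ f.2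

open scoped Classical in
/-- The decision class: all matchings of maximum cardinality. -/
noncomputable def maxMatchings (E : Finset (Edge n ℓ)) : Finset (Finset (Edge n ℓ)) :=
  E.powerset.filter (fun M => IsMatching E M ∧ ∀ M', IsMatching E M' → M'.card ≤ M.card)

/-- `f(M₁, M₂, Q) = (1/ℓ) ∑ⱼ Q (e(M₁, j)) (e(M₂, j))`. -/
noncomputable def score (Q : EdgeMatrix n ℓ) (M₁ M₂ : Finset (Edge n ℓ)) : ℝ :=
  (1 / (ℓ : ℝ)) * ∑ j : Fin ℓ, ∑ e ∈ edgesAt M₁ j, ∑ f ∈ edgesAt M₂ j, Q e f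

/-- `M` is the Condorcet winner: it wins against every other maximum matching with probability
strictly better than `1 / 2`. -/
def IsCondorcetWinner (E : Finset (Edge n ℓ)) (P : EdgeMatrix n ℓ) (M : Finset (Edge n ℓ)) : Prop :=
  M ∈ maxMatchings E ∧ ∀ M' ∈ maxMatchings E, M' ≠ M → 1 / 2 < score P M M'

/-! ### Gaps and hardness (`Ms` is the Condorcet winner) -/

open scoped Classical in
/-- The maximum matchings over which the Condorcet gap of `e` is taken. -/
noncomputable def flipMatchings (E Ms : Finset (Edge n ℓ)) (e : Edge n ℓ) :
    Finset (Finset (Edge n ℓ)) :=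
  if e ∈ Ms then (maxMatchings E).filter (fun M => e ∉ M)
  else (maxMatchings E).filter (fun M => e ∈ M)

open scoped Classical in
/-- The Condorcet gap of an edge. If there is no matching to maximise over (the edge is in no
maximum matching, or is in all of them), the maximum is read as `0`, so that the gap is `1 / 2`, the
largest value that a gap can have. -/
noncomputable def condGap (E : Finset (Edge n ℓ)) (P : EdgeMatrix n ℓ) (Ms : Finset (Edge n ℓ))
    (e : Edge n ℓ) : ℝ :=
  1 / 2 - if h : (flipMatchings E Ms e).Nonempty
    then (flipMatchings E Ms e).sup' h (fun M => score P M Ms) else 0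

/-- The Condorcet gap of a pair of edges. -/
noncomputable def pairGap (E : Finset (Edge n ℓ)) (P : EdgeMatrix n ℓ) (Ms : Finset (Edge n ℓ))
    (e f : Edge n ℓ) : ℝ :=
  max (condGap E P Ms e) (condGap E P Ms f)

/-- The number of positions at which two matchings have different edges. -/
def numDiff (M₁ M₂ : Finset (Edge n ℓ)) : ℕ :=
  (Finset.univ.filter (fun j : Fin ℓ => edgesAt M₁ j ≠ edgesAt M₂ j)).card

open scoped Classical in
/-- The maximum matchings, other than the Condorcet winner, that contain `e`. -/
noncomputable def rivals (E Ms : Finset (Edge n ℓ)) (e : Edge n ℓ) : Finset (Finset (Edge n ℓ)) :=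
  (maxMatchings E).filter (fun M => M ≠ Ms ∧ e ∈ M)

/-- The verification gap of an edge `e` that lies in some rival of the Condorcet winner. -/
noncomputable def verGap (E : Finset (Edge n ℓ)) (P : EdgeMatrix n ℓ) (Ms : Finset (Edge n ℓ))
    (e : Edge n ℓ) (h : (rivals E Ms e).Nonempty) : ℝ :=
  (rivals E Ms e).inf' h
    (fun M => ((ℓ : ℝ) / (numDiff Ms M : ℝ)) * (1 / 2 - score P M Ms))

open scoped Classical in
/-- The verification hardness: the sum of the inverse squared verification gaps over the edges
outside the Condorcet winner. An edge in no maximum matching has an empty minimum as its gap,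
that is `+∞`, and contributes `0`. -/
noncomputable def hardness (E : Finset (Edge n ℓ)) (P : EdgeMatrix n ℓ) (Ms : Finset (Edge n ℓ)) :
    ℝ :=
  ∑ e ∈ E \ Ms, if h : (rivals E Ms e).Nonempty then 1 / (verGap E P Ms e h) ^ 2 else 0

open scoped Classical in
/-- `∑ⱼ ∑_{e ≠ e' ∈ Eⱼ} ln(K / Δ(e,e')²) / Δ(e,e')² + H ln(H / δ)`. -/
noncomputable def complexityBound (E : Finset (Edge n ℓ)) (P : EdgeMatrix n ℓ)
    (Ms : Finset (Edge n ℓ)) (δ : ℝ) : ℝ :=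
  (∑ j : Fin ℓ, ∑ d ∈ (edgesAt E j).offDiag,
      Real.log (numDuels E / (pairGap E P Ms d.1 d.2) ^ 2) / (pairGap E P Ms d.1 d.2) ^ 2)
    + hardness E P Ms * Real.log (hardness E P Ms / δ)

/-! ### The optimisation oracle -/

/-- The indicator vector of a set of edges. -/
def chi (M : Finset (Edge n ℓ)) : Edge n ℓ → ℝ := fun e => if e ∈ M then 1 else 0

/-- The convex hull of the indicator vectors of the maximum matchings that include `A` and
avoid `R`. -/
def polytope (E A R : Finset (Edge n ℓ)) : Set (Edge n ℓ → ℝ) :=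
  convexHull ℝ {x | ∃ M ∈ maxMatchings E, A ⊆ M ∧ Disjoint R M ∧ x = chi M}

/-- `min_{y ∈ 𝒫(A, R)} (1/ℓ) xᵀ Q y`. -/
noncomputable def worstCase (E : Finset (Edge n ℓ)) (Q : EdgeMatrix n ℓ) (A R : Finset (Edge n ℓ))
    (x : Edge n ℓ → ℝ) : ℝ :=
  sInf ((fun y : Edge n ℓ → ℝ => (1 / (ℓ : ℝ)) * ∑ e, ∑ f, x e * Q e f * y f) '' polytope E A R)

/-- The type of an oracle: it is called as `O ε A₁ R₁ A₂ R₂ Q` and returns a value, which is `⊥`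
(that is, `-∞`) if the outer maximisation is over the empty set. -/
abbrev Oracle (n ℓ : ℕ) := ℝ → Finset (Edge n ℓ) → Finset (Edge n ℓ) → Finset (Edge n ℓ) →
  Finset (Edge n ℓ) → EdgeMatrix n ℓ → WithBot ℝ

/-- The guarantee of the oracle: the value returned is attained by a feasible `x₀` that is
optimal up to `ε` in `max_{x ∈ 𝒫(A₁, R₁)} min_{y ∈ 𝒫(A₂, R₂)} (1/ℓ) xᵀ Q y`. -/
structure IsOracle (E : Finset (Edge n ℓ)) (O : Oracle n ℓ) : Prop where
  infeasible : ∀ ε A₁ R₁ A₂ R₂ Q, polytope E A₁ R₁ = ∅ → O ε A₁ R₁ A₂ R₂ Q = ⊥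
  feasible : ∀ ε A₁ R₁ A₂ R₂ Q, 0 < ε → (∀ e f, 0 ≤ Q e f ∧ Q e f ≤ 1) →
    (polytope E A₁ R₁).Nonempty → (polytope E A₂ R₂).Nonempty →
    ∃ x₀ ∈ polytope E A₁ R₁, O ε A₁ R₁ A₂ R₂ Q = (worstCase E Q A₂ R₂ x₀ : ℝ) ∧
      ∀ x ∈ polytope E A₁ R₁, worstCase E Q A₂ R₂ x - ε ≤ worstCase E Q A₂ R₂ x₀

/-- `pick` returns a maximiser of a function on a nonempty finite set (ties are broken
arbitrarily). -/
def IsArgmax {α β : Type} [LE β] (pick : Finset α → (α → β) → α) : Prop :=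
  ∀ (s : Finset α) (g : α → β), s.Nonempty → pick s g ∈ s ∧ ∀ x ∈ s, g x ≤ g (pick s g)

/-- What the learner is given: the graph, the oracle, and the rules that resolve the two `argmax`
of the verification algorithm. -/
structure Input (n ℓ : ℕ) where
  E : Finset (Edge n ℓ)
  oracle : Oracle n ℓ
  argmaxM : Finset (Finset (Edge n ℓ)) → (Finset (Edge n ℓ) → ℝ) → Finset (Edge n ℓ)
  argmaxD : Finset (Edge n ℓ × Edge n ℓ) → (Edge n ℓ × Edge n ℓ → EReal) → Edge n ℓ × Edge n ℓ

/-- The standing assumptions on the input: there is a matching that covers all positions, and the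
oracle and the two `argmax` rules do what they should. -/
structure Input.Valid (I : Input n ℓ) : Prop where
  exists_matching : ∃ M, IsMatching I.E M ∧ M.card = ℓ
  oracle : IsOracle I.E I.oracle
  argmaxM : IsArgmax I.argmaxM
  argmaxD : IsArgmax I.argmaxD

/-! ### Empirical statistics and confidence bounds -/

/-- Observed duels: `count e f` is the number of duels between `e` and `f` (in either order), and
`wins e f` is the number of these that `e` has won. -/
structure Stats (n ℓ : ℕ) where
  count : Edge n ℓ → Edge n ℓ → ℕ
  wins : Edge n ℓ → Edge n ℓ → ℕ

/-- No duel observed yet. -/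
def Stats.empty : Stats n ℓ := ⟨fun _ _ => 0, fun _ _ => 0⟩

/-- Record a duel `d = (d.1, d.2)`; `b = true` means that `d.1` has won. -/
def Stats.record (s : Stats n ℓ) (d : Edge n ℓ × Edge n ℓ) (b : Bool) : Stats n ℓ where
  count e f := s.count e f + if (e, f) = d ∨ (f, e) = d then 1 else 0
  wins e f := s.wins e f +
    if ((e, f) = d ∧ b = true) ∨ ((f, e) = d ∧ b = false) then 1 else 0

/-- Empirical winning probability. -/
noncomputable def Stats.mean (s : Stats n ℓ) (e f : Edge n ℓ) : ℝ :=
  (s.wins e f : ℝ) / (s.count e f : ℝ)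

/-- The confidence radius `√(ln(4 K t³ / δ) / (2 T))` in round `t` after `T ≥ 1` duels. -/
noncomputable def radius (K δ : ℝ) (t T : ℕ) : ℝ :=
  Real.sqrt (Real.log (4 * K * (t : ℝ) ^ 3 / δ) / (2 * (T : ℝ)))

/-- The confidence radius as an extended real: it is `+∞` for a pair with no duel. -/
noncomputable def radiusExt (K δ : ℝ) (t T : ℕ) : EReal :=
  if T = 0 then ⊤ else ((radius K δ t T : ℝ) : EReal)

open scoped Classical in
/-- Matrix of upper confidence bounds. -/
noncomputable def upperBounds (E : Finset (Edge n ℓ)) (δ : ℝ) (t : ℕ) (s : Stats n ℓ) :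
    EdgeMatrix n ℓ := fun e f =>
  if ¬ Comparable E e f then 0
  else if e = f then 1 / 2
  else if s.count e f = 0 then 1
  else min 1 (s.mean e f + radius (numDuels E) δ t (s.count e f))

open scoped Classical in
/-- Matrix of lower confidence bounds. -/
noncomputable def lowerBounds (E : Finset (Edge n ℓ)) (δ : ℝ) (t : ℕ) (s : Stats n ℓ) :
    EdgeMatrix n ℓ := fun e f =>
  if ¬ Comparable E e f then 0
  else if e = f then 1 / 2
  else if s.count e f = 0 then 0
  else max 0 (s.mean e f - radius (numDuels E) δ t (s.count e f))

/-! ### `CAR-Cond` and `CAR-Verify` as a state machine -/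

/-- The two parts of `CAR-Verify`: the call of `CAR-Cond`, and the verification loop. -/
inductive Phase where
  | explore
  | verify

/-- The states of `CAR-Verify`.
* `explore t todo A R s`: in round `t` of `CAR-Cond`, with accepted edges `A`, rejected edges `R`,
  statistics `s`, and the duels `todo` still to be sampled in this round.
* `verify t Mhat s`: at the start of round `t` of the verification of `Mhat`, with statistics `s`.
* `answer M`: has returned `M`.
* `error`: has returned an error. -/
inductive VState (n ℓ : ℕ) where
  | explore (t : ℕ) (todo : List (Edge n ℓ × Edge n ℓ)) (A R : Finset (Edge n ℓ)) (s : Stats n ℓ)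
  | verify (t : ℕ) (Mhat : Finset (Edge n ℓ)) (s : Stats n ℓ)
  | answer (M : Finset (Edge n ℓ))
  | error

/-- The constant confidence `δ₀` with which `CAR-Verify` calls `CAR-Cond`. -/
noncomputable def delta0 : ℝ := 1 / 100

/-- `d` is a duel between two distinct comparable edges, the one with the smaller candidate index
first. -/
def IsDuel (E : Finset (Edge n ℓ)) (d : Edge n ℓ × Edge n ℓ) : Prop :=
  Comparable E d.1 d.2 ∧ d.1.1 < d.2.1

open scoped Classical in
/-- All the duels between edges in `U ⊆ E`, in some order. -/
noncomputable def duelList (E U : Finset (Edge n ℓ)) : List (Edge n ℓ × Edge n ℓ) :=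
  ((U ×ˢ U).filter (fun d => IsDuel E d)).toList

/-- `CAR-Cond` starts with round `1`, in which all edges are undecided. -/
noncomputable def VState.init (I : Input n ℓ) : VState n ℓ :=
  .explore 1 (duelList I.E I.E) ∅ ∅ Stats.empty

/-- The epoch `q ≥ 1` of round `t`: `4 ^ (q-1) < t ≤ 4 ^ q` if `q ≥ 2`, and `t ≤ 4` if `q = 1`. -/
def epoch (t : ℕ) : ℕ := max 1 (Nat.clog 4 t)

/-- The oracle accuracy `ε_q = 1 / 2 ^ q` in round `t`. -/
noncomputable def accuracy (t : ℕ) : ℝ := 1 / 2 ^ epoch t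

/-- The undecided edges. -/
def undecided (E A R : Finset (Edge n ℓ)) : Finset (Edge n ℓ) := E \ (A ∪ R)

/-- `InL > ExU + ε_q` for the edge `e` at the end of round `t` of `CAR-Cond`. -/
def Accepts (I : Input n ℓ) (t : ℕ) (A R : Finset (Edge n ℓ)) (s : Stats n ℓ) (e : Edge n ℓ) :
    Prop :=
  I.oracle (accuracy t) A (R ∪ {e}) A R (upperBounds I.E delta0 t s) + (accuracy t : WithBot ℝ)
    < I.oracle (accuracy t) (A ∪ {e}) R A R (lowerBounds I.E delta0 t s)

/-- `ExL > InU + ε_q` for the edge `e` at the end of round `t` of `CAR-Cond`. -/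
def Rejects (I : Input n ℓ) (t : ℕ) (A R : Finset (Edge n ℓ)) (s : Stats n ℓ) (e : Edge n ℓ) :
    Prop :=
  I.oracle (accuracy t) (A ∪ {e}) R A R (upperBounds I.E delta0 t s) + (accuracy t : WithBot ℝ)
    < I.oracle (accuracy t) A (R ∪ {e}) A R (lowerBounds I.E delta0 t s)

open scoped Classical in
/-- The accepted edges after round `t` of `CAR-Cond`. -/
noncomputable def nextA (I : Input n ℓ) (t : ℕ) (A R : Finset (Edge n ℓ)) (s : Stats n ℓ) :
    Finset (Edge n ℓ) :=
  A ∪ (undecided I.E A R).filter (fun e => Accepts I t A R s e)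

open scoped Classical in
/-- The rejected edges after round `t` of `CAR-Cond`. -/
noncomputable def nextR (I : Input n ℓ) (t : ℕ) (A R : Finset (Edge n ℓ)) (s : Stats n ℓ) :
    Finset (Edge n ℓ) :=
  R ∪ (undecided I.E A R).filter (fun e => ¬ Accepts I t A R s e ∧ Rejects I t A R s e)

open scoped Classical in
/-- The end of round `t` of `CAR-Cond`: return the accepted set if it has `ℓ` elements, and enter
the verification of it with new statistics; otherwise start the next round. -/
noncomputable def endRound (I : Input n ℓ) (t : ℕ) (A R : Finset (Edge n ℓ)) (s : Stats n ℓ) :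
    VState n ℓ :=
  if (nextA I t A R s).card = ℓ then .verify 1 (nextA I t A R s) Stats.empty
  else .explore (t + 1)
    (duelList I.E (undecided I.E (nextA I t A R s) (nextR I t A R s)))
    (nextA I t A R s) (nextR I t A R s) s

/-- `max_{M ≠ Mhat} f(M, Mhat, lower bounds) ≥ 1/2`: the verification fails with an error. -/
def Refuted (I : Input n ℓ) (δ : ℝ) (t : ℕ) (Mhat : Finset (Edge n ℓ)) (s : Stats n ℓ) : Prop :=
  ∃ M ∈ maxMatchings I.E, M ≠ Mhat ∧ 1 / 2 ≤ score (lowerBounds I.E δ t s) M Mhat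

/-- `max_{M ≠ Mhat} f(M, Mhat, upper bounds) ≤ 1/2`: the verification is successful. -/
def Confirmed (I : Input n ℓ) (δ : ℝ) (t : ℕ) (Mhat : Finset (Edge n ℓ)) (s : Stats n ℓ) : Prop :=
  ∀ M ∈ maxMatchings I.E, M ≠ Mhat → score (upperBounds I.E δ t s) M Mhat ≤ 1 / 2

open scoped Classical in
/-- The matching `M_t ≠ Mhat` that maximises `f(M, Mhat, upper bounds)`. -/
noncomputable def challenger (I : Input n ℓ) (δ : ℝ) (t : ℕ) (Mhat : Finset (Edge n ℓ))
    (s : Stats n ℓ) : Finset (Edge n ℓ) :=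
  I.argmaxM ((maxMatchings I.E).filter (fun M => M ≠ Mhat))
    (fun M => score (upperBounds I.E δ t s) M Mhat)

open scoped Classical in
/-- The duel `(e_t, f_t)` of largest confidence radius with `e_t ∈ M_t \ Mhat`,
`f_t ∈ Mhat \ M_t` at the same position. -/
noncomputable def verifyDuel (I : Input n ℓ) (δ : ℝ) (t : ℕ) (Mhat : Finset (Edge n ℓ))
    (s : Stats n ℓ) : Edge n ℓ × Edge n ℓ :=
  I.argmaxD
    (((challenger I δ t Mhat s \ Mhat) ×ˢ (Mhat \ challenger I δ t Mhat s)).filter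
      (fun d => d.1.2 = d.2.2))
    (fun d => radiusExt (numDuels I.E) δ t (s.count d.1 d.2))

open scoped Classical in
/-- The sample that `CAR-Verify` with confidence `δ` takes next in the given state: the phase, the
duel, and the number of duels of this pair so far in this phase. It is `none` if the next action
is not a sample. -/
noncomputable def VState.request (I : Input n ℓ) (δ : ℝ) :
    VState n ℓ → Option (Phase × (Edge n ℓ × Edge n ℓ) × ℕ)
  | .explore _ (d :: _) _ _ s => some (.explore, d, s.count d.1 d.2)
  | .explore _ [] _ _ _ => none
  | .verify t Mhat s =>
      if Refuted I δ t Mhat s ∨ Confirmed I δ t Mhat s then none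
      else some (.verify, verifyDuel I δ t Mhat s,
        s.count (verifyDuel I δ t Mhat s).1 (verifyDuel I δ t Mhat s).2)
  | .answer _ => none
  | .error => none

open scoped Classical in
/-- The next action of `CAR-Verify` if it is not a sample. -/
noncomputable def VState.silent (I : Input n ℓ) (δ : ℝ) : VState n ℓ → VState n ℓ
  | .explore t [] A R s => endRound I t A R s
  | .verify t Mhat s =>
      if Refuted I δ t Mhat s then .error
      else if Confirmed I δ t Mhat s then .answer Mhat
      else .verify t Mhat s
  | x => x

/-- The state after the requested sample, with outcome `b`, has been taken. -/
noncomputable def VState.observe (I : Input n ℓ) (δ : ℝ) (b : Bool) : VState n ℓ → VState n ℓ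
  | .explore t (d :: todo) A R s => .explore t todo A R (s.record d b)
  | .verify t Mhat s => .verify (t + 1) Mhat (s.record (verifyDuel I δ t Mhat s) b)
  | x => x

/-- The algorithm has returned an answer or an error. -/
def VState.Halted : VState n ℓ → Prop
  | .answer _ => True
  | .error => True
  | _ => False

/-- The answer, if one has been returned. -/
def VState.result : VState n ℓ → Option (Finset (Edge n ℓ))
  | .answer M => some M
  | _ => none

/-- The state waits for a sample, or is final. -/
def VState.Ready (I : Input n ℓ) (δ : ℝ) (x : VState n ℓ) : Prop :=
  (x.request I δ).isSome = true ∨ x.Halted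

open scoped Classical in
/-- Carry out the actions that are not samples until the next sample is due or the algorithm has
returned. (A run that would never do either takes no further part: as the copies run in parallel, it
does not hold up the others.) -/
noncomputable def VState.settle (I : Input n ℓ) (δ : ℝ) (x : VState n ℓ) : VState n ℓ :=
  if h : ∃ r : ℕ, ((VState.silent I δ)^[r] x).Ready I δ then (VState.silent I δ)^[Nat.find h] x
  else x

/-- The random outcomes: `X (k, ph, d, i)` is the outcome (`true` if `d.1` wins) of the duel
number `i` between the edges of `d` that copy `k` of `CAR-Verify` samples in phase `ph`. -/
abbrev Index (n ℓ : ℕ) := ℕ × Phase × (Edge n ℓ × Edge n ℓ) × ℕ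

/-- The outcome of a duel, requested in either order. -/
def outcome (x : Index n ℓ → Bool) (k : ℕ) (ph : Phase) (d : Edge n ℓ × Edge n ℓ) (i : ℕ) : Bool :=
  if d.1.1 < d.2.1 then x (k, ph, d, i) else !(x (k, ph, (d.2, d.1), i))

/-- Resume copy `k` of `CAR-Verify`, allowing one sample, and suspend it. The second component is
the number of samples taken. -/
noncomputable def VState.resume (I : Input n ℓ) (δ : ℝ) (x : Index n ℓ → Bool) (k : ℕ)
    (v : VState n ℓ) : VState n ℓ × ℕ :=
  match (v.settle I δ).request I δ with
  | some (ph, d, i) => ((v.settle I δ).observe I δ (outcome x k ph d i), 1)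
  | none => (v.settle I δ, 0)

/-! ### `CAR-Parallel` -/

/-- The state of `CAR-Parallel`: the copies of `CAR-Verify`, the total number of samples, and the
output if it has returned. -/
structure PState (n ℓ : ℕ) where
  copies : ℕ → VState n ℓ
  samples : ℕ
  out : Option (Finset (Edge n ℓ))

/-- The start of `CAR-Parallel`. -/
noncomputable def PState.init (I : Input n ℓ) : PState n ℓ := ⟨fun _ => VState.init I, 0, none⟩

/-- One pass through the inner loop: copy `k`, which has confidence `δ / 2 ^ (k+1)`, is resumed, and
its answer is returned if there is one. Nothing happens after `CAR-Parallel` has returned. -/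
noncomputable def PState.resumeCopy (I : Input n ℓ) (δ : ℝ) (x : Index n ℓ → Bool)
    (p : PState n ℓ) (k : ℕ) : PState n ℓ :=
  match p.out with
  | some _ => p
  | none =>
    let r := (p.copies k).resume I (δ / 2 ^ (k + 1)) x k
    { copies := Function.update p.copies k r.1
      samples := p.samples + r.2
      out := r.1.result }

/-- The indices `k` with `t mod 2 ^ k = 0`, in increasing order (`k ≤ t` holds for these, as
`t ≥ 1`). -/
def scheduled (t : ℕ) : List ℕ := (List.range (t + 1)).filter (fun k => t % 2 ^ k = 0)

/-- The state of `CAR-Parallel` after the rounds `1, …, t` of its outer loop. -/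
noncomputable def parallel (I : Input n ℓ) (δ : ℝ) (x : Index n ℓ → Bool) : ℕ → PState n ℓ
  | 0 => PState.init I
  | t + 1 => (scheduled (t + 1)).foldl (PState.resumeCopy I δ x) (parallel I δ x t)

/-- `CAR-Parallel` returns `M`. -/
def Returns (I : Input n ℓ) (δ : ℝ) (x : Index n ℓ → Bool) (M : Finset (Edge n ℓ)) : Prop :=
  ∃ t, (parallel I δ x t).out = some M

/-- The total number of samples that `CAR-Parallel` takes (possibly infinite). -/
noncomputable def sampleComplexity (I : Input n ℓ) (δ : ℝ) (x : Index n ℓ → Bool) : ENNReal :=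
  ⨆ t, ((parallel I δ x t).samples : ENNReal)

/-- The outcomes of the duels are independent, and the outcome of a duel `d` is a Bernoulli
variable with mean `P d.1 d.2`. -/
structure IsDuelOutcomes {Ω : Type*} [MeasurableSpace Ω] (μ : MeasureTheory.Measure Ω)
    (E : Finset (Edge n ℓ)) (P : EdgeMatrix n ℓ) (X : Index n ℓ → Ω → Bool) : Prop where
  measurable : ∀ i, Measurable (X i)
  indep : ProbabilityTheory.iIndepFun
    (fun i : {i : Index n ℓ // IsDuel E i.2.2.1} => X i.1) μ
  law : ∀ i : Index n ℓ, IsDuel E i.2.2.1 →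
    μ {ω | X i ω = true} = ENNReal.ofReal (P i.2.2.1.1 i.2.2.1.2)

end Model

end CPEDB

/-! ### Matchings, scores, the matching polytope and the oracle -/

section

open Finset

namespace CPEDB

variable {n ℓ : ℕ} {E : Finset (Edge n ℓ)}

/-! ### Matchings -/

/-! The analysis is deterministic on the event that the empirical means of one copy stay within
their confidence radii (`Concentrated`). The outcomes form one stack per copy, phase and duel, so
this event does not depend on how the algorithm uses its samples. By Hoeffding's inequality and a
union bound it fails in a phase of confidence δ' with probability at most δ'.

Exploration keeps `A ⊆ Ms` and `R` disjoint from `Ms`. Under the true matrix the winner has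
worst-case value at least 1/2. Against the reply `Ms`, any mixture of matchings that disagree with
the winner about `e` has value at most 1/2 minus the gap of `e`. So no wrong decision can be
certified. Only duels between undecided edges carry uncertain weight, and their bounds are within
two radii of the truth, so `e` is decided once four radii plus twice the oracle accuracy drop below
its gap (`oracle_lt_of_gap`), in a round of order ln(K/Δ²)/Δ² at the latest. A duel is repeated only
while both its edges are undecided, so the larger of the two gaps governs its cost.

Verification samples the most uncertain duel between the challenger and the winner. If this duel has
been sampled before, its radius bounds the error at every position where the two matchings differ.
As the challenger still has an upper score above 1/2, the verification gap is at most twice this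
radius, and the count of the duel is at most of order log / gap²
(`Concentrated.lt_of_not_confirmed`). Summation over the rival edges gives an inequality for the
number of samples that has this number inside a logarithm; a tangent line to the logarithm solves
it.

A concentrated copy thus returns the winner after a bounded number B of samples
(`GoodCopy.exists_answer`). Copy k has been resumed B + 1 times by round (B + 1) 2^k, and the
parallel run takes at most 2t samples in t rounds. The copies are independent and each fails to be
concentrated with probability at most 1/50, so the first k copies all fail with probability at most
50^(-k). This beats the growth of (B_k + 1) 2^k, where B_k is linear in k + 1, and the expectation
is a geometric series. An answer can be wrong only if some verification phase is not concentrated,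
which has total probability at most ∑ δ/2^(k+1) = δ. -/

theorem mem_edgesAt {M : Finset (Edge n ℓ)} {j : Fin ℓ} {e : Edge n ℓ} :
    e ∈ edgesAt M j ↔ e ∈ M ∧ e.2 = j := by
  simp [edgesAt]

theorem IsMatching.injOn {M : Finset (Edge n ℓ)} (h : IsMatching E M) :
    Set.InjOn Prod.snd (M : Set (Edge n ℓ)) := by
  intro e he f hf hef
  by_contra hne
  exact (h.2 e he f hf hne).2 hef

theorem IsMatching.card_le {M : Finset (Edge n ℓ)} (h : IsMatching E M) : M.card ≤ ℓ := by
  have := Finset.card_le_card_of_injOn Prod.snd (t := (Finset.univ : Finset (Fin ℓ)))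
    (fun e _ => Finset.mem_univ _) h.injOn
  simpa using this

theorem mem_maxMatchings (hE : ∃ M, IsMatching E M ∧ M.card = ℓ) {M : Finset (Edge n ℓ)} :
    M ∈ maxMatchings E ↔ IsMatching E M ∧ M.card = ℓ := by
  classical
  simp only [maxMatchings, mem_filter, mem_powerset]
  constructor
  · rintro ⟨-, hM, hmax⟩
    obtain ⟨N, hN, hc⟩ := hE
    exact ⟨hM, le_antisymm hM.card_le (hc.ge.trans (hmax N hN))⟩
  · rintro ⟨hM, hc⟩
    exact ⟨hM.1, hM, fun N hN => hN.card_le.trans hc.ge⟩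

/-- With ℓ edges at distinct positions, a maximum matching covers every position and is therefore a
function from positions to candidates. This representation turns scores into sums over positions. -/
theorem exists_edgesAt_eq (hE : ∃ M, IsMatching E M ∧ M.card = ℓ) {M : Finset (Edge n ℓ)}
    (hM : M ∈ maxMatchings E) : ∃ m : Fin ℓ → Fin n, ∀ j, edgesAt M j = {(m j, j)} := by
  obtain ⟨hM, hc⟩ := (mem_maxMatchings hE).1 hM
  have himg : M.image Prod.snd = Finset.univ := by
    apply Finset.eq_univ_of_card
    rw [Finset.card_image_of_injOn hM.injOn, hc, Fintype.card_fin]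
  have hex : ∀ j : Fin ℓ, ∃ c, (c, j) ∈ M := by
    intro j
    have : j ∈ M.image Prod.snd := himg ▸ Finset.mem_univ j
    obtain ⟨e, he, rfl⟩ := Finset.mem_image.1 this
    exact ⟨e.1, he⟩
  choose m hm using hex
  refine ⟨m, fun j => ?_⟩
  ext e
  rw [mem_edgesAt, mem_singleton]
  constructor
  · rintro ⟨he, hj⟩
    exact hM.injOn he (hm j) hj
  · rintro rfl
    exact ⟨hm j, rfl⟩

theorem mem_of_edgesAt {M : Finset (Edge n ℓ)} {m : Fin ℓ → Fin n}
    (hm : ∀ j, edgesAt M j = {(m j, j)}) (e : Edge n ℓ) : e ∈ M ↔ m e.2 = e.1 := by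
  have : e ∈ edgesAt M e.2 ↔ e ∈ M := by simp [mem_edgesAt]
  rw [← this, hm, mem_singleton, Prod.ext_iff]
  simp [eq_comm]

theorem maxMatchings_subset {M : Finset (Edge n ℓ)} (hM : M ∈ maxMatchings E) : M ⊆ E := by
  classical
  simp only [maxMatchings, mem_filter, mem_powerset] at hM
  exact hM.1

theorem maxMatchings_isMatching {M : Finset (Edge n ℓ)} (hM : M ∈ maxMatchings E) :
    IsMatching E M := by
  classical
  simp only [maxMatchings, mem_filter, mem_powerset] at hM
  exact hM.2.1

theorem score_eq_of_edgesAt (Q : EdgeMatrix n ℓ) {M N : Finset (Edge n ℓ)} {m m' : Fin ℓ → Fin n}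
    (hm : ∀ j, edgesAt M j = {(m j, j)}) (hm' : ∀ j, edgesAt N j = {(m' j, j)}) :
    score Q M N = (1 / (ℓ : ℝ)) * ∑ j, Q (m j, j) (m' j, j) := by
  simp [score, hm, hm']

theorem numDiff_eq_of_edgesAt {M N : Finset (Edge n ℓ)} {m m' : Fin ℓ → Fin n}
    (hm : ∀ j, edgesAt M j = {(m j, j)}) (hm' : ∀ j, edgesAt N j = {(m' j, j)}) :
    numDiff M N = (univ.filter (fun j => m j ≠ m' j)).card := by
  simp [numDiff, hm, hm']

/-! ### Preference matrices -/

theorem IsPreference.self {P : EdgeMatrix n ℓ} (hP : IsPreference E P) {e : Edge n ℓ}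
    (he : e ∈ E) : P e e = 1 / 2 := by
  have := hP.add_eq_one e e ⟨he, he, rfl⟩
  linarith

theorem score_swap (hℓ : 0 < ℓ) (hE : ∃ M, IsMatching E M ∧ M.card = ℓ) {P : EdgeMatrix n ℓ}
    (hP : IsPreference E P) {M N : Finset (Edge n ℓ)} (hM : M ∈ maxMatchings E)
    (hN : N ∈ maxMatchings E) : score P M N = 1 - score P N M := by
  obtain ⟨m, hm⟩ := exists_edgesAt_eq hE hM
  obtain ⟨m', hm'⟩ := exists_edgesAt_eq hE hN
  rw [score_eq_of_edgesAt P hm hm', score_eq_of_edgesAt P hm' hm]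
  have h : ∀ j, P (m j, j) (m' j, j) = 1 - P (m' j, j) (m j, j) := by
    intro j
    have := hP.add_eq_one (m j, j) (m' j, j)
      ⟨maxMatchings_subset hM ((mem_of_edgesAt hm _).2 rfl),
        maxMatchings_subset hN ((mem_of_edgesAt hm' _).2 rfl), rfl⟩
    linarith
  simp_rw [h]
  have : (ℓ : ℝ) ≠ 0 := by positivity
  rw [Finset.sum_sub_distrib]
  simp
  field_simp

theorem score_self (hℓ : 0 < ℓ) (hE : ∃ M, IsMatching E M ∧ M.card = ℓ) {P : EdgeMatrix n ℓ}
    (hP : IsPreference E P) {M : Finset (Edge n ℓ)} (hM : M ∈ maxMatchings E) :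
    score P M M = 1 / 2 := by
  have := score_swap hℓ hE hP hM hM
  linarith

theorem score_nonneg {P : EdgeMatrix n ℓ} (hP : ∀ e f, 0 ≤ P e f) (M N : Finset (Edge n ℓ)) :
    0 ≤ score P M N := by
  unfold score
  have : 0 ≤ ∑ j : Fin ℓ, ∑ e ∈ edgesAt M j, ∑ f ∈ edgesAt N j, P e f :=
    sum_nonneg fun j _ => sum_nonneg fun e _ => sum_nonneg fun f _ => hP e f
  positivity

theorem score_mono {P Q : EdgeMatrix n ℓ} (h : ∀ e f, P e f ≤ Q e f) (M N : Finset (Edge n ℓ)) :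
    score P M N ≤ score Q M N := by
  unfold score
  have : ∑ j : Fin ℓ, ∑ e ∈ edgesAt M j, ∑ f ∈ edgesAt N j, P e f ≤
      ∑ j : Fin ℓ, ∑ e ∈ edgesAt M j, ∑ f ∈ edgesAt N j, Q e f :=
    sum_le_sum fun j _ => sum_le_sum fun e _ => sum_le_sum fun f _ => h e f
  gcongr

/-! ### The bilinear form of a matrix -/

/-- `(1/ℓ) xᵀ Q y`. -/
noncomputable def bil (Q : EdgeMatrix n ℓ) (x y : Edge n ℓ → ℝ) : ℝ :=
  (1 / (ℓ : ℝ)) * ∑ e, ∑ f, x e * Q e f * y f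

theorem worstCase_eq (Q : EdgeMatrix n ℓ) (A R : Finset (Edge n ℓ)) (x : Edge n ℓ → ℝ) :
    worstCase E Q A R x = sInf ((fun y => bil Q x y) '' polytope E A R) := rfl

/-- The bilinear form runs over all pairs of edges, the score only over pairs at a common position;
`hQ` kills the difference. This links the values of the oracle to scores of matchings. -/
theorem bil_chi_chi (Q : EdgeMatrix n ℓ) (hQ : ∀ e f, e.2 ≠ f.2 → Q e f = 0)
    (M N : Finset (Edge n ℓ)) : bil Q (chi M) (chi N) = score Q M N := by
  unfold bil score
  congr 1
  have h1 : ∀ e, ∑ f, chi M e * Q e f * chi N f = chi M e * ∑ f ∈ edgesAt N e.2, Q e f := by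
    intro e
    rw [Finset.mul_sum, edgesAt, Finset.sum_filter, ← Finset.sum_filter_add_sum_filter_not univ (· ∈ N)]
    rw [Finset.sum_filter, Finset.sum_filter]
    rw [← Finset.sum_add_distrib]
    rw [← Finset.sum_subset (Finset.subset_univ N)]
    · refine Finset.sum_congr rfl fun f hf => ?_
      simp only [hf, if_true, chi, not_true, if_false, add_zero, mul_one]
      by_cases h : f.2 = e.2
      · simp [h]
      · simp [h, hQ e f (Ne.symm h)]
    · intro f _ hf
      simp [hf, chi]
  simp_rw [h1]
  have h2 : ∑ e, chi M e * ∑ f ∈ edgesAt N e.2, Q e f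
      = ∑ e ∈ M, ∑ f ∈ edgesAt N e.2, Q e f := by
    rw [← Finset.sum_subset (Finset.subset_univ M)]
    · exact Finset.sum_congr rfl fun e he => by simp [chi, he]
    · intro e _ he
      simp [chi, he]
  rw [h2, ← Finset.sum_fiberwise M Prod.snd]
  refine Finset.sum_congr rfl fun j _ => ?_
  refine Finset.sum_congr rfl fun e he => ?_
  rw [(Finset.mem_filter.1 he).2]

theorem bil_nonneg {Q : EdgeMatrix n ℓ} (hQ : ∀ e f, 0 ≤ Q e f) {x y : Edge n ℓ → ℝ}
    (hx : ∀ e, 0 ≤ x e) (hy : ∀ e, 0 ≤ y e) : 0 ≤ bil Q x y := by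
  unfold bil
  have : 0 ≤ ∑ e, ∑ f, x e * Q e f * y f :=
    sum_nonneg fun e _ => sum_nonneg fun f _ =>
      mul_nonneg (mul_nonneg (hx e) (hQ e f)) (hy f)
  positivity

theorem bil_mono {P Q : EdgeMatrix n ℓ} (h : ∀ e f, P e f ≤ Q e f) {x y : Edge n ℓ → ℝ}
    (hx : ∀ e, 0 ≤ x e) (hy : ∀ e, 0 ≤ y e) : bil P x y ≤ bil Q x y := by
  unfold bil
  have : ∑ e, ∑ f, x e * P e f * y f ≤ ∑ e, ∑ f, x e * Q e f * y f :=
    sum_le_sum fun e _ => sum_le_sum fun f _ =>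
      mul_le_mul_of_nonneg_right (mul_le_mul_of_nonneg_left (h e f) (hx e)) (hy f)
  gcongr

/-- Linearity in one argument, in the form in which `polytope_linear_le` and `polytope_linear_ge`
carry inequalities from the vertices to the polytope. The next lemma does this for the other
argument. -/
theorem bil_eq_dot_left (Q : EdgeMatrix n ℓ) (x y : Edge n ℓ → ℝ) :
    bil Q x y = ∑ e, x e * ((1 / (ℓ : ℝ)) * ∑ f, Q e f * y f) := by
  unfold bil
  simp only [Finset.mul_sum]
  exact Finset.sum_congr rfl fun e _ => Finset.sum_congr rfl fun f _ => by ring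

theorem bil_eq_dot_right (Q : EdgeMatrix n ℓ) (x y : Edge n ℓ → ℝ) :
    bil Q x y = ∑ f, y f * ((1 / (ℓ : ℝ)) * ∑ e, x e * Q e f) := by
  unfold bil
  rw [Finset.sum_comm]
  simp only [Finset.mul_sum]
  exact Finset.sum_congr rfl fun e _ => Finset.sum_congr rfl fun f _ => by ring

/-! ### The polytope -/

theorem chi_mem_polytope {A R M : Finset (Edge n ℓ)} (hM : M ∈ maxMatchings E) (hA : A ⊆ M)
    (hR : Disjoint R M) : chi M ∈ polytope E A R :=
  subset_convexHull ℝ _ ⟨M, hM, hA, hR, rfl⟩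

/-- A linear inequality that holds at the vertices holds on the polytope. -/
theorem polytope_linear_le {A R : Finset (Edge n ℓ)} (w : Edge n ℓ → ℝ) (c : ℝ)
    (h : ∀ M ∈ maxMatchings E, A ⊆ M → Disjoint R M → ∑ e, chi M e * w e ≤ c) {x : Edge n ℓ → ℝ}
    (hx : x ∈ polytope E A R) : ∑ e, x e * w e ≤ c := by
  have hconv : Convex ℝ {x : Edge n ℓ → ℝ | ∑ e, x e * w e ≤ c} := by
    refine convex_halfSpace_le ⟨fun x y => ?_, fun a x => ?_⟩ c
    · simp [add_mul, Finset.sum_add_distrib]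
    · simp [Finset.mul_sum, mul_assoc]
  refine convexHull_min ?_ hconv hx
  rintro _ ⟨M, hM, hA, hR, rfl⟩
  exact h M hM hA hR

theorem polytope_linear_ge {A R : Finset (Edge n ℓ)} (w : Edge n ℓ → ℝ) (c : ℝ)
    (h : ∀ M ∈ maxMatchings E, A ⊆ M → Disjoint R M → c ≤ ∑ e, chi M e * w e) {x : Edge n ℓ → ℝ}
    (hx : x ∈ polytope E A R) : c ≤ ∑ e, x e * w e := by
  have := polytope_linear_le (fun e => - w e) (-c) (fun M hM hA hR => by
    have := h M hM hA hR
    simpa using this) hx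
  simp at this
  exact this

theorem sum_chi_mul (M : Finset (Edge n ℓ)) (w : Edge n ℓ → ℝ) :
    ∑ e, chi M e * w e = ∑ e ∈ M, w e := by
  simp [chi]

theorem polytope_mono {A A' R R' : Finset (Edge n ℓ)}
    (h : ∀ M ∈ maxMatchings E, A ⊆ M → Disjoint R M → A' ⊆ M ∧ Disjoint R' M) :
    polytope E A R ⊆ polytope E A' R' := by
  refine convexHull_mono ?_
  rintro _ ⟨M, hM, hA, hR, rfl⟩
  exact ⟨M, hM, (h M hM hA hR).1, (h M hM hA hR).2, rfl⟩

theorem polytope_nonneg {A R : Finset (Edge n ℓ)} {x : Edge n ℓ → ℝ} (hx : x ∈ polytope E A R)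
    (e : Edge n ℓ) : 0 ≤ x e := by
  have := polytope_linear_ge (fun f => if f = e then 1 else 0) 0 (fun M _ _ _ => by
    rw [sum_chi_mul]
    exact Finset.sum_nonneg fun f _ => by split_ifs <;> norm_num) hx
  simpa using this

theorem polytope_sum_position (hE : ∃ M, IsMatching E M ∧ M.card = ℓ) {A R : Finset (Edge n ℓ)}
    {x : Edge n ℓ → ℝ} (hx : x ∈ polytope E A R) (j : Fin ℓ) :
    ∑ e, (if e.2 = j then x e else 0) = 1 := by
  have key : ∀ M ∈ maxMatchings E, ∑ e, chi M e * (if e.2 = j then 1 else 0) = (1 : ℝ) := by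
    intro M hM
    obtain ⟨m, hm⟩ := exists_edgesAt_eq hE hM
    rw [sum_chi_mul, ← Finset.sum_filter]
    have : (M.filter fun e => e.2 = j) = {(m j, j)} := hm j
    rw [this]
    simp
  have h1 := polytope_linear_le _ 1 (fun M hM _ _ => (key M hM).le) hx
  have h2 := polytope_linear_ge _ 1 (fun M hM _ _ => (key M hM).ge) hx
  have := le_antisymm h1 h2
  simpa using this

theorem polytope_eq_zero {A R : Finset (Edge n ℓ)} {x : Edge n ℓ → ℝ} (hx : x ∈ polytope E A R)
    {e : Edge n ℓ} (h : ∀ M ∈ maxMatchings E, A ⊆ M → Disjoint R M → e ∉ M) : x e = 0 := by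
  refine le_antisymm ?_ (polytope_nonneg hx e)
  have := polytope_linear_le (fun f => if f = e then 1 else 0) 0 (fun M hM hA hR => by
    rw [sum_chi_mul]
    simp [h M hM hA hR]) hx
  simpa using this

/-- Over a polytope on which two matrices differ by at most `w` on the undecided edges, their
bilinear forms differ by at most `w`. -/
theorem bil_le_bil_add (hℓ : 0 < ℓ) (hE : ∃ M, IsMatching E M ∧ M.card = ℓ)
    {A R : Finset (Edge n ℓ)} {x y : Edge n ℓ → ℝ} (hx : x ∈ polytope E A R)
    (hy : y ∈ polytope E A R) {P Q : EdgeMatrix n ℓ} {w : ℝ} (hw : 0 ≤ w)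
    (hinc : ∀ e f, ¬ Comparable E e f → Q e f = P e f)
    (hdiag : ∀ e ∈ E, Q e e = P e e)
    (hclose : ∀ e f, Comparable E e f → e ≠ f → e ∈ undecided E A R → f ∈ undecided E A R →
      Q e f ≤ P e f + w) :
    bil Q x y ≤ bil P x y + w := by
  -- Each position carries mass 1 in both vectors, so the weights of the same-position pairs have
  -- total ℓ. This cancels the factor 1/ℓ of the bilinear form.
  have hsum : ∑ e : Edge n ℓ, ∑ f : Edge n ℓ, (if f.2 = e.2 then x e * y f else 0) = (ℓ : ℝ) := by
    have h1 : ∀ e : Edge n ℓ, ∑ f : Edge n ℓ, (if f.2 = e.2 then x e * y f else 0) = x e := by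
      intro e
      have := polytope_sum_position hE hy e.2
      calc _ = x e * ∑ f : Edge n ℓ, (if f.2 = e.2 then y f else 0) := by
            rw [Finset.mul_sum]
            exact Finset.sum_congr rfl fun f _ => by split_ifs <;> simp
        _ = x e := by rw [this, mul_one]
    simp_rw [h1]
    have h2 : ∑ e, x e = ∑ j : Fin ℓ, ∑ e : Edge n ℓ, (if e.2 = j then x e else 0) := by
      rw [Finset.sum_comm]
      exact Finset.sum_congr rfl fun e _ => by simp
    rw [h2]
    simp [polytope_sum_position hE hx]
  have hterm : ∀ e f, x e * Q e f * y f ≤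
      x e * P e f * y f + w * (if f.2 = e.2 then x e * y f else 0) := by
    intro e f
    have hxe := polytope_nonneg hx e
    have hyf := polytope_nonneg hy f
    have htriv : x e * Q e f * y f ≤ x e * P e f * y f →
        x e * Q e f * y f ≤ x e * P e f * y f + w * (if f.2 = e.2 then x e * y f else 0) := by
      intro h
      have : 0 ≤ w * (if f.2 = e.2 then x e * y f else 0) := by
        apply mul_nonneg hw
        split_ifs
        · positivity
        · exact le_rfl
      linarith
    by_cases hc : Comparable E e f
    swap
    · exact htriv (by rw [hinc e f hc])
    by_cases hef : e = f
    · subst hef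
      exact htriv (by rw [hdiag e hc.1])
    -- If both edges occur in feasible matchings, neither is rejected; neither is accepted, as it
    -- would share a feasible matching with the other edge at the same position. So a pair of
    -- distinct edges carries weight only if both are undecided.
    by_cases hfeas : (∃ M ∈ maxMatchings E, A ⊆ M ∧ Disjoint R M ∧ e ∈ M) ∧
        (∃ M ∈ maxMatchings E, A ⊆ M ∧ Disjoint R M ∧ f ∈ M)
    · obtain ⟨⟨M, hM, hAM, hRM, heM⟩, ⟨N, hN, hAN, hRN, hfN⟩⟩ := hfeas
      have heA : e ∉ A := fun h =>
        ((maxMatchings_isMatching hN).2 e (hAN h) f hfN hef).2 hc.2.2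
      have hfA : f ∉ A := fun h =>
        ((maxMatchings_isMatching hM).2 e heM f (hAM h) hef).2 hc.2.2
      have heR : e ∉ R := fun h => Finset.disjoint_left.1 hRM h heM
      have hfR : f ∉ R := fun h => Finset.disjoint_left.1 hRN h hfN
      have := hclose e f hc hef (by simp [undecided, hc.1, heA, heR])
        (by simp [undecided, hc.2.1, hfA, hfR])
      rw [if_pos hc.2.2.symm]
      have : x e * Q e f * y f ≤ x e * (P e f + w) * y f := by gcongr
      linarith
    · apply htriv
      by_cases h : ∃ M ∈ maxMatchings E, A ⊆ M ∧ Disjoint R M ∧ e ∈ M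
      · have : y f = 0 := polytope_eq_zero hy fun M hM hA hR hf => hfeas ⟨h, M, hM, hA, hR, hf⟩
        simp [this]
      · have : x e = 0 := polytope_eq_zero hx fun M hM hA hR hf => h ⟨M, hM, hA, hR, hf⟩
        simp [this]
  have hle : ∑ e, ∑ f, x e * Q e f * y f ≤ ∑ e, ∑ f, x e * P e f * y f + w * ℓ := by
    calc ∑ e, ∑ f, x e * Q e f * y f
        ≤ ∑ e, ∑ f, (x e * P e f * y f + w * (if f.2 = e.2 then x e * y f else 0)) :=
          sum_le_sum fun e _ => sum_le_sum fun f _ => hterm e f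
      _ = _ := by
        simp_rw [Finset.sum_add_distrib, ← Finset.mul_sum]
        rw [hsum]
  have hl : (0 : ℝ) < ℓ := by exact_mod_cast hℓ
  unfold bil
  calc _ ≤ (1 / (ℓ : ℝ)) * (∑ e, ∑ f, x e * P e f * y f + w * ℓ) := by gcongr
    _ = _ := by field_simp

/-! ### The inner minimum -/

/-- Nonnegative entries bound the values below by 0, so the real infimum is a genuine lower bound
and not a default value. -/
theorem worstCase_le {A R A' R' : Finset (Edge n ℓ)} {Q : EdgeMatrix n ℓ} (hQ : ∀ e f, 0 ≤ Q e f)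
    {x y : Edge n ℓ → ℝ} (hx : x ∈ polytope E A' R') (hy : y ∈ polytope E A R) :
    worstCase E Q A R x ≤ bil Q x y := by
  rw [worstCase_eq]
  refine csInf_le ⟨0, ?_⟩ ⟨y, hy, rfl⟩
  rintro _ ⟨z, hz, rfl⟩
  exact bil_nonneg hQ (polytope_nonneg hx) (polytope_nonneg hz)

theorem le_worstCase {A R : Finset (Edge n ℓ)} {Q : EdgeMatrix n ℓ} {x : Edge n ℓ → ℝ} {c : ℝ}
    (hne : (polytope E A R).Nonempty) (h : ∀ y ∈ polytope E A R, c ≤ bil Q x y) :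
    c ≤ worstCase E Q A R x := by
  rw [worstCase_eq]
  refine le_csInf (hne.image _) ?_
  rintro _ ⟨z, hz, rfl⟩
  exact h z hz

theorem worstCase_le_add {A R A' R' : Finset (Edge n ℓ)} {P Q : EdgeMatrix n ℓ}
    (hQ : ∀ e f, 0 ≤ Q e f) {x : Edge n ℓ → ℝ} (hx : x ∈ polytope E A' R') {w : ℝ}
    (hne : (polytope E A R).Nonempty)
    (h : ∀ y ∈ polytope E A R, bil Q x y ≤ bil P x y + w) :
    worstCase E Q A R x ≤ worstCase E P A R x + w := by
  have : worstCase E Q A R x - w ≤ worstCase E P A R x :=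
    le_worstCase hne fun y hy => by linarith [h y hy, worstCase_le hQ hx hy]
  linarith

theorem worstCase_mono {A R A' R' : Finset (Edge n ℓ)} {P Q : EdgeMatrix n ℓ}
    (hP : ∀ e f, 0 ≤ P e f) (h : ∀ e f, P e f ≤ Q e f) {x : Edge n ℓ → ℝ}
    (hx : x ∈ polytope E A' R') (hne : (polytope E A R).Nonempty) :
    worstCase E P A R x ≤ worstCase E Q A R x := by
  have := worstCase_le_add (w := 0) hP hx hne fun y hy => by
    simpa using bil_mono h (polytope_nonneg hx) (polytope_nonneg hy)
  simpa using this

/-! ### Comparing two calls of the oracle -/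

/-- If one call of the oracle beats another one by more than the accuracy, then some point of the
first polytope is better than all the points of the second. -/
theorem IsOracle.exists_of_lt {O : Oracle n ℓ} (hO : IsOracle E O) {ε : ℝ} (hε : 0 < ε)
    {A R Aw Rw Al Rl : Finset (Edge n ℓ)} {L U : EdgeMatrix n ℓ}
    (hL : ∀ e f, 0 ≤ L e f ∧ L e f ≤ 1) (hU : ∀ e f, 0 ≤ U e f ∧ U e f ≤ 1)
    (hsub : polytope E Aw Rw ⊆ polytope E A R)
    (h : O ε Al Rl A R U + (ε : WithBot ℝ) < O ε Aw Rw A R L) :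
    ∃ x₀ ∈ polytope E Aw Rw, ∀ x ∈ polytope E Al Rl,
      worstCase E U A R x < worstCase E L A R x₀ := by
  -- An empty polytope would make the larger side `⊥`, and nothing lies below `⊥`.
  have hw : (polytope E Aw Rw).Nonempty := by
    by_contra hne
    rw [Set.not_nonempty_iff_eq_empty] at hne
    rw [hO.infeasible ε Aw Rw A R L hne] at h
    exact not_lt_bot h
  obtain ⟨x₀, hx₀, hval, -⟩ := hO.feasible ε Aw Rw A R L hε hL hw (hw.mono hsub)
  refine ⟨x₀, hx₀, fun x hx => ?_⟩
  obtain ⟨x₁, hx₁, hval₁, hopt⟩ := hO.feasible ε Al Rl A R U hε hU ⟨x, hx⟩ (hw.mono hsub)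
  rw [hval, hval₁, ← WithBot.coe_add, WithBot.coe_lt_coe] at h
  linarith [hopt x hx]

/-- A call of the oracle beats another one by more than the accuracy `ε` if some point of the first
polytope is better by more than `2 ε` than all the points of the second. -/
theorem IsOracle.lt_of_exists {O : Oracle n ℓ} (hO : IsOracle E O) {ε : ℝ} (hε : 0 < ε)
    {A R Aw Rw Al Rl : Finset (Edge n ℓ)} {L U : EdgeMatrix n ℓ}
    (hL : ∀ e f, 0 ≤ L e f ∧ L e f ≤ 1) (hU : ∀ e f, 0 ≤ U e f ∧ U e f ≤ 1)
    (hne : (polytope E A R).Nonempty) {x : Edge n ℓ → ℝ} (hx : x ∈ polytope E Aw Rw)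
    (h : ∀ x' ∈ polytope E Al Rl, worstCase E U A R x' + 2 * ε < worstCase E L A R x) :
    O ε Al Rl A R U + (ε : WithBot ℝ) < O ε Aw Rw A R L := by
  obtain ⟨x₀, hx₀, hval, hopt⟩ := hO.feasible ε Aw Rw A R L hε hL ⟨x, hx⟩ hne
  rw [hval]
  -- Without a feasible competitor the other call returns `⊥`, which every real value beats.
  rcases (polytope E Al Rl).eq_empty_or_nonempty with hl | hl
  · rw [hO.infeasible ε Al Rl A R U hl, WithBot.bot_add]
    exact WithBot.bot_lt_coe _
  · obtain ⟨x₁, hx₁, hval₁, -⟩ := hO.feasible ε Al Rl A R U hε hU hl hne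
    rw [hval₁, ← WithBot.coe_add, WithBot.coe_lt_coe]
    linarith [hopt x hx, h x₁ hx₁]

end CPEDB

end

/-! ### Empirical statistics and their confidence bounds -/

section

open Finset

namespace CPEDB

variable {n ℓ : ℕ} {E : Finset (Edge n ℓ)}

/-! ### Statistics of a stack of outcomes -/

/-- The number of successes among the first `T` outcomes. -/
def winCount (o : ℕ → Bool) (T : ℕ) : ℕ := ((range T).filter (fun i => o i = true)).card

theorem winCount_le (o : ℕ → Bool) (T : ℕ) : winCount o T ≤ T :=
  (card_filter_le _ _).trans (card_range T).le

theorem winCount_succ (o : ℕ → Bool) (T : ℕ) :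
    winCount o (T + 1) = winCount o T + if o T = true then 1 else 0 := by
  unfold winCount
  rw [range_add_one, filter_insert]
  split_ifs with h
  · rw [card_insert_of_notMem (by simp)]
  · simp

theorem winCount_not (o : ℕ → Bool) (T : ℕ) : winCount (fun i => !o i) T + winCount o T = T := by
  induction T with
  | zero => simp [winCount]
  | succ T ih =>
    rw [winCount_succ, winCount_succ]
    cases h : o T <;> simp <;> omega

theorem winCount_eq_sum (o : ℕ → Bool) (T : ℕ) :
    (winCount o T : ℝ) = ∑ i ∈ range T, if o i = true then 1 else 0 := by
  simp [winCount]

theorem outcome_swap (x : Index n ℓ → Bool) (k : ℕ) (ph : Phase) {e f : Edge n ℓ} (h : e.1 ≠ f.1)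
    (i : ℕ) : outcome x k ph (f, e) i = !outcome x k ph (e, f) i := by
  unfold outcome
  rcases lt_or_gt_of_ne h with h | h
  · simp [h, h.not_gt]
  · simp [h, h.not_gt]

/-- The statistics count the first outcomes of the stack of every duel. -/
structure Stats.Records (s : Stats n ℓ) (x : Index n ℓ → Bool) (k : ℕ) (ph : Phase) : Prop where
  symm : ∀ e f, s.count e f = s.count f e
  wins : ∀ e f, e.1 ≠ f.1 → s.wins e f = winCount (outcome x k ph (e, f)) (s.count e f)

theorem Stats.records_empty (x : Index n ℓ → Bool) (k : ℕ) (ph : Phase) :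
    (Stats.empty : Stats n ℓ).Records x k ph :=
  ⟨fun _ _ => rfl, fun _ _ _ => by simp [Stats.empty, winCount]⟩

/-- The outcome read has the present count as its index, so it is the next unread one of the stack.
As the candidates differ, a pair matches the recorded duel in at most one orientation, and the
reversed pair sees the negated outcome. -/
theorem Stats.Records.record {s : Stats n ℓ} {x : Index n ℓ → Bool} {k : ℕ} {ph : Phase}
    (h : s.Records x k ph) {d : Edge n ℓ × Edge n ℓ} (hd : d.1.1 ≠ d.2.1) :
    (s.record d (outcome x k ph d (s.count d.1 d.2))).Records x k ph := by
  obtain ⟨a, b⟩ := d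
  have hab : a ≠ b := fun h => hd (by rw [h])
  refine ⟨fun e f => ?_, fun e f hef => ?_⟩
  · simp only [Stats.record, h.symm e f, or_comm]
  · simp only [Stats.record]
    rw [h.wins e f hef]
    by_cases h1 : (e, f) = (a, b)
    · obtain ⟨rfl, rfl⟩ := Prod.mk.inj h1
      have h2 : (f, e) ≠ (e, f) := fun h => hab (Prod.mk.inj h).2
      simp [h2, winCount_succ]
    · by_cases h2 : (f, e) = (a, b)
      · obtain ⟨rfl, rfl⟩ := Prod.mk.inj h2
        have hsw := outcome_swap x k ph hd (s.count f e)
        rw [if_pos (Or.inr rfl : (e, f) = (f, e) ∨ (f, e) = (f, e)), winCount_succ, h.symm e f, hsw]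
        simp [h1]
      · simp [h1, h2]

theorem Stats.mean_nonneg {s : Stats n ℓ} (e f : Edge n ℓ) : 0 ≤ s.mean e f := by
  unfold Stats.mean
  positivity

theorem Stats.Records.mean_le_one {s : Stats n ℓ} {x : Index n ℓ → Bool} {k : ℕ} {ph : Phase}
    (h : s.Records x k ph) {e f : Edge n ℓ} (hef : e.1 ≠ f.1) : s.mean e f ≤ 1 := by
  unfold Stats.mean
  apply div_le_one_of_le₀ _ (by positivity)
  rw [h.wins e f hef]
  exact_mod_cast winCount_le _ _

theorem Comparable.fst_ne {e f : Edge n ℓ} (h : Comparable E e f) (hef : e ≠ f) : e.1 ≠ f.1 :=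
  fun h1 => hef (Prod.ext h1 h.2.2)

theorem Comparable.symm {e f : Edge n ℓ} (h : Comparable E e f) : Comparable E f e :=
  ⟨h.2.1, h.1, h.2.2.symm⟩

theorem radius_nonneg (K δ : ℝ) (t T : ℕ) : 0 ≤ radius K δ t T := Real.sqrt_nonneg _

theorem upperBounds_mem {s : Stats n ℓ} (δ : ℝ) (t : ℕ) (e f : Edge n ℓ) :
    0 ≤ upperBounds E δ t s e f ∧ upperBounds E δ t s e f ≤ 1 := by
  unfold upperBounds
  split_ifs
  · norm_num
  · norm_num
  · refine ⟨le_min zero_le_one ?_, min_le_left _ _⟩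
    exact add_nonneg (Stats.mean_nonneg e f) (radius_nonneg _ _ _ _)
  · norm_num

/-- The upper bounds are truncated at 1, but the lower bounds are not; for them the mean has to be
at most 1, which needs genuine statistics. -/
theorem Stats.Records.lowerBounds_mem {s : Stats n ℓ} {x : Index n ℓ → Bool} {k : ℕ} {ph : Phase}
    (h : s.Records x k ph) (δ : ℝ) (t : ℕ) (e f : Edge n ℓ) :
    0 ≤ lowerBounds E δ t s e f ∧ lowerBounds E δ t s e f ≤ 1 := by
  unfold lowerBounds
  split_ifs with h1 h2 h3
  · norm_num
  · norm_num
  · refine ⟨le_max_left _ _, max_le zero_le_one ?_⟩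
    have := h.mean_le_one (Comparable.fst_ne h1 h2)
    linarith [radius_nonneg (numDuels E) δ t (s.count e f)]
  · norm_num

theorem Stats.Records.lowerBounds_le_upperBounds {s : Stats n ℓ} {x : Index n ℓ → Bool} {k : ℕ}
    {ph : Phase} (h : s.Records x k ph) (δ : ℝ) (t : ℕ) (e f : Edge n ℓ) :
    lowerBounds E δ t s e f ≤ upperBounds E δ t s e f := by
  unfold lowerBounds upperBounds
  split_ifs with h1 h2 h3
  · exact le_rfl
  · exact zero_le_one
  · have h4 := h.mean_le_one (Comparable.fst_ne h1 h2)
    have h5 := Stats.mean_nonneg (s := s) e f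
    have h6 := radius_nonneg (numDuels E) δ t (s.count e f)
    refine max_le (le_min zero_le_one ?_) (le_min ?_ ?_) <;> linarith
  · exact le_rfl

/-- All the empirical means of the duels of copy `k` in phase `ph` are within their confidence
radius of the preference probabilities. -/
def Concentrated (E : Finset (Edge n ℓ)) (P : EdgeMatrix n ℓ) (δ : ℝ) (x : Index n ℓ → Bool)
    (k : ℕ) (ph : Phase) : Prop :=
  ∀ d, IsDuel E d → ∀ t T : ℕ, 1 ≤ T → T ≤ t →
    |(winCount (fun i => x (k, ph, d, i)) T : ℝ) / T - P d.1 d.2| ≤ radius (numDuels E) δ t T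

section Bounds

variable {P : EdgeMatrix n ℓ} {δ : ℝ} {x : Index n ℓ → Bool} {k : ℕ} {ph : Phase}

/-- `Concentrated` speaks only of the orientation with the smaller candidate index first. In the
other one the mean and the probability are both replaced by their complements, which preserves the
deviation. -/
theorem Concentrated.abs_mean_sub_le (hc : Concentrated E P δ x k ph) (hP : IsPreference E P)
    {s : Stats n ℓ} (h : s.Records x k ph) {e f : Edge n ℓ} (hef : Comparable E e f) (hne : e ≠ f)
    {t : ℕ} (h1 : s.count e f ≠ 0) (ht : s.count e f ≤ t) :
    |s.mean e f - P e f| ≤ radius (numDuels E) δ t (s.count e f) := by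
  have hfst := hef.fst_ne hne
  unfold Stats.mean
  rw [h.wins e f hfst]
  rcases lt_or_gt_of_ne hfst with hlt | hgt
  · have := hc (e, f) ⟨hef, hlt⟩ t (s.count e f) (Nat.one_le_iff_ne_zero.2 h1) ht
    have ho : outcome x k ph (e, f) = fun i => x (k, ph, (e, f), i) := by
      funext i
      simp [outcome, hlt]
    rw [ho]
    exact this
  · have hcon := hc (f, e) ⟨hef.symm, hgt⟩ t (s.count e f) (Nat.one_le_iff_ne_zero.2 h1) ht
    have ho : outcome x k ph (e, f) = fun i => !x (k, ph, (f, e), i) := by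
      funext i
      simp [outcome, hgt.not_gt]
    rw [ho]
    have hw := winCount_not (fun i => x (k, ph, (f, e), i)) (s.count e f)
    have hw' : (winCount (fun i => !x (k, ph, (f, e), i)) (s.count e f) : ℝ)
        = s.count e f - winCount (fun i => x (k, ph, (f, e), i)) (s.count e f) := by
      rw [eq_sub_iff_add_eq]
      exact_mod_cast hw
    have hpos : (s.count e f : ℝ) ≠ 0 := by exact_mod_cast h1
    rw [hw', sub_div, div_self hpos]
    have hadd := hP.add_eq_one e f hef
    have : 1 - (winCount (fun i => x (k, ph, (f, e), i)) (s.count e f) : ℝ) / s.count e f - P e f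
        = -((winCount (fun i => x (k, ph, (f, e), i)) (s.count e f) : ℝ) / s.count e f - P f e) := by
      linarith
    rw [this, abs_neg]
    exact hcon

theorem Concentrated.le_upperBounds (hc : Concentrated E P δ x k ph) (hP : IsPreference E P)
    {s : Stats n ℓ} (h : s.Records x k ph) {t : ℕ}
    (ht : ∀ e f, Comparable E e f → e ≠ f → s.count e f ≤ t) (e f : Edge n ℓ) :
    P e f ≤ upperBounds E δ t s e f := by
  unfold upperBounds
  split_ifs with h1 h2 h3
  · subst h2
    exact (hP.self h1.1).le
  · exact hP.le_one e f
  · have := hc.abs_mean_sub_le hP h h1 h2 h3 (ht e f h1 h2)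
    rw [abs_le] at this
    exact le_min (hP.le_one e f) (by linarith)
  · exact (hP.eq_zero e f h1).le

theorem Concentrated.lowerBounds_le (hc : Concentrated E P δ x k ph) (hP : IsPreference E P)
    {s : Stats n ℓ} (h : s.Records x k ph) {t : ℕ}
    (ht : ∀ e f, Comparable E e f → e ≠ f → s.count e f ≤ t) (e f : Edge n ℓ) :
    lowerBounds E δ t s e f ≤ P e f := by
  unfold lowerBounds
  split_ifs with h1 h2 h3
  · subst h2
    exact (hP.self h1.1).ge
  · exact hP.nonneg e f
  · have := hc.abs_mean_sub_le hP h h1 h2 h3 (ht e f h1 h2)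
    rw [abs_le] at this
    exact max_le (hP.nonneg e f) (by linarith)
  · exact (hP.eq_zero e f h1).ge

/-- One radius is added by the bound itself, and the mean may exceed the true probability by another
one. -/
theorem Concentrated.upperBounds_le (hc : Concentrated E P δ x k ph) (hP : IsPreference E P)
    {s : Stats n ℓ} (h : s.Records x k ph) {e f : Edge n ℓ} (hef : Comparable E e f) (hne : e ≠ f)
    {t : ℕ} (h1 : s.count e f ≠ 0) (ht : s.count e f ≤ t) :
    upperBounds E δ t s e f ≤ P e f + 2 * radius (numDuels E) δ t (s.count e f) := by
  have := hc.abs_mean_sub_le hP h hef hne h1 ht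
  rw [abs_le] at this
  unfold upperBounds
  rw [if_neg (not_not.2 hef), if_neg hne, if_neg h1]
  exact (min_le_right _ _).trans (by linarith)

theorem Concentrated.le_lowerBounds (hc : Concentrated E P δ x k ph) (hP : IsPreference E P)
    {s : Stats n ℓ} (h : s.Records x k ph) {e f : Edge n ℓ} (hef : Comparable E e f) (hne : e ≠ f)
    {t : ℕ} (h1 : s.count e f ≠ 0) (ht : s.count e f ≤ t) :
    P e f ≤ lowerBounds E δ t s e f + 2 * radius (numDuels E) δ t (s.count e f) := by
  have := hc.abs_mean_sub_le hP h hef hne h1 ht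
  rw [abs_le] at this
  unfold lowerBounds
  rw [if_neg (not_not.2 hef), if_neg hne, if_neg h1]
  have := le_max_right 0 (s.mean e f - radius (numDuels E) δ t (s.count e f))
  linarith

end Bounds

theorem upperBounds_eq_zero {s : Stats n ℓ} {δ : ℝ} {t : ℕ} {e f : Edge n ℓ}
    (h : ¬ Comparable E e f) : upperBounds E δ t s e f = 0 := by
  simp [upperBounds, h]

theorem lowerBounds_eq_zero {s : Stats n ℓ} {δ : ℝ} {t : ℕ} {e f : Edge n ℓ}
    (h : ¬ Comparable E e f) : lowerBounds E δ t s e f = 0 := by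
  simp [lowerBounds, h]

theorem upperBounds_self {s : Stats n ℓ} {δ : ℝ} {t : ℕ} {e : Edge n ℓ} (h : e ∈ E) :
    upperBounds E δ t s e e = 1 / 2 := by
  simp [upperBounds, Comparable, h]

theorem lowerBounds_self {s : Stats n ℓ} {δ : ℝ} {t : ℕ} {e : Edge n ℓ} (h : e ∈ E) :
    lowerBounds E δ t s e e = 1 / 2 := by
  simp [lowerBounds, Comparable, h]

end CPEDB

end

/-! ### Steps of a single copy, and soundness of its answer -/

section

open Finset

namespace CPEDB

variable {n ℓ : ℕ}

/-! ### The next suspension point of a copy -/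

theorem VState.settle_eq_iterate (I : Input n ℓ) (δ : ℝ) (v : VState n ℓ) :
    ∃ r, v.settle I δ = (VState.silent I δ)^[r] v := by
  unfold VState.settle
  split_ifs with h
  · exact ⟨_, rfl⟩
  · exact ⟨0, rfl⟩

theorem VState.settle_ready {I : Input n ℓ} {δ : ℝ} {v : VState n ℓ}
    (h : ∃ r : ℕ, ((VState.silent I δ)^[r] v).Ready I δ) : (v.settle I δ).Ready I δ := by
  unfold VState.settle
  classical
  rw [dif_pos h]
  exact Nat.find_spec h

/-- `settle` is always an iterate of `silent`, with zero steps for a run that never becomes ready,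
so invariants pass through it without a termination proof. -/
theorem VState.settle_induction {I : Input n ℓ} {δ : ℝ} {p : VState n ℓ → Prop}
    (hp : ∀ v, p v → p (v.silent I δ)) {v : VState n ℓ} (hv : p v) : p (v.settle I δ) := by
  obtain ⟨r, hr⟩ := VState.settle_eq_iterate I δ v
  rw [hr]
  clear hr
  induction r with
  | zero => exact hv
  | succ r ih =>
    rw [Function.iterate_succ_apply']
    exact hp _ ih

theorem VState.resume_of_request {I : Input n ℓ} {δ : ℝ} {x : Index n ℓ → Bool} {k : ℕ}
    {v : VState n ℓ} {ph : Phase} {d : Edge n ℓ × Edge n ℓ} {i : ℕ}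
    (h : (v.settle I δ).request I δ = some (ph, d, i)) :
    v.resume I δ x k = ((v.settle I δ).observe I δ (outcome x k ph d i), 1) := by
  unfold VState.resume
  rw [h]

theorem VState.resume_of_none {I : Input n ℓ} {δ : ℝ} {x : Index n ℓ → Bool} {k : ℕ}
    {v : VState n ℓ} (h : (v.settle I δ).request I δ = none) :
    v.resume I δ x k = (v.settle I δ, 0) := by
  unfold VState.resume
  rw [h]

theorem VState.resume_snd_le (I : Input n ℓ) (δ : ℝ) (x : Index n ℓ → Bool) (k : ℕ)
    (v : VState n ℓ) : (v.resume I δ x k).2 ≤ 1 := by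
  unfold VState.resume
  split <;> simp

/-! ### The duels of the verification loop -/

theorem IsArgmax.mem {α β : Type} [LE β] {pick : Finset α → (α → β) → α} (h : IsArgmax pick)
    {s : Finset α} (g : α → β) (hs : s.Nonempty) : pick s g ∈ s := (h s g hs).1

theorem IsArgmax.le {α β : Type} [LE β] {pick : Finset α → (α → β) → α} (h : IsArgmax pick)
    {s : Finset α} (g : α → β) {y : α} (hy : y ∈ s) : g y ≤ g (pick s g) := (h s g ⟨y, hy⟩).2 y hy

section Verify

variable {I : Input n ℓ} {δ : ℝ} {t : ℕ} {Mhat : Finset (Edge n ℓ)} {s : Stats n ℓ}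

theorem challenger_spec (hI : I.Valid) (h : ¬ Confirmed I δ t Mhat s) :
    challenger I δ t Mhat s ∈ maxMatchings I.E ∧ challenger I δ t Mhat s ≠ Mhat ∧
      1 / 2 < score (upperBounds I.E δ t s) (challenger I δ t Mhat s) Mhat := by
  classical
  unfold Confirmed at h
  push Not at h
  obtain ⟨M, hM, hne, hlt⟩ := h
  have hmem : M ∈ (maxMatchings I.E).filter (fun M => M ≠ Mhat) := mem_filter.2 ⟨hM, hne⟩
  have h1 := hI.argmaxM.mem (fun M => score (upperBounds I.E δ t s) M Mhat) ⟨M, hmem⟩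
  have h2 := hI.argmaxM.le (fun M => score (upperBounds I.E δ t s) M Mhat) hmem
  have h3 := mem_filter.1 h1
  have hv : challenger I δ t Mhat s = I.argmaxM ((maxMatchings I.E).filter (fun M => M ≠ Mhat))
      (fun M => score (upperBounds I.E δ t s) M Mhat) := by
    unfold challenger
    congr!
  rw [hv]
  exact ⟨h3.1, h3.2, hlt.trans_le h2⟩

/-- Two distinct maximum matchings are distinct functions on the positions, so they differ
somewhere; the set of admissible duels is nonempty and the argmax rule applies. -/
theorem verifyDuel_spec (hI : I.Valid) (hM : Mhat ∈ maxMatchings I.E)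
    (h : ¬ Confirmed I δ t Mhat s) :
    ((verifyDuel I δ t Mhat s).1 ∈ challenger I δ t Mhat s ∧
      (verifyDuel I δ t Mhat s).1 ∉ Mhat ∧ (verifyDuel I δ t Mhat s).2 ∈ Mhat ∧
      (verifyDuel I δ t Mhat s).2 ∉ challenger I δ t Mhat s ∧
      (verifyDuel I δ t Mhat s).1.2 = (verifyDuel I δ t Mhat s).2.2) ∧
    ∀ e f, e ∈ challenger I δ t Mhat s → e ∉ Mhat → f ∈ Mhat → f ∉ challenger I δ t Mhat s →
      e.2 = f.2 → radiusExt (numDuels I.E) δ t (s.count e f) ≤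
        radiusExt (numDuels I.E) δ t
          (s.count (verifyDuel I δ t Mhat s).1 (verifyDuel I δ t Mhat s).2) := by
  classical
  obtain ⟨hC, hne, -⟩ := challenger_spec hI h
  have hE := hI.exists_matching
  obtain ⟨c, hc⟩ := exists_edgesAt_eq hE hC
  obtain ⟨m, hm⟩ := exists_edgesAt_eq hE hM
  set C := challenger I δ t Mhat s with hCdef
  have hmem : ∀ e f : Edge n ℓ,
      (e, f) ∈ ((C \ Mhat) ×ˢ (Mhat \ C)).filter (fun d => d.1.2 = d.2.2) ↔
      (e ∈ C ∧ e ∉ Mhat ∧ f ∈ Mhat ∧ f ∉ C ∧ e.2 = f.2) := by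
    intro e f
    simp only [mem_filter, mem_product, mem_sdiff]
    tauto
  have hex : (((C \ Mhat) ×ˢ (Mhat \ C)).filter (fun d => d.1.2 = d.2.2)).Nonempty := by
    by_contra hempty
    apply hne
    have hall : ∀ j, c j = m j := by
      intro j
      by_contra hj
      refine hempty ⟨((c j, j), (m j, j)), (hmem _ _).2 ?_⟩
      simp only [mem_of_edgesAt hc, mem_of_edgesAt hm]
      simp [hj, Ne.symm hj]
    ext e
    rw [mem_of_edgesAt hc, mem_of_edgesAt hm, hall]
  have h1 := hI.argmaxD.mem (fun d => radiusExt (numDuels I.E) δ t (s.count d.1 d.2)) hex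
  have hv : verifyDuel I δ t Mhat s = I.argmaxD
      (((C \ Mhat) ×ˢ (Mhat \ C)).filter (fun d => d.1.2 = d.2.2))
      (fun d => radiusExt (numDuels I.E) δ t (s.count d.1 d.2)) := by
    unfold verifyDuel
    congr!
  rw [hv]
  refine ⟨(hmem _ _).1 h1, fun e f h1 h2 h3 h4 h5 => ?_⟩
  exact hI.argmaxD.le (fun d => radiusExt (numDuels I.E) δ t (s.count d.1 d.2))
    ((hmem e f).2 ⟨h1, h2, h3, h4, h5⟩)

theorem verifyDuel_comparable (hI : I.Valid) (hM : Mhat ∈ maxMatchings I.E)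
    (h : ¬ Confirmed I δ t Mhat s) :
    Comparable I.E (verifyDuel I δ t Mhat s).1 (verifyDuel I δ t Mhat s).2 ∧
      (verifyDuel I δ t Mhat s).1 ≠ (verifyDuel I δ t Mhat s).2 := by
  obtain ⟨⟨h1, h2, h3, h4, h5⟩, -⟩ := verifyDuel_spec hI hM h
  refine ⟨⟨maxMatchings_subset (challenger_spec hI h).1 h1, maxMatchings_subset hM h3, h5⟩, ?_⟩
  intro heq
  exact h2 (heq ▸ h3)

end Verify

/-! ### The set of accepted edges is a matching -/

theorem accuracy_pos (t : ℕ) : 0 < accuracy t := by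
  unfold accuracy
  positivity

section Round

variable {I : Input n ℓ} {t : ℕ} {A R : Finset (Edge n ℓ)} {s : Stats n ℓ} {e : Edge n ℓ}

theorem polytope_include_subset (E A R : Finset (Edge n ℓ)) (e : Edge n ℓ) :
    polytope E (A ∪ {e}) R ⊆ polytope E A R :=
  polytope_mono fun _ _ hA hR => ⟨subset_union_left.trans hA, hR⟩

theorem polytope_exclude_subset (E A R : Finset (Edge n ℓ)) (e : Edge n ℓ) :
    polytope E A (R ∪ {e}) ⊆ polytope E A R :=
  polytope_mono fun _ _ hA hR => ⟨hA, hR.mono_left subset_union_left⟩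

theorem Accepts.exists_point (hI : I.Valid) {x : Index n ℓ → Bool} {k : ℕ} {ph : Phase}
    (hs : s.Records x k ph) (h : Accepts I t A R s e) :
    ∃ x₀ ∈ polytope I.E (A ∪ {e}) R, ∀ y ∈ polytope I.E A (R ∪ {e}),
      worstCase I.E (upperBounds I.E delta0 t s) A R y <
        worstCase I.E (lowerBounds I.E delta0 t s) A R x₀ :=
  hI.oracle.exists_of_lt (accuracy_pos t) (hs.lowerBounds_mem delta0 t) (upperBounds_mem delta0 t)
    (polytope_include_subset _ _ _ _) h

theorem Rejects.exists_point (hI : I.Valid) {x : Index n ℓ → Bool} {k : ℕ} {ph : Phase}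
    (hs : s.Records x k ph) (h : Rejects I t A R s e) :
    ∃ x₀ ∈ polytope I.E A (R ∪ {e}), ∀ y ∈ polytope I.E (A ∪ {e}) R,
      worstCase I.E (upperBounds I.E delta0 t s) A R y <
        worstCase I.E (lowerBounds I.E delta0 t s) A R x₀ :=
  hI.oracle.exists_of_lt (accuracy_pos t) (hs.lowerBounds_mem delta0 t) (upperBounds_mem delta0 t)
    (polytope_exclude_subset _ _ _ _) h

/-- Two edges that are accepted in the same round are in a common feasible matching. -/
theorem Accepts.exists_common_matching (hI : I.Valid) {x : Index n ℓ → Bool} {k : ℕ} {ph : Phase}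
    (hs : s.Records x k ph) {f : Edge n ℓ} (he : Accepts I t A R s e) (hf : Accepts I t A R s f) :
    ∃ M ∈ maxMatchings I.E, A ⊆ M ∧ Disjoint R M ∧ e ∈ M ∧ f ∈ M := by
  by_contra hcon
  push Not at hcon
  obtain ⟨x₀, hx₀, h₀⟩ := he.exists_point hI hs
  obtain ⟨x₁, hx₁, h₁⟩ := hf.exists_point hI hs
  -- Without a common matching, including one edge excludes the other. Each witness then competes in
  -- the other edge's comparison, and since lower bounds are below upper bounds the two strict
  -- inequalities form a cycle.
  have hsub : ∀ a b : Edge n ℓ, (∀ M ∈ maxMatchings I.E, A ⊆ M → Disjoint R M → a ∈ M → b ∉ M) →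
      polytope I.E (A ∪ {a}) R ⊆ polytope I.E A (R ∪ {b}) := by
    intro a b hab
    refine polytope_mono fun M hM hA hR => ⟨subset_union_left.trans hA, ?_⟩
    rw [disjoint_union_left]
    refine ⟨hR, disjoint_singleton_left.2 ?_⟩
    exact hab M hM (subset_union_left.trans hA) hR (hA (by simp))
  have h2 := h₀ x₁ (hsub f e (fun M hM hA hR hf he => hcon M hM hA hR he hf) hx₁)
  have h3 := h₁ x₀ (hsub e f hcon hx₀)
  have hne : (polytope I.E A R).Nonempty := ⟨x₀, polytope_include_subset _ _ _ _ hx₀⟩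
  have hm : ∀ g z, z ∈ polytope I.E (A ∪ {g}) R →
      worstCase I.E (lowerBounds I.E delta0 t s) A R z ≤
        worstCase I.E (upperBounds I.E delta0 t s) A R z := fun g z hz =>
    worstCase_mono (fun a b => (hs.lowerBounds_mem delta0 t a b).1)
      (hs.lowerBounds_le_upperBounds delta0 t) hz hne
  linarith [hm e x₀ hx₀, hm f x₁ hx₁]

theorem mem_nextA {e : Edge n ℓ} :
    e ∈ nextA I t A R s ↔ e ∈ A ∨ (e ∈ undecided I.E A R ∧ Accepts I t A R s e) := by
  classical
  simp [nextA]

theorem mem_nextR {e : Edge n ℓ} :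
    e ∈ nextR I t A R s ↔ e ∈ R ∨
      (e ∈ undecided I.E A R ∧ ¬ Accepts I t A R s e ∧ Rejects I t A R s e) := by
  classical
  simp [nextR]

theorem mem_undecided {E A R : Finset (Edge n ℓ)} {e : Edge n ℓ} :
    e ∈ undecided E A R ↔ e ∈ E ∧ e ∉ A ∧ e ∉ R := by
  simp [undecided]

/-- No concentration is used here: even an unlucky exploration that accepts ℓ edges hands a maximum
matching to the verification. The soundness of the answer therefore depends on the verification
phase alone. -/
theorem nextA_isMatching (hI : I.Valid) {x : Index n ℓ → Bool} {k : ℕ} {ph : Phase}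
    (hs : s.Records x k ph) (hA : IsMatching I.E A) : IsMatching I.E (nextA I t A R s) := by
  refine ⟨fun e he => ?_, fun e he f hf hef => ?_⟩
  · rcases mem_nextA.1 he with h | h
    · exact hA.1 h
    · exact (mem_undecided.1 h.1).1
  · rcases mem_nextA.1 he with he | ⟨-, he⟩ <;> rcases mem_nextA.1 hf with hf | ⟨-, hf⟩
    · exact hA.2 e he f hf hef
    -- Both edges are taken to be `f`: an accepted edge lies in a feasible matching, and this
    -- matching includes `A`.
    · obtain ⟨M, hM, hAM, -, hfM, -⟩ := hf.exists_common_matching hI hs hf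
      exact (maxMatchings_isMatching hM).2 e (hAM he) f hfM hef
    · obtain ⟨M, hM, hAM, -, heM, -⟩ := he.exists_common_matching hI hs he
      exact (maxMatchings_isMatching hM).2 e heM f (hAM hf) hef
    · obtain ⟨M, hM, -, -, heM, hfM⟩ := he.exists_common_matching hI hs hf
      exact (maxMatchings_isMatching hM).2 e heM f hfM hef

end Round

theorem mem_duelList {E U : Finset (Edge n ℓ)} {d : Edge n ℓ × Edge n ℓ} :
    d ∈ duelList E U ↔ d.1 ∈ U ∧ d.2 ∈ U ∧ IsDuel E d := by
  classical
  simp [duelList, and_assoc]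

theorem duelList_nodup (E U : Finset (Edge n ℓ)) : (duelList E U).Nodup := by
  classical
  exact Finset.nodup_toList _

theorem IsDuel.fst_ne {E : Finset (Edge n ℓ)} {d : Edge n ℓ × Edge n ℓ} (h : IsDuel E d) :
    d.1.1 ≠ d.2.1 := h.2.ne

theorem Stats.record_count_le (s : Stats n ℓ) (d : Edge n ℓ × Edge n ℓ) (b : Bool)
    (e f : Edge n ℓ) : (s.record d b).count e f ≤ s.count e f + 1 := by
  simp only [Stats.record]
  split_ifs <;> simp

/-! ### A verified answer is the Condorcet winner -/

/-- An invariant of the states of copy `k` of `CAR-Verify`, provided that its verification phase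
is concentrated: the only matching that it may return is `Ms`. -/
def Sound (I : Input n ℓ) (Ms : Finset (Edge n ℓ)) (x : Index n ℓ → Bool) (k : ℕ) :
    VState n ℓ → Prop
  | .explore _ todo A _ s => s.Records x k .explore ∧ IsMatching I.E A ∧ ∀ d ∈ todo, IsDuel I.E d
  | .verify t Mhat s => s.Records x k .verify ∧ Mhat ∈ maxMatchings I.E ∧ ∀ e f, s.count e f + 1 ≤ t
  | .answer M => M = Ms
  | .error => True

section Sound

variable {I : Input n ℓ} {P : EdgeMatrix n ℓ} {Ms : Finset (Edge n ℓ)} {δ : ℝ}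
  {x : Index n ℓ → Bool} {k : ℕ}

theorem Sound.init (I : Input n ℓ) (Ms : Finset (Edge n ℓ)) (x : Index n ℓ → Bool) (k : ℕ) :
    Sound I Ms x k (VState.init I) :=
  ⟨Stats.records_empty x k _, ⟨empty_subset _, by simp⟩, fun _ hd => (mem_duelList.1 hd).2.2⟩

/-- Against a wrong `Mhat` the winner itself is a challenger whose true score, and hence whose upper
score, exceeds 1/2. -/
theorem Confirmed.eq_winner (hP : IsPreference I.E P) (hMs : IsCondorcetWinner I.E P Ms)
    (hc : Concentrated I.E P δ x k .verify) {t : ℕ} {Mhat : Finset (Edge n ℓ)} {s : Stats n ℓ}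
    (hs : s.Records x k .verify) (hM : Mhat ∈ maxMatchings I.E)
    (ht : ∀ e f, s.count e f ≤ t) (h : Confirmed I δ t Mhat s) : Mhat = Ms := by
  by_contra hne
  have h1 := hMs.2 Mhat hM hne
  have h2 := h Ms hMs.1 (Ne.symm hne)
  have h3 := score_mono (hc.le_upperBounds hP hs (t := t) fun e f _ _ => ht e f) Ms Mhat
  linarith

theorem Sound.silent (hI : I.Valid) (hP : IsPreference I.E P) (hMs : IsCondorcetWinner I.E P Ms)
    (hc : Concentrated I.E P δ x k .verify) (v : VState n ℓ) (h : Sound I Ms x k v) :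
    Sound I Ms x k (v.silent I δ) := by
  match v, h with
  | .explore t [] A R s, ⟨hs, hA, _⟩ =>
    have hA' := nextA_isMatching (t := t) (R := R) hI hs hA
    simp only [VState.silent, endRound]
    split_ifs with hcard
    · exact ⟨Stats.records_empty x k _, (mem_maxMatchings hI.exists_matching).2 ⟨hA', hcard⟩,
        fun e f => by simp [Stats.empty]⟩
    · exact ⟨hs, hA', fun d hd => (mem_duelList.1 hd).2.2⟩
  | .explore t (d :: todo) A R s, h => exact h
  | .verify t Mhat s, ⟨hs, hM, ht⟩ =>
    simp only [VState.silent]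
    split_ifs with h1 h2
    · trivial
    · exact h2.eq_winner hP hMs hc hs hM (fun e f => by have := ht e f; omega)
    · exact ⟨hs, hM, ht⟩
  | .answer M, h => exact h
  | .error, h => exact h

theorem Sound.observe (hI : I.Valid) {v : VState n ℓ} (h : Sound I Ms x k v) {ph : Phase}
    {d : Edge n ℓ × Edge n ℓ} {i : ℕ} (hr : v.request I δ = some (ph, d, i)) :
    Sound I Ms x k (v.observe I δ (outcome x k ph d i)) := by
  match v, h with
  | .explore t [] A R s, _ => simp [VState.request] at hr
  | .explore t (d' :: todo) A R s, ⟨hs, hA, hd⟩ =>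
    simp only [VState.request, Option.some.injEq, Prod.mk.injEq] at hr
    obtain ⟨rfl, rfl, rfl⟩ := hr
    exact ⟨hs.record (hd d' (by simp)).fst_ne, hA, fun d h => hd d (by simp [h])⟩
  | .verify t Mhat s, ⟨hs, hM, ht⟩ =>
    simp only [VState.request] at hr
    split_ifs at hr with hRC
    push Not at hRC
    simp only [Option.some.injEq, Prod.mk.injEq] at hr
    obtain ⟨rfl, rfl, rfl⟩ := hr
    obtain ⟨h1, h2⟩ := verifyDuel_comparable hI hM hRC.2
    refine ⟨hs.record (h1.fst_ne h2), hM, fun e f => ?_⟩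
    have := ht e f
    have := s.record_count_le (verifyDuel I δ t Mhat s) (outcome x k Phase.verify
      (verifyDuel I δ t Mhat s)
      (s.count (verifyDuel I δ t Mhat s).1 (verifyDuel I δ t Mhat s).2)) e f
    omega
  | .answer M, _ => simp [VState.request] at hr
  | .error, _ => simp [VState.request] at hr

theorem Sound.resume (hI : I.Valid) (hP : IsPreference I.E P) (hMs : IsCondorcetWinner I.E P Ms)
    (hc : Concentrated I.E P δ x k .verify) {v : VState n ℓ} (h : Sound I Ms x k v) :
    Sound I Ms x k (v.resume I δ x k).1 := by
  have hset : Sound I Ms x k (v.settle I δ) :=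
    VState.settle_induction (fun v hv => Sound.silent hI hP hMs hc v hv) h
  rcases hr : (v.settle I δ).request I δ with _ | ⟨ph, d, i⟩
  · rw [VState.resume_of_none hr]
    exact hset
  · rw [VState.resume_of_request hr]
    exact hset.observe hI hr

theorem Sound.result_eq {v : VState n ℓ} (h : Sound I Ms x k v) {M : Finset (Edge n ℓ)}
    (hM : v.result = some M) : M = Ms := by
  match v, h with
  | .explore .., _ => simp [VState.result] at hM
  | .verify .., _ => simp [VState.result] at hM
  | .error, _ => simp [VState.result] at hM
  | .answer N, h =>
    simp only [VState.result, Option.some.injEq] at hM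
    exact hM ▸ h

end Sound

end CPEDB

end

/-! ### Gaps, and what one round decides on the concentration event -/

section

open Finset

namespace CPEDB

variable {n ℓ : ℕ}

/-! ### Gaps -/

section Gaps

variable {E : Finset (Edge n ℓ)} {P : EdgeMatrix n ℓ} {Ms : Finset (Edge n ℓ)}

theorem score_winner_le (hℓ : 0 < ℓ) (hE : ∃ M, IsMatching E M ∧ M.card = ℓ)
    (hP : IsPreference E P) (hMs : IsCondorcetWinner E P Ms) {M : Finset (Edge n ℓ)}
    (hM : M ∈ maxMatchings E) : score P M Ms ≤ 1 / 2 := by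
  by_cases h : M = Ms
  · subst h
    exact (score_self hℓ hE hP hM).le
  · have := hMs.2 M hM h
    rw [score_swap hℓ hE hP hM hMs.1]
    linarith

theorem score_winner_lt (hℓ : 0 < ℓ) (hE : ∃ M, IsMatching E M ∧ M.card = ℓ)
    (hP : IsPreference E P) (hMs : IsCondorcetWinner E P Ms) {M : Finset (Edge n ℓ)}
    (hM : M ∈ maxMatchings E) (hne : M ≠ Ms) : score P M Ms < 1 / 2 := by
  have := hMs.2 M hM hne
  rw [score_swap hℓ hE hP hM hMs.1]
  linarith

/-- Both cases of the definition say that the matching and the winner disagree about `e`. -/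
theorem mem_flipMatchings {e : Edge n ℓ} {M : Finset (Edge n ℓ)} :
    M ∈ flipMatchings E Ms e ↔ M ∈ maxMatchings E ∧ (e ∈ Ms ↔ e ∉ M) := by
  classical
  unfold flipMatchings
  split_ifs with h <;> simp [h]

theorem score_le_of_mem_flipMatchings {e : Edge n ℓ} {M : Finset (Edge n ℓ)}
    (h : M ∈ flipMatchings E Ms e) : score P M Ms ≤ 1 / 2 - condGap E P Ms e := by
  unfold condGap
  rw [dif_pos ⟨M, h⟩]
  have := Finset.le_sup' (fun M => score P M Ms) h
  linarith

theorem condGap_le_half (hP : IsPreference E P) (e : Edge n ℓ) : condGap E P Ms e ≤ 1 / 2 := by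
  by_cases h : (flipMatchings E Ms e).Nonempty
  · obtain ⟨M, hM⟩ := h
    have := score_le_of_mem_flipMatchings (P := P) hM
    have := score_nonneg hP.nonneg M Ms
    linarith
  · unfold condGap
    rw [dif_neg h]
    norm_num

theorem condGap_pos (hℓ : 0 < ℓ) (hE : ∃ M, IsMatching E M ∧ M.card = ℓ)
    (hP : IsPreference E P) (hMs : IsCondorcetWinner E P Ms) (e : Edge n ℓ) :
    0 < condGap E P Ms e := by
  unfold condGap
  split_ifs with hne
  · have : (flipMatchings E Ms e).sup' hne (fun M => score P M Ms) < 1 / 2 := by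
      rw [Finset.sup'_lt_iff]
      intro M hM
      obtain ⟨hM, he⟩ := mem_flipMatchings.1 hM
      refine score_winner_lt hℓ hE hP hMs hM ?_
      rintro rfl
      tauto
    linarith
  · norm_num

theorem mem_rivals {e : Edge n ℓ} {M : Finset (Edge n ℓ)} :
    M ∈ rivals E Ms e ↔ M ∈ maxMatchings E ∧ M ≠ Ms ∧ e ∈ M := by
  classical
  simp [rivals]

theorem numDiff_comm (M N : Finset (Edge n ℓ)) : numDiff M N = numDiff N M := by
  unfold numDiff
  simp_rw [ne_comm]

theorem numDiff_pos (hE : ∃ M, IsMatching E M ∧ M.card = ℓ) {M N : Finset (Edge n ℓ)}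
    (hM : M ∈ maxMatchings E) (hN : N ∈ maxMatchings E) (hne : M ≠ N) : 0 < numDiff M N := by
  obtain ⟨m, hm⟩ := exists_edgesAt_eq hE hM
  obtain ⟨m', hm'⟩ := exists_edgesAt_eq hE hN
  rw [numDiff_eq_of_edgesAt hm hm', Finset.card_pos]
  by_contra h
  apply hne
  have hall : ∀ j, m j = m' j := by
    intro j
    by_contra hj
    exact h ⟨j, by simpa using hj⟩
  ext e
  rw [mem_of_edgesAt hm, mem_of_edgesAt hm', hall]

theorem verGap_pos (hℓ : 0 < ℓ) (hE : ∃ M, IsMatching E M ∧ M.card = ℓ)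
    (hP : IsPreference E P) (hMs : IsCondorcetWinner E P Ms) {e : Edge n ℓ}
    (h : (rivals E Ms e).Nonempty) : 0 < verGap E P Ms e h := by
  unfold verGap
  rw [Finset.lt_inf'_iff]
  intro M hM
  obtain ⟨hM, hne, -⟩ := mem_rivals.1 hM
  have h1 := score_winner_lt hℓ hE hP hMs hM hne
  have h2 := numDiff_pos hE hMs.1 hM hne.symm
  have h3 : (0 : ℝ) < numDiff Ms M := by exact_mod_cast h2
  have h4 : (0 : ℝ) < ℓ := by exact_mod_cast hℓ
  exact mul_pos (div_pos h4 h3) (by linarith)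

theorem verGap_le {e : Edge n ℓ} {M : Finset (Edge n ℓ)} (hM : M ∈ rivals E Ms e) :
    verGap E P Ms e ⟨M, hM⟩ ≤ ((ℓ : ℝ) / (numDiff Ms M : ℝ)) * (1 / 2 - score P M Ms) := by
  unfold verGap
  exact Finset.inf'_le _ hM

open scoped Classical in
/-- The contribution of an edge to the verification hardness. -/
noncomputable def edgeHardness (E : Finset (Edge n ℓ)) (P : EdgeMatrix n ℓ)
    (Ms : Finset (Edge n ℓ)) (e : Edge n ℓ) : ℝ :=
  if h : (rivals E Ms e).Nonempty then 1 / (verGap E P Ms e h) ^ 2 else 0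

theorem edgeHardness_nonneg (e : Edge n ℓ) : 0 ≤ edgeHardness E P Ms e := by
  unfold edgeHardness
  split_ifs
  · positivity
  · exact le_rfl

theorem hardness_eq_sum : hardness E P Ms = ∑ e ∈ E \ Ms, edgeHardness E P Ms e := by
  unfold hardness edgeHardness
  congr!

open scoped Classical in
/-- The edges outside the Condorcet winner that lie in some maximum matching. -/
noncomputable def rivalEdges (E Ms : Finset (Edge n ℓ)) : Finset (Edge n ℓ) :=
  (E \ Ms).filter (fun e => (rivals E Ms e).Nonempty)

theorem mem_rivalEdges {e : Edge n ℓ} :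
    e ∈ rivalEdges E Ms ↔ (e ∈ E ∧ e ∉ Ms) ∧ (rivals E Ms e).Nonempty := by
  classical
  simp [rivalEdges]

theorem hardness_eq_sum_rivalEdges :
    hardness E P Ms = ∑ e ∈ rivalEdges E Ms, edgeHardness E P Ms e := by
  classical
  rw [hardness_eq_sum]
  unfold rivalEdges
  rw [Finset.sum_filter]
  refine Finset.sum_congr rfl fun e _ => ?_
  split_ifs with h
  · rfl
  · simp [edgeHardness, h]

/-- The increase of a score in terms of the increase of the entries at the positions at which the
two matchings differ. -/
theorem score_le_score_add (hℓ : 0 < ℓ) (hE : ∃ M, IsMatching E M ∧ M.card = ℓ)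
    {M N : Finset (Edge n ℓ)} (hM : M ∈ maxMatchings E) (hN : N ∈ maxMatchings E)
    {Q : EdgeMatrix n ℓ} {w : ℝ} (hdiag : ∀ e ∈ E, Q e e = P e e)
    (h : ∀ e f, e ∈ M → e ∉ N → f ∈ N → f ∉ M → e.2 = f.2 → Q e f ≤ P e f + w) :
    score Q M N ≤ score P M N + (numDiff N M : ℝ) / ℓ * w := by
  obtain ⟨m, hm⟩ := exists_edgesAt_eq hE hM
  obtain ⟨m', hm'⟩ := exists_edgesAt_eq hE hN
  rw [numDiff_comm, score_eq_of_edgesAt Q hm hm', score_eq_of_edgesAt P hm hm',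
    numDiff_eq_of_edgesAt hm hm']
  -- Common edges contribute no error because diagonal entries are known exactly. This produces the
  -- factor `numDiff / ℓ`, which the normalisation of the verification gap undoes.
  have hterm : ∀ j, Q (m j, j) (m' j, j) ≤
      P (m j, j) (m' j, j) + if m j ≠ m' j then w else 0 := by
    intro j
    by_cases hj : m j = m' j
    · rw [← hj, hdiag _ (maxMatchings_subset hM ((mem_of_edgesAt hm _).2 rfl))]
      simp
    · rw [if_pos hj]
      apply h
      · rw [mem_of_edgesAt hm]
      · rw [mem_of_edgesAt hm']
        exact fun h => hj h.symm
      · rw [mem_of_edgesAt hm']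
      · rw [mem_of_edgesAt hm]
        exact hj
      · rfl
  have hl : (0 : ℝ) < ℓ := by exact_mod_cast hℓ
  calc (1 / (ℓ : ℝ)) * ∑ j, Q (m j, j) (m' j, j)
      ≤ (1 / (ℓ : ℝ)) * ∑ j, (P (m j, j) (m' j, j) + if m j ≠ m' j then w else 0) := by
        gcongr with j
        exact hterm j
    _ = _ := by
        rw [Finset.sum_add_distrib, ← Finset.sum_filter, Finset.sum_const, nsmul_eq_mul]
        ring

end Gaps

/-! ### One round of the exploration, if the duels are concentrated -/

open scoped Classical in
/-- All the duels. -/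
noncomputable def duels (E : Finset (Edge n ℓ)) : Finset (Edge n ℓ × Edge n ℓ) :=
  univ.filter (fun d => IsDuel E d)

theorem mem_duels {E : Finset (Edge n ℓ)} {d : Edge n ℓ × Edge n ℓ} :
    d ∈ duels E ↔ IsDuel E d := by
  classical
  simp [duels]

section Round

variable {I : Input n ℓ} {P : EdgeMatrix n ℓ} {Ms : Finset (Edge n ℓ)} {t : ℕ}
  {A R : Finset (Edge n ℓ)} {s : Stats n ℓ} {x : Index n ℓ → Bool} {k : ℕ}

theorem IsPreference.eq_zero_of_ne {E : Finset (Edge n ℓ)} (hP : IsPreference E P) (e f : Edge n ℓ)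
    (h : e.2 ≠ f.2) : P e f = 0 := hP.eq_zero e f fun hc => h hc.2.2

/-- The winner scores at least 1/2 against each vertex, and the form is linear in the reply. -/
theorem worstCase_winner_ge (hℓ : 0 < ℓ) (hI : I.Valid) (hP : IsPreference I.E P)
    (hMs : IsCondorcetWinner I.E P Ms) (hA : A ⊆ Ms) (hR : Disjoint R Ms) :
    1 / 2 ≤ worstCase I.E P A R (chi Ms) := by
  refine le_worstCase ⟨_, chi_mem_polytope hMs.1 hA hR⟩ fun y hy => ?_
  rw [bil_eq_dot_right]
  refine polytope_linear_ge _ _ (fun M hM _ _ => ?_) hy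
  rw [← bil_eq_dot_right, bil_chi_chi P hP.eq_zero_of_ne]
  have := score_winner_le hℓ hI.exists_matching hP hMs hM
  rw [score_swap hℓ hI.exists_matching hP hMs.1 hM]
  linarith

/-- The winner is a feasible reply, so it bounds the inner minimum; linearity then reduces the claim
to the vertices. -/
theorem worstCase_le_of_score_le (hP : IsPreference I.E P)
    (hMs : IsCondorcetWinner I.E P Ms) (hA : A ⊆ Ms) (hR : Disjoint R Ms)
    {A' R' : Finset (Edge n ℓ)} {c : ℝ}
    (h : ∀ M ∈ maxMatchings I.E, A' ⊆ M → Disjoint R' M → score P M Ms ≤ c) {y : Edge n ℓ → ℝ}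
    (hy : y ∈ polytope I.E A' R') : worstCase I.E P A R y ≤ c := by
  refine (worstCase_le hP.nonneg hy (chi_mem_polytope hMs.1 hA hR)).trans ?_
  rw [bil_eq_dot_left]
  refine polytope_linear_le _ _ (fun M hM hA' hR' => ?_) hy
  rw [← bil_eq_dot_left, bil_chi_chi P hP.eq_zero_of_ne]
  exact h M hM hA' hR'

/-- A comparison that the winner's side loses cannot be certified: the winner's upper value is at
least 1/2, and the lower value of any feasible point is at most 1/2. -/
theorem not_exists_point (hℓ : 0 < ℓ) (hI : I.Valid) (hP : IsPreference I.E P)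
    (hMs : IsCondorcetWinner I.E P Ms) (hA : A ⊆ Ms) (hR : Disjoint R Ms)
    (hc : Concentrated I.E P delta0 x k .explore) (hs : s.Records x k .explore)
    (ht : ∀ e f, s.count e f ≤ t) {Aw Rw Al Rl : Finset (Edge n ℓ)}
    (hMsl : chi Ms ∈ polytope I.E Al Rl)
    (h : ∃ x₀ ∈ polytope I.E Aw Rw, ∀ y ∈ polytope I.E Al Rl,
      worstCase I.E (upperBounds I.E delta0 t s) A R y <
        worstCase I.E (lowerBounds I.E delta0 t s) A R x₀) : False := by
  obtain ⟨x₀, hx₀, h⟩ := h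
  have h1 := h _ hMsl
  have hne : (polytope I.E A R).Nonempty := ⟨_, chi_mem_polytope hMs.1 hA hR⟩
  have h2 := worstCase_winner_ge hℓ hI hP hMs hA hR
  have h3 := worstCase_mono hP.nonneg (hc.le_upperBounds hP hs (t := t) fun e f _ _ => ht e f)
    hMsl hne
  have h4 := worstCase_mono (fun e f => (hs.lowerBounds_mem delta0 t e f).1)
    (hc.lowerBounds_le hP hs (t := t) fun e f _ _ => ht e f) hx₀ hne
  have h5 := worstCase_le_of_score_le (c := 1 / 2) hP hMs hA hR
    (fun M hM _ _ => score_winner_le hℓ hI.exists_matching hP hMs hM) hx₀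
  linarith

theorem Accepts.mem_winner (hℓ : 0 < ℓ) (hI : I.Valid) (hP : IsPreference I.E P)
    (hMs : IsCondorcetWinner I.E P Ms) (hA : A ⊆ Ms) (hR : Disjoint R Ms)
    (hc : Concentrated I.E P delta0 x k .explore) (hs : s.Records x k .explore)
    (ht : ∀ e f, s.count e f ≤ t) {e : Edge n ℓ} (h : Accepts I t A R s e) : e ∈ Ms := by
  by_contra he
  refine not_exists_point hℓ hI hP hMs hA hR hc hs ht ?_ (h.exists_point hI hs)
  exact chi_mem_polytope hMs.1 hA (by simp [hR, he])

theorem Rejects.notMem_winner (hℓ : 0 < ℓ) (hI : I.Valid) (hP : IsPreference I.E P)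
    (hMs : IsCondorcetWinner I.E P Ms) (hA : A ⊆ Ms) (hR : Disjoint R Ms)
    (hc : Concentrated I.E P delta0 x k .explore) (hs : s.Records x k .explore)
    (ht : ∀ e f, s.count e f ≤ t) {e : Edge n ℓ} (h : Rejects I t A R s e) : e ∉ Ms := by
  intro he
  refine not_exists_point hℓ hI hP hMs hA hR hc hs ht ?_ (h.exists_point hI hs)
  refine chi_mem_polytope hMs.1 ?_ hR
  exact union_subset hA (by simpa using he)

/-- The winner has true value at least 1/2 and the competitors at most 1/2 - Δ. Passing to lower and
upper bounds costs two radii on each side. Twice the accuracy covers the suboptimality of the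
oracle's point on the winner's side and the margin in the test. -/
theorem oracle_lt_of_gap (hℓ : 0 < ℓ) (hI : I.Valid) (hP : IsPreference I.E P)
    (hMs : IsCondorcetWinner I.E P Ms) (hA : A ⊆ Ms) (hR : Disjoint R Ms)
    (hc : Concentrated I.E P delta0 x k .explore) (hs : s.Records x k .explore) (h1t : 1 ≤ t)
    (hcount : ∀ e f, Comparable I.E e f → e ≠ f → e ∈ undecided I.E A R → f ∈ undecided I.E A R →
      s.count e f = t)
    {Aw Rw Al Rl : Finset (Edge n ℓ)} (hw : chi Ms ∈ polytope I.E Aw Rw)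
    (hl : polytope I.E Al Rl ⊆ polytope I.E A R) {Δ : ℝ}
    (hΔ : ∀ M ∈ maxMatchings I.E, Al ⊆ M → Disjoint Rl M → score P M Ms ≤ 1 / 2 - Δ)
    (hgap : 4 * radius (numDuels I.E) delta0 t t + 2 * accuracy t < Δ) :
    I.oracle (accuracy t) Al Rl A R (upperBounds I.E delta0 t s) + (accuracy t : WithBot ℝ) <
      I.oracle (accuracy t) Aw Rw A R (lowerBounds I.E delta0 t s) := by
  have hMsp := chi_mem_polytope hMs.1 hA hR
  have hne : (polytope I.E A R).Nonempty := ⟨_, hMsp⟩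
  have hrad := radius_nonneg (numDuels I.E) delta0 t t
  refine hI.oracle.lt_of_exists (accuracy_pos t) (hs.lowerBounds_mem delta0 t)
    (upperBounds_mem delta0 t) hne hw fun y hy => ?_
  have h1 := worstCase_winner_ge hℓ hI hP hMs hA hR
  have h2 : worstCase I.E P A R (chi Ms) ≤
      worstCase I.E (lowerBounds I.E delta0 t s) A R (chi Ms) +
        2 * radius (numDuels I.E) delta0 t t := by
    refine worstCase_le_add hP.nonneg hMsp hne fun z hz => ?_
    refine bil_le_bil_add hℓ hI.exists_matching hMsp hz (by linarith) ?_ ?_ ?_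
    · intro e f hef
      rw [hP.eq_zero e f hef, lowerBounds_eq_zero hef]
    · intro e he
      rw [hP.self he, lowerBounds_self he]
    · intro e f hef hne' he hf
      have hct := hcount e f hef hne' he hf
      have := hc.le_lowerBounds hP hs hef hne' (t := t) (by omega) hct.le
      rwa [hct] at this
  have h3 : worstCase I.E (upperBounds I.E delta0 t s) A R y ≤
      worstCase I.E P A R y + 2 * radius (numDuels I.E) delta0 t t := by
    refine worstCase_le_add (fun e f => (upperBounds_mem delta0 t e f).1) hy hne fun z hz => ?_
    refine bil_le_bil_add hℓ hI.exists_matching (hl hy) hz (by linarith) ?_ ?_ ?_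
    · intro e f hef
      rw [hP.eq_zero e f hef, upperBounds_eq_zero hef]
    · intro e he
      rw [hP.self he, upperBounds_self he]
    · intro e f hef hne' he hf
      have hct := hcount e f hef hne' he hf
      have := hc.upperBounds_le hP hs hef hne' (t := t) (by omega) hct.le
      rwa [hct] at this
  have h4 := worstCase_le_of_score_le hP hMs hA hR hΔ hy
  linarith

/-- An edge that is neither accepted nor rejected has a small gap. -/
theorem condGap_le_of_undecided (hℓ : 0 < ℓ) (hI : I.Valid) (hP : IsPreference I.E P)
    (hMs : IsCondorcetWinner I.E P Ms) (hA : A ⊆ Ms) (hR : Disjoint R Ms)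
    (hc : Concentrated I.E P delta0 x k .explore) (hs : s.Records x k .explore) (h1t : 1 ≤ t)
    (hcount : ∀ e f, Comparable I.E e f → e ≠ f → e ∈ undecided I.E A R → f ∈ undecided I.E A R →
      s.count e f = t) {e : Edge n ℓ} (ha : ¬ Accepts I t A R s e) (hr : ¬ Rejects I t A R s e) :
    condGap I.E P Ms e ≤ 4 * radius (numDuels I.E) delta0 t t + 2 * accuracy t := by
  by_contra hgap
  push Not at hgap
  by_cases he : e ∈ Ms
  · refine ha (oracle_lt_of_gap hℓ hI hP hMs hA hR hc hs h1t hcount ?_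
      (polytope_exclude_subset _ _ _ _) (fun M hM _ hRM => ?_) hgap)
    · exact chi_mem_polytope hMs.1 (union_subset hA (by simpa using he)) hR
    · refine score_le_of_mem_flipMatchings (mem_flipMatchings.2 ⟨hM, ?_⟩)
      have : e ∉ M := fun h => Finset.disjoint_left.1 hRM (by simp) h
      tauto
  · refine hr (oracle_lt_of_gap hℓ hI hP hMs hA hR hc hs h1t hcount ?_
      (polytope_include_subset _ _ _ _) (fun M hM hAM _ => ?_) hgap)
    · exact chi_mem_polytope hMs.1 hA (by simp [hR, he])
    · refine score_le_of_mem_flipMatchings (mem_flipMatchings.2 ⟨hM, ?_⟩)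
      have : e ∈ M := hAM (by simp)
      tauto

end Round

/-! ### One round of the verification, if the duels are concentrated -/

/-- If the most uncertain duel has radius r, each differing position overestimates by at most 2r. An
upper score above 1/2 then forces the verification gap to be at most 2r, and r² = L/(2T), with L the
logarithm and T the count, turns this into a bound on T. -/
theorem Concentrated.lt_of_not_confirmed {I : Input n ℓ} {P : EdgeMatrix n ℓ}
    {Ms : Finset (Edge n ℓ)} {δ : ℝ} {t : ℕ} {s : Stats n ℓ} {x : Index n ℓ → Bool} {k : ℕ}
    (hℓ : 0 < ℓ) (hI : I.Valid) (hP : IsPreference I.E P) (hMs : IsCondorcetWinner I.E P Ms)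
    (hc : Concentrated I.E P δ x k .verify) (hs : s.Records x k .verify)
    (ht : ∀ e f, s.count e f ≤ t) (h : ¬ Confirmed I δ t Ms s)
    (hT : s.count (verifyDuel I δ t Ms s).1 (verifyDuel I δ t Ms s).2 ≠ 0) :
    (s.count (verifyDuel I δ t Ms s).1 (verifyDuel I δ t Ms s).2 : ℝ) ≤
      2 * Real.log (4 * numDuels I.E * (t : ℝ) ^ 3 / δ) *
        edgeHardness I.E P Ms (verifyDuel I δ t Ms s).1 := by
  obtain ⟨hC, hne, hlt⟩ := challenger_spec hI h
  obtain ⟨⟨h1, h2, h3, h4, h5⟩, hmax⟩ := verifyDuel_spec hI hMs.1 h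
  set C := challenger I δ t Ms s
  set d := verifyDuel I δ t Ms s
  set T := s.count d.1 d.2
  set r := radius (numDuels I.E) δ t T with hr
  have hup : score (upperBounds I.E δ t s) C Ms ≤
      score P C Ms + (numDiff Ms C : ℝ) / ℓ * (2 * r) := by
    refine score_le_score_add hℓ hI.exists_matching hC hMs.1 ?_ ?_
    · intro e he
      rw [hP.self he, upperBounds_self he]
    · intro e f h1 h2 h3 h4 h5
      have hle := hmax e f h1 h2 h3 h4 h5
      have hne : e ≠ f := fun h => h2 (h ▸ h3)
      have hcomp : Comparable I.E e f :=
        ⟨maxMatchings_subset hC h1, maxMatchings_subset hMs.1 h3, h5⟩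
      -- A pair without duels has radius `⊤` and would have been preferred to the chosen one.
      have hcnt : s.count e f ≠ 0 := by
        intro h0
        unfold radiusExt at hle
        rw [if_pos h0, if_neg hT] at hle
        exact absurd hle (not_le.2 (EReal.coe_lt_top _))
      have hrad : radius (numDuels I.E) δ t (s.count e f) ≤ r := by
        unfold radiusExt at hle
        rw [if_neg hcnt, if_neg hT] at hle
        exact_mod_cast hle
      have := hc.upperBounds_le hP hs hcomp hne (t := t) hcnt (ht e f)
      linarith
  have hmem : C ∈ rivals I.E Ms d.1 := mem_rivals.2 ⟨hC, hne, h1⟩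
  have hv := verGap_le (P := P) hmem
  have hvpos := verGap_pos hℓ hI.exists_matching hP hMs ⟨C, hmem⟩
  set g := verGap I.E P Ms d.1 ⟨C, hmem⟩ with hg
  have hd : (0 : ℝ) < numDiff Ms C := by
    exact_mod_cast numDiff_pos hI.exists_matching hMs.1 hC hne.symm
  have hl : (0 : ℝ) < ℓ := by exact_mod_cast hℓ
  have hgr : g ≤ 2 * r := by
    have h6 : 1 / 2 - score P C Ms ≤ (numDiff Ms C : ℝ) / ℓ * (2 * r) := by linarith
    calc g ≤ (ℓ : ℝ) / numDiff Ms C * (1 / 2 - score P C Ms) := hv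
      _ ≤ (ℓ : ℝ) / numDiff Ms C * ((numDiff Ms C : ℝ) / ℓ * (2 * r)) := by gcongr
      _ = 2 * r := by field_simp
  have hTpos : (0 : ℝ) < T := by exact_mod_cast Nat.pos_of_ne_zero hT
  set L := Real.log (4 * numDuels I.E * (t : ℝ) ^ 3 / δ)
  -- No sign of the logarithm is assumed: a negative radicand would make the radius 0, contrary to 0
  -- < g ≤ 2r.
  have hLpos : 0 ≤ L / (2 * T) := by
    by_contra hneg
    push Not at hneg
    have : r = 0 := Real.sqrt_eq_zero_of_nonpos hneg.le
    linarith
  have hr2 : r ^ 2 = L / (2 * T) := Real.sq_sqrt hLpos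
  have hg2 : g ^ 2 ≤ 2 * L / T := by
    calc g ^ 2 ≤ (2 * r) ^ 2 := by gcongr
      _ = 4 * r ^ 2 := by ring
      _ = 2 * L / T := by rw [hr2]; field_simp; ring
  have hh : edgeHardness I.E P Ms d.1 = 1 / g ^ 2 := by
    unfold edgeHardness
    rw [dif_pos ⟨C, hmem⟩]
  rw [hh]
  rw [le_div_iff₀ hTpos] at hg2
  rw [mul_one_div, le_div_iff₀ (by positivity)]
  linarith

end CPEDB

end

/-! ### Invariants and sample bounds of a concentrated copy -/

section

open Finset

namespace CPEDB

variable {n ℓ : ℕ}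

/-! ### The run of a copy all of whose duels are concentrated -/

theorem Stats.record_count (s : Stats n ℓ) (d : Edge n ℓ × Edge n ℓ) (b : Bool) (e f : Edge n ℓ) :
    (s.record d b).count e f = s.count e f + if (e, f) = d ∨ (f, e) = d then 1 else 0 := rfl

theorem Stats.record_count_of_isDuel {E : Finset (Edge n ℓ)} (s : Stats n ℓ)
    {d d' : Edge n ℓ × Edge n ℓ} (hd : IsDuel E d) (hd' : IsDuel E d') (b : Bool) :
    (s.record d b).count d'.1 d'.2 = s.count d'.1 d'.2 + if d' = d then 1 else 0 := by
  rw [Stats.record_count]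
  have h1 : ((d'.1, d'.2) = d ∨ (d'.2, d'.1) = d) ↔ d' = d := by
    constructor
    · rintro (h | h)
      · exact h
      · exfalso
        have h1 := hd.2
        have h2 := hd'.2
        rw [← h] at h1
        exact absurd h1 h2.not_gt
    · exact Or.inl
  simp only [h1]

theorem numDuels_eq_natCast (E : Finset (Edge n ℓ)) :
    numDuels E = ((∑ j, (edgesAt E j).card.choose 2 : ℕ) : ℝ) := by
  unfold numDuels
  push_cast
  exact Finset.sum_congr rfl fun j _ => (Nat.cast_choose_two ℝ _).symm

/-- `numDuels` is a natural number. When it is 0, the logarithm in the radius is `log 0 = 0`, so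
that the estimates below survive without a special hypothesis. -/
theorem numDuels_eq_zero_or (E : Finset (Edge n ℓ)) : numDuels E = 0 ∨ 1 ≤ numDuels E := by
  rw [numDuels_eq_natCast]
  rcases Nat.eq_zero_or_pos (∑ j, (edgesAt E j).card.choose 2) with h | h
  · left
    exact_mod_cast h
  · right
    exact_mod_cast h

theorem log_radius_nonneg (E : Finset (Edge n ℓ)) {δ : ℝ} (h0 : 0 < δ) (h1 : δ ≤ 1) {t : ℕ}
    (ht : 1 ≤ t) : 0 ≤ Real.log (4 * numDuels E * (t : ℝ) ^ 3 / δ) := by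
  rcases numDuels_eq_zero_or E with h | h
  · simp [h]
  · apply Real.log_nonneg
    rw [le_div_iff₀ h0]
    have ht' : (1 : ℝ) ≤ t := by exact_mod_cast ht
    have : (1 : ℝ) ≤ (t : ℝ) ^ 3 := one_le_pow₀ ht'
    nlinarith

theorem log_radius_mono (E : Finset (Edge n ℓ)) {δ : ℝ} (h0 : 0 < δ) {t u : ℕ} (ht : 1 ≤ t)
    (htu : t ≤ u) : Real.log (4 * numDuels E * (t : ℝ) ^ 3 / δ) ≤
      Real.log (4 * numDuels E * (u : ℝ) ^ 3 / δ) := by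
  rcases numDuels_eq_zero_or E with h | h
  · simp [h]
  · have ht' : (0 : ℝ) < t := by exact_mod_cast ht
    have htu' : (t : ℝ) ≤ u := by exact_mod_cast htu
    have : 0 < numDuels E := by linarith
    apply Real.log_le_log (by positivity)
    gcongr

/-- What is assumed about a copy: its duels are concentrated in both phases. The edge `e` is
decided in round `τ e` of the exploration at the latest; `B₁` and `B₂` bound the numbers of samples
of the two phases; `p` maps an edge to the edge of the winner at the same position. -/
structure GoodCopy (I : Input n ℓ) (P : EdgeMatrix n ℓ) (Ms : Finset (Edge n ℓ)) (δ : ℝ)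
    (x : Index n ℓ → Bool) (k : ℕ) (τ : Edge n ℓ → ℝ) (B₁ B₂ : ℝ)
    (p : Edge n ℓ → Edge n ℓ) : Prop where
  pos : 0 < ℓ
  valid : I.Valid
  pref : IsPreference I.E P
  winner : IsCondorcetWinner I.E P Ms
  partner : ∀ e f, f ∈ Ms → e.2 = f.2 → f = p e
  delta_pos : 0 < δ
  delta_le : δ ≤ 1
  explore : Concentrated I.E P delta0 x k .explore
  verify : Concentrated I.E P δ x k .verify
  tau_nonneg : ∀ e, 0 ≤ τ e
  le_tau : ∀ e ∈ I.E, ∀ t : ℕ, 1 ≤ t →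
    condGap I.E P Ms e ≤ 4 * radius (numDuels I.E) delta0 t t + 2 * accuracy t → (t : ℝ) ≤ τ e
  sum_le : ∑ d ∈ duels I.E, (1 + min (τ d.1) (τ d.2)) ≤ B₁
  -- The number of samples also occurs inside the logarithm, since the radius depends on the round;
  -- `B₂` is a bound that follows from this implicit inequality.
  le_of_sum : ∀ N : ℕ, (N : ℝ) ≤ ∑ e ∈ rivalEdges I.E Ms,
    (1 + 2 * Real.log (4 * numDuels I.E * ((N : ℝ) + 1) ^ 3 / δ) * edgeHardness I.E P Ms e) →
    (N : ℝ) ≤ B₂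

/-- The invariant of the exploration, after `m` samples. -/
structure ExploreInv (I : Input n ℓ) (Ms : Finset (Edge n ℓ)) (x : Index n ℓ → Bool) (k : ℕ)
    (τ : Edge n ℓ → ℝ) (m t : ℕ) (todo : List (Edge n ℓ × Edge n ℓ)) (A R : Finset (Edge n ℓ))
    (s : Stats n ℓ) : Prop where
  records : s.Records x k .explore
  subset : A ⊆ Ms
  disjoint : Disjoint R Ms
  one_le : 1 ≤ t
  nodup : todo.Nodup
  todo_mem : ∀ d ∈ todo, IsDuel I.E d ∧ d.1 ∈ undecided I.E A R ∧ d.2 ∈ undecided I.E A R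
  -- One sample for each of the `t - 1` finished rounds, and one more in the current round unless
  -- the duel is still to be done.
  count_eq : ∀ d, IsDuel I.E d → d.1 ∈ undecided I.E A R → d.2 ∈ undecided I.E A R →
    s.count d.1 d.2 + (if d ∈ todo then 1 else 0) = t
  count_le : ∀ e f, s.count e f ≤ t
  le_tau : ∀ e ∈ undecided I.E A R, (t : ℝ) ≤ 1 + τ e
  count_le_tau : ∀ d, IsDuel I.E d → (s.count d.1 d.2 : ℝ) ≤ 1 + min (τ d.1) (τ d.2)
  samples : m = ∑ d ∈ duels I.E, s.count d.1 d.2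

/-- The invariant of the verification, after `m` samples in total. -/
structure VerifyInv (I : Input n ℓ) (P : EdgeMatrix n ℓ) (Ms : Finset (Edge n ℓ)) (δ : ℝ)
    (x : Index n ℓ → Bool) (k : ℕ) (B₁ : ℝ) (p : Edge n ℓ → Edge n ℓ) (m t : ℕ)
    (Mhat : Finset (Edge n ℓ)) (s : Stats n ℓ) : Prop where
  records : s.Records x k .verify
  eq_winner : Mhat = Ms
  one_le : 1 ≤ t
  count_lt : ∀ e f, s.count e f + 1 ≤ t
  -- Round `t` starts after `t - 1` verification samples; `m₁` counts those of the exploration.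
  samples : ∃ m₁ : ℕ, (m₁ : ℝ) ≤ B₁ ∧ m + 1 = m₁ + t
  count_sum : t = 1 + ∑ e ∈ rivalEdges I.E Ms, s.count e (p e)
  count_le : ∀ e ∈ rivalEdges I.E Ms, (s.count e (p e) : ℝ) ≤
    1 + 2 * Real.log (4 * numDuels I.E * (t : ℝ) ^ 3 / δ) * edgeHardness I.E P Ms e

/-- The invariant of a good copy, after `m` samples. -/
def CopyInv (I : Input n ℓ) (P : EdgeMatrix n ℓ) (Ms : Finset (Edge n ℓ)) (δ : ℝ)
    (x : Index n ℓ → Bool) (k : ℕ) (τ : Edge n ℓ → ℝ) (B₁ : ℝ) (p : Edge n ℓ → Edge n ℓ)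
    (m : ℕ) : VState n ℓ → Prop
  | .explore t todo A R s => ExploreInv I Ms x k τ m t todo A R s
  | .verify t Mhat s => VerifyInv I P Ms δ x k B₁ p m t Mhat s
  | .answer M => M = Ms
  | .error => False

theorem comparable_isDuel {E : Finset (Edge n ℓ)} {e f : Edge n ℓ} (h : Comparable E e f)
    (hne : e ≠ f) : IsDuel E (e, f) ∨ IsDuel E (f, e) := by
  rcases lt_or_gt_of_ne (h.fst_ne hne) with h1 | h1
  · exact Or.inl ⟨h, h1⟩
  · exact Or.inr ⟨h.symm, h1⟩

section GoodCopy

variable {I : Input n ℓ} {P : EdgeMatrix n ℓ} {Ms : Finset (Edge n ℓ)} {δ : ℝ}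
  {x : Index n ℓ → Bool} {k : ℕ} {τ : Edge n ℓ → ℝ} {B₁ B₂ : ℝ} {p : Edge n ℓ → Edge n ℓ}

theorem CopyInv.init (hg : GoodCopy I P Ms δ x k τ B₁ B₂ p) :
    CopyInv I P Ms δ x k τ B₁ p 0 (VState.init I) where
  records := Stats.records_empty x k _
  subset := empty_subset _
  disjoint := disjoint_empty_left _
  one_le := le_rfl
  nodup := duelList_nodup _ _
  todo_mem d hd := by
    obtain ⟨h1, h2, h3⟩ := mem_duelList.1 hd
    exact ⟨h3, by simpa [mem_undecided] using h1, by simpa [mem_undecided] using h2⟩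
  count_eq d hd h1 h2 := by
    rw [if_pos (mem_duelList.2 ⟨(mem_undecided.1 h1).1, (mem_undecided.1 h2).1, hd⟩)]
    simp [Stats.empty]
  count_le e f := by simp [Stats.empty]
  le_tau e _ := by simpa using hg.tau_nonneg e
  count_le_tau d _ := by
    have := le_min (hg.tau_nonneg d.1) (hg.tau_nonneg d.2)
    simp only [Stats.empty, Nat.cast_zero]
    linarith
  samples := by simp [Stats.empty]

theorem ExploreInv.count_eq_of_nil {m t : ℕ} {A R : Finset (Edge n ℓ)} {s : Stats n ℓ}
    (h : ExploreInv I Ms x k τ m t [] A R s) {e f : Edge n ℓ} (hc : Comparable I.E e f)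
    (hne : e ≠ f) (he : e ∈ undecided I.E A R) (hf : f ∈ undecided I.E A R) :
    s.count e f = t := by
  rcases comparable_isDuel hc hne with hd | hd
  · simpa using h.count_eq (e, f) hd he hf
  · rw [h.records.symm]
    simpa using h.count_eq (f, e) hd hf he

theorem ExploreInv.samples_le (hg : GoodCopy I P Ms δ x k τ B₁ B₂ p) {m t : ℕ}
    {todo : List (Edge n ℓ × Edge n ℓ)} {A R : Finset (Edge n ℓ)} {s : Stats n ℓ}
    (h : ExploreInv I Ms x k τ m t todo A R s) : (m : ℝ) ≤ B₁ := by
  refine le_trans ?_ hg.sum_le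
  rw [h.samples]
  push_cast
  exact sum_le_sum fun d hd => h.count_le_tau d (mem_duels.1 hd)

section EndRound

variable {m t : ℕ} {A R : Finset (Edge n ℓ)} {s : Stats n ℓ}

theorem ExploreInv.nextA_subset (hg : GoodCopy I P Ms δ x k τ B₁ B₂ p)
    (h : ExploreInv I Ms x k τ m t [] A R s) : nextA I t A R s ⊆ Ms := by
  intro e he
  rcases mem_nextA.1 he with he | ⟨-, he⟩
  · exact h.subset he
  · exact he.mem_winner hg.pos hg.valid hg.pref hg.winner h.subset h.disjoint hg.explore h.records
      h.count_le

theorem ExploreInv.nextR_disjoint (hg : GoodCopy I P Ms δ x k τ B₁ B₂ p)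
    (h : ExploreInv I Ms x k τ m t [] A R s) : Disjoint (nextR I t A R s) Ms := by
  rw [Finset.disjoint_left]
  intro e he
  rcases mem_nextR.1 he with he | ⟨-, -, he⟩
  · exact Finset.disjoint_left.1 h.disjoint he
  · exact he.notMem_winner hg.pos hg.valid hg.pref hg.winner h.subset h.disjoint hg.explore
      h.records h.count_le

theorem undecided_next_subset :
    undecided I.E (nextA I t A R s) (nextR I t A R s) ⊆ undecided I.E A R := by
  intro e he
  obtain ⟨h1, h2, h3⟩ := mem_undecided.1 he
  exact mem_undecided.2 ⟨h1, fun h => h2 (mem_nextA.2 (Or.inl h)),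
    fun h => h3 (mem_nextR.2 (Or.inl h))⟩

theorem ExploreInv.le_tau_of_undecided (hg : GoodCopy I P Ms δ x k τ B₁ B₂ p)
    (h : ExploreInv I Ms x k τ m t [] A R s) {e : Edge n ℓ}
    (he : e ∈ undecided I.E (nextA I t A R s) (nextR I t A R s)) : (t : ℝ) ≤ τ e := by
  have hu := undecided_next_subset he
  obtain ⟨h1, h2, h3⟩ := mem_undecided.1 he
  have ha : ¬ Accepts I t A R s e := fun ha => h2 (mem_nextA.2 (Or.inr ⟨hu, ha⟩))
  have hr : ¬ Rejects I t A R s e := fun hr => h3 (mem_nextR.2 (Or.inr ⟨hu, ha, hr⟩))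
  refine hg.le_tau e h1 t h.one_le ?_
  exact condGap_le_of_undecided hg.pos hg.valid hg.pref hg.winner h.subset h.disjoint hg.explore
    h.records h.one_le (fun e f hc hne he hf => h.count_eq_of_nil hc hne he hf) ha hr

theorem winner_card (hg : GoodCopy I P Ms δ x k τ B₁ B₂ p) : Ms.card = ℓ :=
  ((mem_maxMatchings hg.valid.exists_matching).1 hg.winner.1).2

/-- The edge with `t ≤ τ e` in the second alternative limits how long the exploration can go on,
also through rounds that have no duel to sample. -/
theorem ExploreInv.endRound (hg : GoodCopy I P Ms δ x k τ B₁ B₂ p)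
    (h : ExploreInv I Ms x k τ m t [] A R s) :
    (∃ Mhat, endRound I t A R s = .verify 1 Mhat Stats.empty ∧
      VerifyInv I P Ms δ x k B₁ p m 1 Mhat Stats.empty) ∨
    (∃ todo A' R', CPEDB.endRound I t A R s = .explore (t + 1) todo A' R' s ∧
      ExploreInv I Ms x k τ m (t + 1) todo A' R' s ∧ ∃ e ∈ I.E, (t : ℝ) ≤ τ e) := by
  have hA := h.nextA_subset hg
  have hR := h.nextR_disjoint hg
  unfold CPEDB.endRound
  by_cases hcard : (nextA I t A R s).card = ℓ
  · left
    rw [if_pos hcard]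
    refine ⟨_, rfl, ?_⟩
    have heq : nextA I t A R s = Ms :=
      Finset.eq_of_subset_of_card_le hA (by rw [hcard, winner_card hg])
    refine ⟨Stats.records_empty x k _, heq, le_rfl, fun e f => by simp [Stats.empty],
      ⟨m, h.samples_le hg, rfl⟩, by simp [Stats.empty], fun e he => ?_⟩
    have h1 := log_radius_nonneg I.E hg.delta_pos hg.delta_le le_rfl
    have h2 := edgeHardness_nonneg (E := I.E) (P := P) (Ms := Ms) e
    simp only [Stats.empty, Nat.cast_zero]
    positivity
  · right
    rw [if_neg hcard]
    refine ⟨_, _, _, rfl, ⟨h.records, hA, hR, by omega, duelList_nodup _ _, ?_, ?_, ?_, ?_,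
      h.count_le_tau, h.samples⟩, ?_⟩
    · intro d hd
      obtain ⟨h1, h2, h3⟩ := mem_duelList.1 hd
      exact ⟨h3, h1, h2⟩
    · intro d hd h1 h2
      rw [if_pos (mem_duelList.2 ⟨h1, h2, hd⟩)]
      have h3 := h.count_eq d hd (undecided_next_subset h1) (undecided_next_subset h2)
      simp at h3
      omega
    · intro e f
      have := h.count_le e f
      omega
    · intro e he
      have := h.le_tau_of_undecided hg he
      push_cast
      linarith
    -- If every edge had passed its deadline, all edges of the winner would be decided, hence
    -- accepted, and the accepted set would have ℓ elements.
    · by_contra hcon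
      push Not at hcon
      refine hcard ((congrArg Finset.card ?_).trans (winner_card hg))
      refine Finset.Subset.antisymm hA fun e he => ?_
      have heE := maxMatchings_subset hg.winner.1 he
      by_contra hnot
      have hu : e ∈ undecided I.E (nextA I t A R s) (nextR I t A R s) :=
        mem_undecided.2 ⟨heE, hnot, fun h => Finset.disjoint_left.1 hR h he⟩
      have := h.le_tau_of_undecided hg hu
      linarith [hcon e heE]

end EndRound

theorem CopyInv.silent (hg : GoodCopy I P Ms δ x k τ B₁ B₂ p) {m : ℕ} (v : VState n ℓ)
    (h : CopyInv I P Ms δ x k τ B₁ p m v) : CopyInv I P Ms δ x k τ B₁ p m (v.silent I δ) := by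
  match v, h with
  | .explore t [] A R s, h =>
    rcases ExploreInv.endRound hg h with ⟨Mhat, h1, h2⟩ | ⟨todo, A', R', h1, h2, -⟩
    · simp only [VState.silent, h1]
      exact h2
    · simp only [VState.silent, h1]
      exact h2
  | .explore t (d :: todo) A R s, h => exact h
  | .verify t Mhat s, h =>
    have h' : VerifyInv I P Ms δ x k B₁ p m t Mhat s := h
    obtain rfl := h'.eq_winner
    simp only [VState.silent]
    split_ifs with h1 h2
    -- An error is impossible: lower scores are below the true ones, and against the winner these
    -- are below 1/2.
    · obtain ⟨M, hM, hne, hle⟩ := h1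
      have h3 := score_winner_lt hg.pos hg.valid.exists_matching hg.pref hg.winner hM hne
      have h4 := score_mono (hg.verify.lowerBounds_le hg.pref h'.records (t := t)
        fun e f _ _ => by have := h'.count_lt e f; omega) M Mhat
      linarith
    · rfl
    · exact h
  | .answer M, h => exact h

theorem CopyInv.observe (hg : GoodCopy I P Ms δ x k τ B₁ B₂ p) {m : ℕ} {v : VState n ℓ}
    (h : CopyInv I P Ms δ x k τ B₁ p m v) {ph : Phase} {d : Edge n ℓ × Edge n ℓ} {i : ℕ}
    (hr : v.request I δ = some (ph, d, i)) :
    CopyInv I P Ms δ x k τ B₁ p (m + 1) (v.observe I δ (outcome x k ph d i)) ∧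
      ¬ (v.observe I δ (outcome x k ph d i)).Halted := by
  match v, h with
  | .explore t [] A R s, _ => simp [VState.request] at hr
  | .explore t (d' :: todo) A R s, h =>
    have h' : ExploreInv I Ms x k τ m t (d' :: todo) A R s := h
    simp only [VState.request, Option.some.injEq, Prod.mk.injEq] at hr
    obtain ⟨rfl, rfl, rfl⟩ := hr
    refine ⟨?_, fun h => h⟩
    obtain ⟨hd, hd1, hd2⟩ := h'.todo_mem d' (by simp)
    have hnot : d' ∉ todo := (List.nodup_cons.1 h'.nodup).1
    have hcd := h'.count_eq d' hd hd1 hd2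
    rw [if_pos (by simp)] at hcd
    set b := outcome x k Phase.explore d' (s.count d'.1 d'.2)
    have hrec : ∀ d, IsDuel I.E d →
        (s.record d' b).count d.1 d.2 = s.count d.1 d.2 + if d = d' then 1 else 0 :=
      fun d hdd => s.record_count_of_isDuel hd hdd b
    refine ⟨h'.records.record hd.fst_ne, h'.subset, h'.disjoint, h'.one_le,
      (List.nodup_cons.1 h'.nodup).2, fun d hdt => h'.todo_mem d (by simp [hdt]), ?_, ?_,
      h'.le_tau, ?_, ?_⟩
    · intro d hdd h1 h2
      have h3 := h'.count_eq d hdd h1 h2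
      rw [hrec d hdd]
      by_cases hdd' : d = d'
      · subst hdd'
        simp [hnot, hcd]
      · simpa [hdd'] using h3
    · intro e f
      rw [Stats.record_count]
      split_ifs with hef
      · have : s.count e f = s.count d'.1 d'.2 := by
          rcases hef with rfl | rfl
          · rfl
          · exact h'.records.symm e f
        omega
      · exact h'.count_le e f
    · intro d hdd
      rw [hrec d hdd]
      by_cases hdd' : d = d'
      · subst hdd'
        -- The new count is exactly `t`, and both edges are still undecided, so both their deadlines
        -- bound it.
        rw [if_pos rfl, hcd, ← min_add_add_left]
        exact le_min (h'.le_tau _ hd1) (h'.le_tau _ hd2)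
      · simpa [hdd'] using h'.count_le_tau d hdd
    · rw [h'.samples, Finset.sum_congr rfl fun d hd => hrec d (mem_duels.1 hd),
        Finset.sum_add_distrib, Finset.sum_ite_eq', if_pos (mem_duels.2 hd)]
  | .verify t Mhat s, h =>
    have h' : VerifyInv I P Ms δ x k B₁ p m t Mhat s := h
    obtain rfl := h'.eq_winner
    simp only [VState.request] at hr
    split_ifs at hr with hRC
    push Not at hRC
    simp only [Option.some.injEq, Prod.mk.injEq] at hr
    obtain ⟨rfl, rfl, rfl⟩ := hr
    refine ⟨?_, fun h => h⟩
    obtain ⟨hcomp, hne⟩ := verifyDuel_comparable hg.valid hg.winner.1 hRC.2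
    obtain ⟨hC, hCne, -⟩ := challenger_spec hg.valid hRC.2
    obtain ⟨⟨h1, h2, h3, h4, h5⟩, -⟩ := verifyDuel_spec hg.valid hg.winner.1 hRC.2
    have hbound := hg.verify.lt_of_not_confirmed hg.pos hg.valid hg.pref hg.winner h'.records
      (fun e f => by have := h'.count_lt e f; omega) hRC.2
    show VerifyInv I P Mhat δ x k B₁ p (m + 1) (t + 1) Mhat _
    set d := verifyDuel I δ t Mhat s
    set b := outcome x k Phase.verify d (s.count d.1 d.2)
    have hdp : d.2 = p d.1 := hg.partner _ _ h3 h5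
    have hmem : d.1 ∈ rivalEdges I.E Mhat :=
      mem_rivalEdges.2 ⟨⟨hcomp.1, h2⟩, ⟨_, mem_rivals.2 ⟨hC, hCne, h1⟩⟩⟩
    have hrec : ∀ e ∈ rivalEdges I.E Mhat, (s.record d b).count e (p e) =
        s.count e (p e) + if e = d.1 then 1 else 0 := by
      intro e he
      rw [Stats.record_count]
      -- The second edge of a verification duel lies in the winner and a rival edge does not, so the
      -- sample is charged to the first edge only.
      have : ((e, p e) = d ∨ (p e, e) = d) ↔ e = d.1 := by
        constructor
        · rintro (hh | hh)
          · rw [← hh]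
          · exfalso
            have : e = d.2 := by rw [← hh]
            exact (mem_rivalEdges.1 he).1.2 (this ▸ h3)
        · rintro rfl
          left
          rw [← hdp]
      simp only [this]
    refine ⟨h'.records.record (hcomp.fst_ne hne), rfl, by omega, ?_, ?_, ?_, ?_⟩
    · intro e f
      have := h'.count_lt e f
      have := s.record_count_le d b e f
      omega
    · obtain ⟨m₁, hm₁, hm⟩ := h'.samples
      exact ⟨m₁, hm₁, by omega⟩
    · rw [Finset.sum_congr rfl hrec, Finset.sum_add_distrib, Finset.sum_ite_eq', if_pos hmem]
      have := h'.count_sum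
      omega
    · intro e he
      rw [hrec e he]
      have hmono := log_radius_mono I.E hg.delta_pos h'.one_le (Nat.le_succ t)
      have hnn := edgeHardness_nonneg (E := I.E) (P := P) (Ms := Mhat) e
      have hstep : 2 * Real.log (4 * numDuels I.E * (t : ℝ) ^ 3 / δ) * edgeHardness I.E P Mhat e ≤
          2 * Real.log (4 * numDuels I.E * ((t + 1 : ℕ) : ℝ) ^ 3 / δ) *
            edgeHardness I.E P Mhat e := by
        gcongr
      by_cases hed : e = d.1
      · subst hed
        rw [if_pos rfl, ← hdp]
        push_cast
        push_cast at hstep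
        -- The bound on the earlier count is available only if the duel has been sampled before; in
        -- both cases the new sample is paid for by the summand 1.
        by_cases h0 : s.count d.1 d.2 = 0
        · have hlog := log_radius_nonneg I.E hg.delta_pos hg.delta_le h'.one_le
          have : 0 ≤ 2 * Real.log (4 * numDuels I.E * (t : ℝ) ^ 3 / δ) *
            edgeHardness I.E P Mhat d.1 := by positivity
          rw [h0]
          push_cast
          linarith
        · have := hbound h0
          linarith
      · rw [if_neg hed]
        have := h'.count_le e he
        simp only [add_zero]
        linarith
  | .answer M, _ => simp [VState.request] at hr

theorem CopyInv.samples_le (hg : GoodCopy I P Ms δ x k τ B₁ B₂ p) (hB₂ : 0 ≤ B₂) {m : ℕ}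
    {v : VState n ℓ} (h : CopyInv I P Ms δ x k τ B₁ p m v) (hv : ¬ v.Halted) :
    (m : ℝ) ≤ B₁ + B₂ := by
  match v, h with
  | .explore t todo A R s, h =>
    have := ExploreInv.samples_le hg h
    linarith
  | .verify t Mhat s, h =>
    have h' : VerifyInv I P Ms δ x k B₁ p m t Mhat s := h
    obtain ⟨m₁, hm₁, hm⟩ := h'.samples
    obtain ⟨N, rfl⟩ : ∃ N, t = N + 1 := ⟨t - 1, by have := h'.one_le; omega⟩
    have hN : (N : ℝ) ≤ B₂ := by
      apply hg.le_of_sum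
      have h1 : N = ∑ e ∈ rivalEdges I.E Ms, s.count e (p e) := by
        have := h'.count_sum
        omega
      have h2 : (N : ℝ) = ∑ e ∈ rivalEdges I.E Ms, (s.count e (p e) : ℝ) := by
        rw [h1]
        push_cast
        rfl
      conv_lhs => rw [h2]
      refine sum_le_sum fun e he => ?_
      have := h'.count_le e he
      push_cast at this
      exact this
    have : (m : ℝ) = m₁ + N := by
      have : m = m₁ + N := by omega
      exact_mod_cast this
    linarith
  | .answer M, _ => exact absurd trivial hv

theorem VState.ready_verify (t : ℕ) (Mhat : Finset (Edge n ℓ)) (s : Stats n ℓ) :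
    ∃ r : ℕ, ((VState.silent I δ)^[r] (.verify t Mhat s)).Ready I δ := by
  by_cases h1 : Refuted I δ t Mhat s
  · refine ⟨1, Or.inr ?_⟩
    simp [VState.silent, h1, VState.Halted]
  · by_cases h2 : Confirmed I δ t Mhat s
    · refine ⟨1, Or.inr ?_⟩
      simp [VState.silent, h1, h2, VState.Halted]
    · refine ⟨0, Or.inl ?_⟩
      simp [VState.request, h1, h2]

/-- Undecided edges may leave no duel to sample, and then rounds pass silently while the radius and
the accuracy still change. Such a stretch ends, as the round number eventually exceeds all the
deadlines `τ e`. -/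
theorem CopyInv.exists_ready (hg : GoodCopy I P Ms δ x k τ B₁ B₂ p) {m : ℕ} {v : VState n ℓ}
    (h : CopyInv I P Ms δ x k τ B₁ p m v) :
    ∃ r : ℕ, ((VState.silent I δ)^[r] v).Ready I δ := by
  match v, h with
  | .explore t (d :: todo) A R s, _ => exact ⟨0, Or.inl rfl⟩
  | .verify t Mhat s, _ => exact VState.ready_verify t Mhat s
  | .answer M, _ => exact ⟨0, Or.inr trivial⟩
  | .explore t [] A R s, h =>
    obtain ⟨D, hD⟩ : ∃ D : ℕ, ∀ e ∈ I.E, τ e < D := by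
      obtain ⟨D, hD⟩ := exists_nat_gt (∑ e ∈ I.E, τ e)
      exact ⟨D, fun e he =>
        (Finset.single_le_sum (fun e _ => hg.tau_nonneg e) he).trans_lt hD⟩
    -- The induction is on `j`, the number of rounds that may still pass before round `D`, by which
    -- all edges are decided.
    have key : ∀ j t A R, ExploreInv I Ms x k τ m t [] A R s → D ≤ t + j →
        ∃ r : ℕ, ((VState.silent I δ)^[r] (.explore t [] A R s)).Ready I δ := by
      intro j
      induction j with
      | zero =>
        intro t A R h ht
        rcases h.endRound hg with ⟨Mhat, h1, -⟩ | ⟨todo, A', R', -, -, e, he, hle⟩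
        · obtain ⟨r, hr⟩ := VState.ready_verify (I := I) (δ := δ) 1 Mhat Stats.empty
          refine ⟨r + 1, ?_⟩
          rw [Function.iterate_succ_apply]
          simpa only [VState.silent, h1] using hr
        · exfalso
          have h3 : (D : ℝ) ≤ t := by exact_mod_cast ht
          linarith [hD e he]
      | succ j ih =>
        intro t A R h ht
        rcases h.endRound hg with ⟨Mhat, h1, -⟩ | ⟨todo, A', R', h1, h2, -⟩
        · obtain ⟨r, hr⟩ := VState.ready_verify (I := I) (δ := δ) 1 Mhat Stats.empty
          refine ⟨r + 1, ?_⟩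
          rw [Function.iterate_succ_apply]
          simpa only [VState.silent, h1] using hr
        · cases todo with
          | nil =>
            obtain ⟨r, hr⟩ := ih (t + 1) A' R' h2 (by omega)
            refine ⟨r + 1, ?_⟩
            rw [Function.iterate_succ_apply]
            have hsil : VState.silent I δ (.explore t [] A R s) = .explore (t + 1) [] A' R' s := h1
            rw [hsil]
            exact hr
          | cons d todo =>
            refine ⟨1, Or.inl ?_⟩
            have hsil : VState.silent I δ (.explore t [] A R s) =
              .explore (t + 1) (d :: todo) A' R' s := h1
            rw [Function.iterate_one, hsil]
            rfl
    exact key D t A R h (by omega)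

/-- Resuming a good copy either takes a sample, or returns the Condorcet winner. -/
theorem CopyInv.resume (hg : GoodCopy I P Ms δ x k τ B₁ B₂ p) {m : ℕ} {v : VState n ℓ}
    (h : CopyInv I P Ms δ x k τ B₁ p m v) :
    (CopyInv I P Ms δ x k τ B₁ p (m + 1) (v.resume I δ x k).1 ∧
      ¬ (v.resume I δ x k).1.Halted) ∨ v.resume I δ x k = (.answer Ms, 0) := by
  have hset : CopyInv I P Ms δ x k τ B₁ p m (v.settle I δ) :=
    VState.settle_induction (fun v hv => CopyInv.silent hg v hv) h
  have hready := VState.settle_ready (h.exists_ready hg)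
  rcases hr : (v.settle I δ).request I δ with _ | ⟨ph, d, i⟩
  · right
    rw [VState.resume_of_none hr]
    rcases hready with h1 | h1
    · simp [hr] at h1
    · generalize v.settle I δ = w at *
      match w, hset, h1 with
      | .answer M, hM, _ =>
        have : M = Ms := hM
        rw [this]
  · left
    rw [VState.resume_of_request hr]
    exact hset.observe hg hr

/-- A good copy returns the Condorcet winner when it is resumed for the `j`-th time, for some
`j ≤ B + 1`, where `B` is the bound on the number of samples. -/
theorem GoodCopy.exists_answer (hg : GoodCopy I P Ms δ x k τ B₁ B₂ p) (hB₂ : 0 ≤ B₂) {B : ℕ}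
    (hB : B₁ + B₂ < B + 1) :
    ∃ j ≤ B, (fun v : VState n ℓ => (v.resume I δ x k).1)^[j + 1] (VState.init I) =
      .answer Ms := by
  by_contra hcon
  push Not at hcon
  -- Without an answer every resumption takes exactly one sample, so the number of resumptions is
  -- the number of samples, and `B + 1` of them exceed the bound.
  have key : ∀ j ≤ B + 1, CopyInv I P Ms δ x k τ B₁ p j
      ((fun v : VState n ℓ => (v.resume I δ x k).1)^[j] (VState.init I)) ∧
      ¬ ((fun v : VState n ℓ => (v.resume I δ x k).1)^[j] (VState.init I)).Halted := by
    intro j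
    induction j with
    | zero => exact fun _ => ⟨CopyInv.init hg, fun h => h⟩
    | succ j ih =>
      intro hj
      obtain ⟨h1, -⟩ := ih (by omega)
      have h2 := hcon j (by omega)
      rw [Function.iterate_succ_apply'] at h2 ⊢
      rcases h1.resume hg with h3 | h3
      · exact h3
      · exact absurd (congrArg Prod.fst h3) h2
  obtain ⟨h1, h2⟩ := key (B + 1) le_rfl
  have := h1.samples_le hg hB₂ h2
  push_cast at this
  linarith

end GoodCopy

end CPEDB

end

/-! ### The schedule and the parallel run -/

section

open Finset

namespace CPEDB

variable {n ℓ : ℕ}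

/-! ### The schedule of the copies -/

theorem mem_scheduled {t k : ℕ} (ht : 1 ≤ t) : k ∈ scheduled t ↔ 2 ^ k ∣ t := by
  simp only [scheduled, List.mem_filter, List.mem_range, decide_eq_true_eq]
  rw [← Nat.dvd_iff_mod_eq_zero]
  constructor
  · exact fun h => h.2
  · intro h
    have h1 := Nat.le_of_dvd ht h
    have h2 : k < 2 ^ k := Nat.lt_two_pow_self
    exact ⟨by omega, h⟩

theorem scheduled_nodup (t : ℕ) : (scheduled t).Nodup := List.nodup_range.filter _

theorem scheduled_length {t : ℕ} (ht : 1 ≤ t) : (scheduled t).length ≤ padicValNat 2 t + 1 := by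
  have h1 : (scheduled t).length = (scheduled t).toFinset.card :=
    (List.toFinset_card_of_nodup (scheduled_nodup t)).symm
  rw [h1, ← Finset.card_range (padicValNat 2 t + 1)]
  apply Finset.card_le_card
  intro k hk
  rw [List.mem_toFinset, mem_scheduled ht,
    padicValNat_dvd_iff_le (p := 2) (by omega)] at hk
  rw [Finset.mem_range]
  omega

/-- Round s resumes one copy for each power of 2 dividing s, that is v₂(s) + 1 copies. The
valuations add up to v₂(t!), which is at most t by Legendre's formula. -/
theorem sum_scheduled_length_le (t : ℕ) :
    ∑ s ∈ range t, (scheduled (s + 1)).length ≤ 2 * t := by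
  have h1 : ∑ s ∈ range t, (scheduled (s + 1)).length ≤ padicValNat 2 t.factorial + t := by
    induction t with
    | zero => simp
    | succ t ih =>
      rw [Finset.sum_range_succ, Nat.factorial_succ,
        padicValNat.mul (by omega) (Nat.factorial_ne_zero t)]
      have := scheduled_length (t := t + 1) (by omega)
      omega
  have h2 := sub_one_mul_padicValNat_factorial (p := 2) t
  omega

/-! ### The parallel run -/

section Parallel

variable {I : Input n ℓ} {δ : ℝ} {x : Index n ℓ → Bool}

/-- Copy `k` after one more resumption. -/
noncomputable def copyStep (I : Input n ℓ) (δ : ℝ) (x : Index n ℓ → Bool) (k : ℕ)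
    (v : VState n ℓ) : VState n ℓ :=
  (v.resume I (δ / 2 ^ (k + 1)) x k).1

theorem resumeCopy_of_some {p : PState n ℓ} {M : Finset (Edge n ℓ)} (h : p.out = some M) (k : ℕ) :
    p.resumeCopy I δ x k = p := by
  unfold PState.resumeCopy
  rw [h]

theorem resumeCopy_of_none {p : PState n ℓ} (h : p.out = none) (k : ℕ) :
    p.resumeCopy I δ x k =
      ⟨Function.update p.copies k (copyStep I δ x k (p.copies k)),
        p.samples + ((p.copies k).resume I (δ / 2 ^ (k + 1)) x k).2,
        (copyStep I δ x k (p.copies k)).result⟩ := by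
  unfold PState.resumeCopy
  rw [h]
  rfl

theorem foldl_of_some {p : PState n ℓ} {M : Finset (Edge n ℓ)} (h : p.out = some M) (l : List ℕ) :
    l.foldl (PState.resumeCopy I δ x) p = p := by
  induction l with
  | nil => rfl
  | cons k l ih => rw [List.foldl_cons, resumeCopy_of_some h, ih]

theorem foldl_samples_le (p : PState n ℓ) (l : List ℕ) :
    (l.foldl (PState.resumeCopy I δ x) p).samples ≤ p.samples + l.length := by
  induction l generalizing p with
  | nil => simp
  | cons k l ih =>
    rw [List.foldl_cons, List.length_cons]
    have h1 := ih (p.resumeCopy I δ x k)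
    have h2 : (p.resumeCopy I δ x k).samples ≤ p.samples + 1 := by
      rcases h : p.out with _ | M
      · rw [resumeCopy_of_none h]
        have := VState.resume_snd_le I (δ / 2 ^ (k + 1)) x k (p.copies k)
        simp only
        omega
      · rw [resumeCopy_of_some h]
        omega
    omega

/-- Copies do not interact except through the output. As long as there is none, a pass over a list
without repetition advances each listed copy exactly once and none of these copies has produced an
answer. -/
theorem foldl_of_out_none {p : PState n ℓ} {l : List ℕ} (hl : l.Nodup)
    (h : (l.foldl (PState.resumeCopy I δ x) p).out = none) :
    (∀ k, k ∉ l → (l.foldl (PState.resumeCopy I δ x) p).copies k = p.copies k) ∧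
    ∀ k ∈ l, (l.foldl (PState.resumeCopy I δ x) p).copies k = copyStep I δ x k (p.copies k) ∧
      (p.out = none → (copyStep I δ x k (p.copies k)).result = none) := by
  induction l generalizing p with
  | nil => simp
  | cons a l ih =>
    rw [List.foldl_cons] at h ⊢
    obtain ⟨hal, hl⟩ := List.nodup_cons.1 hl
    rcases hp : p.out with _ | M
    swap
    · rw [resumeCopy_of_some hp, foldl_of_some hp, hp] at h
      exact absurd h (by simp)
    obtain ⟨ih1, ih2⟩ := ih hl h
    have hq := resumeCopy_of_none (I := I) (δ := δ) (x := x) hp a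
    have hqout : (p.resumeCopy I δ x a).out = none := by
      rcases hq' : (p.resumeCopy I δ x a).out with _ | M
      · rfl
      · rw [foldl_of_some hq', hq'] at h
        exact absurd h (by simp)
    have hcop : ∀ k, k ≠ a → (p.resumeCopy I δ x a).copies k = p.copies k := by
      intro k hk
      rw [hq]
      simp [Function.update_of_ne hk]
    constructor
    · intro k hk
      rw [List.mem_cons, not_or] at hk
      rw [ih1 k hk.2, hcop k hk.1]
    · intro k hk
      rcases List.mem_cons.1 hk with rfl | hk
      · rw [ih1 k hal]
        refine ⟨?_, fun _ => ?_⟩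
        · rw [hq]
          simp
        · rw [hq] at hqout
          exact hqout
      · have hne : k ≠ a := fun h => hal (h ▸ hk)
        have := ih2 k hk
        rw [hcop k hne] at this
        exact ⟨this.1, fun _ => this.2 hqout⟩

/-- Copy `k` is resumed at the multiples of 2^k, of which there are `t / 2 ^ k` up to round `t`. -/
theorem parallel_of_out_none {t : ℕ} (h : (parallel I δ x t).out = none) (k : ℕ) :
    (parallel I δ x t).copies k = (copyStep I δ x k)^[t / 2 ^ k] (VState.init I) := by
  induction t with
  | zero => simp [parallel, PState.init]
  | succ t ih =>
    have hprev : (parallel I δ x t).out = none := by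
      rcases h' : (parallel I δ x t).out with _ | M
      · rfl
      · rw [parallel, foldl_of_some h', h'] at h
        exact absurd h (by simp)
    have ih := ih hprev
    rw [parallel] at h ⊢
    obtain ⟨h1, h2⟩ := foldl_of_out_none (scheduled_nodup _) h
    rw [Nat.succ_div]
    split_ifs with hd
    · rw [(h2 k ((mem_scheduled (by omega)).2 hd)).1, ih, Function.iterate_succ_apply']
    · rw [h1 k fun hk => hd ((mem_scheduled (by omega)).1 hk), ih, add_zero]

/-- If the `(j+1)`-st resumption of copy `k` returns a matching, then the parallel run has returned
a matching at the time of this resumption. -/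
theorem parallel_out_ne_none {k j : ℕ} {M : Finset (Edge n ℓ)}
    (h : ((copyStep I δ x k)^[j + 1] (VState.init I)).result = some M) :
    (parallel I δ x ((j + 1) * 2 ^ k)).out ≠ none := by
  intro hnone
  obtain ⟨t, ht⟩ : ∃ t, (j + 1) * 2 ^ k = t + 1 :=
    ⟨(j + 1) * 2 ^ k - 1, by have : 0 < (j + 1) * 2 ^ k := by positivity
                             omega⟩
  rw [ht] at hnone
  have hprev : (parallel I δ x t).out = none := by
    rcases h' : (parallel I δ x t).out with _ | M
    · rfl
    · rw [parallel, foldl_of_some h', h'] at hnone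
      exact absurd hnone (by simp)
  have hd : 2 ^ k ∣ t + 1 := ht ▸ Dvd.intro_left _ rfl
  -- Just before the round (j + 1) 2^k copy `k` has been resumed `j` times; this round supplies the
  -- resumption that answers.
  have hdiv : t / 2 ^ k = j := by
    have h1 : (t + 1) / 2 ^ k = j + 1 := by
      rw [← ht]
      exact Nat.mul_div_cancel _ (by positivity)
    rw [Nat.succ_div, if_pos hd] at h1
    omega
  rw [parallel] at hnone
  have h2 := ((foldl_of_out_none (scheduled_nodup _) hnone).2 k
    ((mem_scheduled (by omega)).2 hd)).2 hprev
  rw [parallel_of_out_none hprev, hdiv, ← Function.iterate_succ_apply' (copyStep I δ x k), h] at h2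
  exact absurd h2 (by simp)

theorem parallel_samples_le (t : ℕ) : (parallel I δ x t).samples ≤ 2 * t := by
  refine le_trans ?_ (sum_scheduled_length_le t)
  induction t with
  | zero => simp [parallel, PState.init]
  | succ t ih =>
    rw [Finset.sum_range_succ, parallel]
    have := foldl_samples_le (I := I) (δ := δ) (x := x) (parallel I δ x t) (scheduled (t + 1))
    omega

theorem parallel_eq_of_out {t : ℕ} {M : Finset (Edge n ℓ)} (h : (parallel I δ x t).out = some M)
    {u : ℕ} (hu : t ≤ u) : parallel I δ x u = parallel I δ x t := by
  induction u, hu using Nat.le_induction with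
  | base => rfl
  | succ u hu ih => rw [parallel, ih, foldl_of_some h]

/-- After an output the state is frozen, so the samples of the first `t` rounds are all there are.
-/
theorem sampleComplexity_le {t : ℕ} (h : (parallel I δ x t).out ≠ none) :
    sampleComplexity I δ x ≤ ((2 * t : ℕ) : ENNReal) := by
  obtain ⟨M, hM⟩ := Option.ne_none_iff_exists'.1 h
  refine iSup_le fun u => ?_
  rw [Nat.cast_le]
  rcases le_total t u with hu | hu
  · rw [parallel_eq_of_out hM hu]
    exact parallel_samples_le t
  · exact (parallel_samples_le u).trans (by omega)

/-- If all the verification phases are concentrated, then only the winner can be returned. -/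
theorem parallel_sound {P : EdgeMatrix n ℓ} {Ms : Finset (Edge n ℓ)} (hI : I.Valid)
    (hP : IsPreference I.E P) (hMs : IsCondorcetWinner I.E P Ms)
    (hc : ∀ k, Concentrated I.E P (δ / 2 ^ (k + 1)) x k .verify) (t : ℕ) :
    (∀ k, Sound I Ms x k ((parallel I δ x t).copies k)) ∧
      ∀ M, (parallel I δ x t).out = some M → M = Ms := by
  have hfold : ∀ (l : List ℕ) (p : PState n ℓ), ((∀ k, Sound I Ms x k (p.copies k)) ∧
      ∀ M, p.out = some M → M = Ms) →
      (∀ k, Sound I Ms x k ((l.foldl (PState.resumeCopy I δ x) p).copies k)) ∧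
      ∀ M, (l.foldl (PState.resumeCopy I δ x) p).out = some M → M = Ms := by
    intro l
    induction l with
    | nil => exact fun p hp => hp
    | cons a l ih =>
      intro p hp
      rw [List.foldl_cons]
      apply ih
      rcases hout : p.out with _ | M
      · rw [resumeCopy_of_none hout]
        have hs := (hp.1 a).resume hI hP hMs (hc a)
        refine ⟨fun k => ?_, fun M hM => hs.result_eq hM⟩
        by_cases hk : k = a
        · subst hk
          simpa [copyStep] using hs
        · simpa [Function.update_of_ne hk] using hp.1 k
      · rw [resumeCopy_of_some hout]
        exact hp
  induction t with
  | zero => exact ⟨fun k => Sound.init I Ms x k, by simp [parallel, PState.init]⟩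
  | succ t ih => exact hfold _ _ ih

variable {P : EdgeMatrix n ℓ} {Ms : Finset (Edge n ℓ)} {k : ℕ} {τ : Edge n ℓ → ℝ} {B₁ B₂ : ℝ}
  {p : Edge n ℓ → Edge n ℓ}

theorem GoodCopy.parallel_out_ne_none (hg : GoodCopy I P Ms (δ / 2 ^ (k + 1)) x k τ B₁ B₂ p)
    (hB₂ : 0 ≤ B₂) {B : ℕ} (hB : B₁ + B₂ < B + 1) :
    (parallel I δ x ((B + 1) * 2 ^ k)).out ≠ none := by
  obtain ⟨j, hj, hans⟩ := hg.exists_answer hB₂ hB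
  have h1 : (parallel I δ x ((j + 1) * 2 ^ k)).out ≠ none :=
    CPEDB.parallel_out_ne_none (M := Ms) (by
      unfold copyStep
      rw [hans]
      rfl)
  obtain ⟨M, hM⟩ := Option.ne_none_iff_exists'.1 h1
  rw [parallel_eq_of_out hM (Nat.mul_le_mul_right _ (by omega)), hM]
  simp

/-- If the first copy is good and does not need any sample, then no samples are taken. -/
theorem GoodCopy.sampleComplexity_eq_zero (hg : GoodCopy I P Ms (δ / 2 ^ (0 + 1)) x 0 τ B₁ B₂ p)
    (hB₂ : 0 ≤ B₂) (hB : B₁ + B₂ < 1) : sampleComplexity I δ x = 0 := by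
  have hres : (VState.init I).resume I (δ / 2 ^ (0 + 1)) x 0 = (.answer Ms, 0) := by
    rcases (CopyInv.init hg).resume hg with ⟨h1, h2⟩ | h
    · have := h1.samples_le hg hB₂ h2
      push_cast at this
      linarith
    · exact h
  have hsched : scheduled (0 + 1) = [0] := by decide
  have h1 : parallel I δ x 1 = (PState.init I).resumeCopy I δ x 0 := by
    rw [parallel, hsched]
    rfl
  have hout : (parallel I δ x 1).out = some Ms := by
    rw [h1, resumeCopy_of_none rfl]
    simp only [copyStep, PState.init, hres]
    rfl
  have hsam : (parallel I δ x 1).samples = 0 := by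
    rw [h1, resumeCopy_of_none rfl]
    simp only [PState.init, hres]
  refine le_antisymm (iSup_le fun u => ?_) zero_le
  rcases Nat.eq_zero_or_pos u with rfl | hu
  · simp [parallel, PState.init]
  · rw [parallel_eq_of_out hout hu, hsam]
    simp

end Parallel

end CPEDB

end

/-! ### Concentration probabilities and independence of the copies -/

section

open Finset MeasureTheory ProbabilityTheory

namespace CPEDB

variable {n ℓ : ℕ} {E : Finset (Edge n ℓ)}

/-! ### Sums over duels -/

/-- Ordered pairs of distinct comparable edges are the duels and their reversals, since comparable
distinct edges have different candidates. -/
theorem sum_offDiag_eq_sum_duels (g : Edge n ℓ × Edge n ℓ → ℝ) :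
    ∑ j : Fin ℓ, ∑ d ∈ (edgesAt E j).offDiag, g d = ∑ d ∈ duels E, (g d + g d.swap) := by
  classical
  set C : Finset (Edge n ℓ × Edge n ℓ) := univ.filter (fun d => Comparable E d.1 d.2 ∧ d.1 ≠ d.2)
    with hC
  have hmem : ∀ d, d ∈ C ↔ Comparable E d.1 d.2 ∧ d.1 ≠ d.2 := fun d => by simp [hC]
  have h1 : ∑ j : Fin ℓ, ∑ d ∈ (edgesAt E j).offDiag, g d = ∑ d ∈ C, g d := by
    rw [← Finset.sum_fiberwise C (fun d => d.1.2)]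
    refine Finset.sum_congr rfl fun j _ => Finset.sum_congr ?_ fun _ _ => rfl
    ext d
    rw [mem_filter, hmem]
    simp only [mem_offDiag, mem_edgesAt, Comparable]
    constructor
    · rintro ⟨⟨h1, rfl⟩, ⟨h2, h3⟩, h4⟩
      exact ⟨⟨⟨h1, h2, h3.symm⟩, h4⟩, rfl⟩
    · rintro ⟨⟨⟨h1, h2, h3⟩, h4⟩, rfl⟩
      exact ⟨⟨h1, rfl⟩, ⟨h2, h3.symm⟩, h4⟩
  rw [h1, Finset.sum_add_distrib, ← Finset.sum_filter_add_sum_filter_not C (fun d => d.1.1 < d.2.1)]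
  congr 1
  · refine Finset.sum_congr ?_ fun _ _ => rfl
    ext d
    simp only [hC, mem_filter, mem_univ, true_and, mem_duels, IsDuel]
    constructor
    · exact fun h => ⟨h.1.1, h.2⟩
    · exact fun h => ⟨⟨h.1, fun heq => h.2.ne (by rw [heq])⟩, h.2⟩
  · refine Finset.sum_bij' (fun d _ => d.swap) (fun d _ => d.swap) ?_ ?_ ?_ ?_ ?_
    · intro d hd
      simp only [hC, mem_filter, mem_univ, true_and] at hd
      rw [mem_duels]
      exact ⟨hd.1.1.symm, lt_of_le_of_ne (not_lt.1 hd.2) (hd.1.1.fst_ne hd.1.2).symm⟩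
    · intro d hd
      rw [mem_duels] at hd
      simp only [hC, mem_filter, mem_univ, true_and]
      exact ⟨⟨hd.1.symm, fun heq => hd.2.ne (by
        have : d.2 = d.1 := heq
        rw [this])⟩, hd.2.not_gt⟩
    · intro d _
      exact Prod.swap_swap d
    · intro d _
      exact Prod.swap_swap d
    · intro d _
      rw [Prod.swap_swap]

theorem numDuels_eq_card : numDuels E = ((duels E).card : ℝ) := by
  have h := sum_offDiag_eq_sum_duels (E := E) (fun _ => 1 / 2)
  simp only [Finset.sum_const, nsmul_eq_mul] at h
  have h2 : numDuels E = ∑ j : Fin ℓ, (((edgesAt E j).offDiag.card : ℕ) : ℝ) * (1 / 2) := by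
    unfold numDuels
    refine Finset.sum_congr rfl fun j _ => ?_
    rw [offDiag_card, Nat.cast_sub (Nat.le_mul_self _)]
    push_cast
    ring
  rw [h2, h]
  ring

/-! ### Concentration -/

section Probability

variable {P : EdgeMatrix n ℓ} {Ω : Type*}

theorem measurable_winCount [MeasurableSpace Ω] {o : ℕ → Ω → Bool} (h : ∀ i, Measurable (o i))
    (T : ℕ) : Measurable (fun ω => (winCount (fun i => o i ω) T : ℝ)) := by
  simp_rw [winCount_eq_sum]
  refine Finset.measurable_sum _ fun i _ => ?_
  exact (measurable_of_countable (fun b : Bool => if b = true then (1 : ℝ) else 0)).comp (h i)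

/-- The σ-algebra is arbitrary and only legitimate duels of this copy and phase have to be
measurable. So the lemma also applies to the σ-algebra generated by a block of copies, as the
independence argument requires. -/
theorem measurableSet_concentrated {m : MeasurableSpace Ω} {X : Index n ℓ → Ω → Bool} {k : ℕ}
    {ph : Phase} (h : ∀ d i, IsDuel E d → Measurable (X (k, ph, d, i))) (δ : ℝ) :
    MeasurableSet {ω | Concentrated E P δ (fun i => X i ω) k ph} := by
  have heq : {ω | Concentrated E P δ (fun i => X i ω) k ph} =
      ⋂ (d) (_ : IsDuel E d) (t : ℕ) (T : ℕ) (_ : 1 ≤ T) (_ : T ≤ t),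
        {ω | |(winCount (fun i => X (k, ph, d, i) ω) T : ℝ) / T - P d.1 d.2| ≤
          radius (numDuels E) δ t T} := by
    ext ω
    simp only [Concentrated, Set.mem_ofPred_eq, Set.mem_iInter]
  rw [heq]
  refine MeasurableSet.iInter fun d => MeasurableSet.iInter fun hd => MeasurableSet.iInter fun t =>
    MeasurableSet.iInter fun T => MeasurableSet.iInter fun _ => MeasurableSet.iInter fun _ => ?_
  refine measurableSet_le ?_ measurable_const
  exact (((measurable_winCount (fun i => h d i hd) T).div_const _).sub_const _).norm

/-- All the duels of copy `k`, which has confidence `δ / 2 ^ (k + 1)`, are concentrated. -/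
def CopyConcentrated (E : Finset (Edge n ℓ)) (P : EdgeMatrix n ℓ) (δ : ℝ) (k : ℕ)
    (x : Index n ℓ → Bool) : Prop :=
  Concentrated E P delta0 x k .explore ∧ Concentrated E P (δ / 2 ^ (k + 1)) x k .verify

/-- None of the copies `0, …, k - 1` is concentrated. -/
def noneConcentrated (E : Finset (Edge n ℓ)) (P : EdgeMatrix n ℓ) (δ : ℝ)
    (X : Index n ℓ → Ω → Bool) (k : ℕ) : Set Ω :=
  {ω | ∀ j < k, ¬ CopyConcentrated E P δ j (fun i => X i ω)}

theorem measurableSet_noneConcentrated {m : MeasurableSpace Ω} (δ : ℝ) (k : ℕ)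
    {X : Index n ℓ → Ω → Bool} (h : ∀ j < k, ∀ ph d i, IsDuel E d → Measurable (X (j, ph, d, i))) :
    MeasurableSet (noneConcentrated E P δ X k) := by
  have : noneConcentrated E P δ X k =
      ⋂ (j) (_ : j < k), {ω | CopyConcentrated E P δ j (fun i => X i ω)}ᶜ := by
    ext ω
    simp [noneConcentrated]
  rw [this]
  refine MeasurableSet.iInter fun j => MeasurableSet.iInter fun hj => MeasurableSet.compl ?_
  exact (measurableSet_concentrated (fun d i hd => h j hj _ d i hd) _).inter
    (measurableSet_concentrated (fun d i hd => h j hj _ d i hd) _)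

variable [MeasurableSpace Ω] {μ : Measure Ω} [IsProbabilityMeasure μ] {X : Index n ℓ → Ω → Bool}

theorem hoeffding_bool {o : ℕ → Ω → Bool} (hm : ∀ i, Measurable (o i)) (hind : iIndepFun o μ)
    {p : ℝ} (hp : 0 ≤ p) (hlaw : ∀ i, μ {ω | o i ω = true} = ENNReal.ofReal p) {T : ℕ} (hT : 1 ≤ T)
    {r : ℝ} (hr : 0 ≤ r) :
    μ {ω | r < |(winCount (fun i => o i ω) T : ℝ) / T - p|} ≤
      ENNReal.ofReal (2 * Real.exp (-(2 * T * r ^ 2))) := by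
  set φ : Bool → ℝ := fun b => if b = true then 1 else 0 with hφ
  have hφm : Measurable φ := measurable_of_countable φ
  have hTpos : (0 : ℝ) < T := by exact_mod_cast hT
  have hint : ∀ i, ∫ ω, φ (o i ω) ∂μ = p := by
    intro i
    have : (fun ω => φ (o i ω)) = Set.indicator {ω | o i ω = true} 1 := by
      funext ω
      by_cases h : o i ω = true <;> simp [hφ, h]
    rw [this, integral_indicator_one (measurableSet_eq_fun (hm i) measurable_const)]
    rw [measureReal_def, hlaw, ENNReal.toReal_ofReal hp]
  have hsub : ∀ i, HasSubgaussianMGF (fun ω => φ (o i ω) - p) ((‖(1 : ℝ) - 0‖₊ / 2) ^ 2) μ := by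
    intro i
    have := hasSubgaussianMGF_of_mem_Icc (μ := μ) (X := fun ω => φ (o i ω)) (a := 0) (b := 1)
      (hφm.comp (hm i)).aemeasurable (Filter.Eventually.of_forall fun ω => by
        simp only [hφ]
        split_ifs <;> simp)
    rwa [hint i] at this
  have hind1 : iIndepFun (fun i ω => φ (o i ω) - p) μ :=
    hind.comp (fun _ b => φ b - p) (fun _ => hφm.sub_const p)
  have hind2 : iIndepFun (fun i ω => -(φ (o i ω) - p)) μ :=
    hind.comp (fun _ b => -(φ b - p)) (fun _ => (hφm.sub_const p).neg)
  have hTr : (0 : ℝ) ≤ T * r := by positivity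
  have h1 := HasSubgaussianMGF.measure_sum_range_ge_le_of_iIndepFun hind1 (n := T)
    (fun i _ => hsub i) hTr
  have h2 := HasSubgaussianMGF.measure_sum_range_ge_le_of_iIndepFun hind2 (n := T)
    (fun i _ => (hsub i).neg) hTr
  -- Variables in [0, 1] have variance proxy 1/4, so the exponent (Tr)² / (2T/4) equals 2Tr².
  have hexp : Real.exp (-(T * r) ^ 2 / (2 * T * (((‖(1 : ℝ) - 0‖₊ / 2) ^ 2 : NNReal) : ℝ))) =
      Real.exp (-(2 * T * r ^ 2)) := by
    congr 1
    simp
    field_simp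
  rw [hexp] at h1 h2
  have hsum : ∀ ω, ∑ i ∈ range T, (φ (o i ω) - p) = winCount (fun i => o i ω) T - T * p := by
    intro ω
    rw [Finset.sum_sub_distrib, winCount_eq_sum]
    simp [hφ]
  have hsubset : {ω | r < |(winCount (fun i => o i ω) T : ℝ) / T - p|} ⊆
      {ω | T * r ≤ ∑ i ∈ range T, (φ (o i ω) - p)} ∪
      {ω | T * r ≤ ∑ i ∈ range T, -(φ (o i ω) - p)} := by
    intro ω hω
    simp only [Set.mem_ofPred_eq, Set.mem_union, Finset.sum_neg_distrib, hsum] at hω ⊢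
    have heq : (winCount (fun i => o i ω) T : ℝ) - T * p =
        T * ((winCount (fun i => o i ω) T : ℝ) / T - p) := by
      field_simp
    rw [heq]
    rcases lt_abs.1 hω with h | h
    · left
      exact mul_le_mul_of_nonneg_left h.le hTpos.le
    · right
      rw [← mul_neg]
      exact mul_le_mul_of_nonneg_left h.le hTpos.le
  calc μ {ω | r < |(winCount (fun i => o i ω) T : ℝ) / T - p|}
      ≤ μ {ω | T * r ≤ ∑ i ∈ range T, (φ (o i ω) - p)} +
        μ {ω | T * r ≤ ∑ i ∈ range T, -(φ (o i ω) - p)} :=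
        (measure_mono hsubset).trans (measure_union_le _ _)
    _ ≤ ENNReal.ofReal (Real.exp (-(2 * T * r ^ 2))) +
        ENNReal.ofReal (Real.exp (-(2 * T * r ^ 2))) := by
        gcongr
        · rw [← ofReal_measureReal]
          exact ENNReal.ofReal_le_ofReal h1
        · rw [← ofReal_measureReal]
          exact ENNReal.ofReal_le_ofReal h2
    _ = _ := by
        rw [← ENNReal.ofReal_add (Real.exp_pos _).le (Real.exp_pos _).le]
        ring_nf

/-- The radius makes the exponent 2Tr² equal to the logarithm of 4Kt³/δ, whatever `T` is. -/
theorem IsDuelOutcomes.measure_deviation_le (hX : IsDuelOutcomes μ E P X)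
    (hP : IsPreference E P) {δ : ℝ} (h0 : 0 < δ) (h1 : δ ≤ 1) (k : ℕ) (ph : Phase)
    {d : Edge n ℓ × Edge n ℓ} (hd : IsDuel E d) {t T : ℕ} (hT : 1 ≤ T) (ht : T ≤ t) :
    μ {ω | radius (numDuels E) δ t T <
      |(winCount (fun i => X (k, ph, d, i) ω) T : ℝ) / T - P d.1 d.2|} ≤
      ENNReal.ofReal (δ / (2 * numDuels E * (t : ℝ) ^ 3)) := by
  have hK : 1 ≤ numDuels E := by
    rw [numDuels_eq_card]
    exact_mod_cast Finset.card_pos.2 ⟨d, mem_duels.2 hd⟩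
  have hind : iIndepFun (fun i => X (k, ph, d, i)) μ :=
    hX.indep.precomp (g := fun i : ℕ => (⟨(k, ph, d, i), hd⟩ : {i : Index n ℓ // IsDuel E i.2.2.1}))
      (fun i j hij => by simpa using hij)
  refine (hoeffding_bool (fun i => hX.measurable _) hind (hP.nonneg d.1 d.2)
    (fun i => hX.law (k, ph, d, i) hd) hT (radius_nonneg _ _ _ _)).trans ?_
  apply ENNReal.ofReal_le_ofReal
  have hTpos : (0 : ℝ) < T := by exact_mod_cast hT
  have htpos : (0 : ℝ) < t := by exact_mod_cast (by omega : 0 < t)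
  have hlog := log_radius_nonneg E h0 h1 (t := t) (by omega)
  unfold radius
  rw [Real.sq_sqrt (by positivity)]
  have : 2 * (T : ℝ) * (Real.log (4 * numDuels E * (t : ℝ) ^ 3 / δ) / (2 * T)) =
      Real.log (4 * numDuels E * (t : ℝ) ^ 3 / δ) := by
    field_simp
  rw [this, Real.exp_neg, Real.exp_log (by positivity)]
  apply le_of_eq
  field_simp
  ring

/-- The union over the counts T ≤ t costs a factor t and leaves δ/(2Kt²); the sum over t is at most
δ/K because ζ(2) ≤ 2; the K duels together give δ. -/
theorem IsDuelOutcomes.measure_not_concentrated_le (hX : IsDuelOutcomes μ E P X)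
    (hP : IsPreference E P) {δ : ℝ} (h0 : 0 < δ) (h1 : δ ≤ 1) (k : ℕ) (ph : Phase) :
    μ {ω | ¬ Concentrated E P δ (fun i => X i ω) k ph} ≤ ENNReal.ofReal δ := by
  set bad : Edge n ℓ × Edge n ℓ → ℕ → ℕ → Set Ω := fun d t T => {ω | radius (numDuels E) δ t T <
      |(winCount (fun i => X (k, ph, d, i) ω) T : ℝ) / T - P d.1 d.2|} with hbad
  have hsub : {ω | ¬ Concentrated E P δ (fun i => X i ω) k ph} ⊆
      ⋃ d ∈ duels E, ⋃ t : ℕ, ⋃ T ∈ Finset.Icc 1 t, bad d t T := by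
    intro ω hω
    simp only [Concentrated, Set.mem_ofPred_eq, not_forall, not_le] at hω
    obtain ⟨d, hd, t, T, hT, ht, hlt⟩ := hω
    simp only [Set.mem_iUnion]
    exact ⟨d, mem_duels.2 hd, t, T, Finset.mem_Icc.2 ⟨hT, ht⟩, hlt⟩
  rcases (duels E).eq_empty_or_nonempty with hE | ⟨d₀, hd₀⟩
  · rw [hE] at hsub
    have : {ω | ¬ Concentrated E P δ (fun i => X i ω) k ph} = ∅ := by
      simpa using hsub
    rw [this]
    simp
  have hK : 1 ≤ numDuels E := by
    rw [numDuels_eq_card]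
    exact_mod_cast Finset.card_pos.2 ⟨d₀, hd₀⟩
  have hKpos : 0 < numDuels E := by linarith
  have hinner : ∀ d ∈ duels E, ∀ t : ℕ, μ (⋃ T ∈ Finset.Icc 1 t, bad d t T) ≤
      ENNReal.ofReal (δ / (2 * numDuels E) * (1 / (t : ℝ) ^ 2)) := by
    intro d hd t
    refine (measure_biUnion_finset_le _ _).trans ?_
    calc ∑ T ∈ Finset.Icc 1 t, μ (bad d t T)
        ≤ ∑ T ∈ Finset.Icc 1 t, ENNReal.ofReal (δ / (2 * numDuels E * (t : ℝ) ^ 3)) := by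
          refine Finset.sum_le_sum fun T hT => ?_
          obtain ⟨h2, h3⟩ := Finset.mem_Icc.1 hT
          exact hX.measure_deviation_le hP h0 h1 k ph (mem_duels.1 hd) h2 h3
      _ = ENNReal.ofReal (t * (δ / (2 * numDuels E * (t : ℝ) ^ 3))) := by
          rw [Finset.sum_const, Nat.card_Icc, nsmul_eq_mul,
            ENNReal.ofReal_mul (Nat.cast_nonneg t), ENNReal.ofReal_natCast]
          simp
      _ = _ := by
          congr 1
          rcases Nat.eq_zero_or_pos t with rfl | ht
          · simp
          · have : (0 : ℝ) < t := by exact_mod_cast ht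
            field_simp
  have hzeta : ∑' t : ℕ, ENNReal.ofReal (δ / (2 * numDuels E) * (1 / (t : ℝ) ^ 2)) ≤
      ENNReal.ofReal (δ / numDuels E) := by
    have hs := (hasSum_zeta_two).mul_left (δ / (2 * numDuels E))
    rw [← ENNReal.ofReal_tsum_of_nonneg (fun t => by positivity) hs.summable, hs.tsum_eq]
    apply ENNReal.ofReal_le_ofReal
    have hpi : Real.pi ^ 2 / 6 ≤ 2 := by
      have := Real.pi_lt_d2
      have := Real.pi_pos
      nlinarith
    calc δ / (2 * numDuels E) * (Real.pi ^ 2 / 6) ≤ δ / (2 * numDuels E) * 2 := by gcongr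
      _ = δ / numDuels E := by field_simp
  calc μ {ω | ¬ Concentrated E P δ (fun i => X i ω) k ph}
      ≤ ∑ d ∈ duels E, μ (⋃ t : ℕ, ⋃ T ∈ Finset.Icc 1 t, bad d t T) :=
        (measure_mono hsub).trans (measure_biUnion_finset_le _ _)
    _ ≤ ∑ d ∈ duels E, ENNReal.ofReal (δ / numDuels E) := by
        refine Finset.sum_le_sum fun d hd => ?_
        exact ((measure_iUnion_le _).trans (ENNReal.tsum_le_tsum (hinner d hd))).trans hzeta
    _ = ENNReal.ofReal δ := by
        rw [Finset.sum_const, nsmul_eq_mul, ← ENNReal.ofReal_natCast, ← numDuels_eq_card,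
          ← ENNReal.ofReal_mul (by linarith)]
        congr 1
        field_simp

/-! ### The copies are independent -/

theorem IsDuelOutcomes.measure_not_copyConcentrated_le (hX : IsDuelOutcomes μ E P X)
    (hP : IsPreference E P) {δ : ℝ} (h0 : 0 < δ) (h1 : δ < 1 / 100) (k : ℕ) :
    μ {ω | ¬ CopyConcentrated E P δ k (fun i => X i ω)} ≤ ENNReal.ofReal (1 / 50) := by
  have hpow : (1 : ℝ) ≤ 2 ^ (k + 1) := one_le_pow₀ (by norm_num)
  have hδ : δ / 2 ^ (k + 1) ≤ 1 / 100 := (div_le_self h0.le hpow).trans h1.le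
  have hδ0 : 0 < δ / 2 ^ (k + 1) := by positivity
  have hsub : {ω | ¬ CopyConcentrated E P δ k (fun i => X i ω)} ⊆
      {ω | ¬ Concentrated E P delta0 (fun i => X i ω) k .explore} ∪
      {ω | ¬ Concentrated E P (δ / 2 ^ (k + 1)) (fun i => X i ω) k .verify} := by
    intro ω hω
    simp only [CopyConcentrated, Set.mem_ofPred_eq, Set.mem_union] at hω ⊢
    tauto
  calc _ ≤ ENNReal.ofReal delta0 + ENNReal.ofReal (δ / 2 ^ (k + 1)) :=
        ((measure_mono hsub).trans (measure_union_le _ _)).trans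
          (add_le_add (hX.measure_not_concentrated_le hP (by norm_num [delta0])
            (by norm_num [delta0]) k _)
            (hX.measure_not_concentrated_le hP hδ0 (by linarith) k _))
    _ = ENNReal.ofReal (delta0 + δ / 2 ^ (k + 1)) :=
        (ENNReal.ofReal_add (by norm_num [delta0]) hδ0.le).symm
    _ ≤ _ := by
        apply ENNReal.ofReal_le_ofReal
        have : delta0 = 1 / 100 := rfl
        linarith

/-- The events for the earlier copies and for copy `k` depend on disjoint blocks of the independent
family, so the failure probabilities multiply. -/
theorem IsDuelOutcomes.measure_noneConcentrated_le (hX : IsDuelOutcomes μ E P X)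
    (hP : IsPreference E P) {δ : ℝ} (h0 : 0 < δ) (h1 : δ < 1 / 100) (k : ℕ) :
    μ (noneConcentrated E P δ X k) ≤ ENNReal.ofReal ((1 / 50) ^ k) := by
  induction k with
  | zero => simpa using prob_le_one
  | succ k ih =>
    have hsplit : noneConcentrated E P δ X (k + 1) = noneConcentrated E P δ X k ∩
        {ω | ¬ CopyConcentrated E P δ k (fun i => X i ω)} := by
      ext ω
      simp only [noneConcentrated, Set.mem_ofPred_eq, Set.mem_inter_iff, Nat.lt_succ_iff_lt_or_eq]
      constructor
      · exact fun h => ⟨fun j hj => h j (Or.inl hj), h k (Or.inr rfl)⟩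
      · rintro ⟨h, h'⟩ j (hj | rfl)
        · exact h j hj
        · exact h'
    have hle : ∀ i : {i : Index n ℓ // IsDuel E i.2.2.1},
        MeasurableSpace.comap (X i.1) inferInstance ≤ ‹MeasurableSpace Ω› :=
      fun i => (hX.measurable i.1).comap_le
    set S : Set {i : Index n ℓ // IsDuel E i.2.2.1} := {i | i.1.1 < k} with hS
    set T : Set {i : Index n ℓ // IsDuel E i.2.2.1} := {i | i.1.1 = k} with hT
    have hST : Disjoint S T := by
      rw [Set.disjoint_left]
      intro i hi hi'
      simp only [hS, hT, Set.mem_ofPred_eq] at hi hi'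
      omega
    have hmeas : ∀ (U : Set {i : Index n ℓ // IsDuel E i.2.2.1})
        (i : {i : Index n ℓ // IsDuel E i.2.2.1}), i ∈ U →
        Measurable[⨆ i ∈ U, MeasurableSpace.comap (X i.1) inferInstance] (X i.1) := by
      intro U i hi
      rw [measurable_iff_comap_le]
      exact le_iSup₂ (f := fun (i : {i : Index n ℓ // IsDuel E i.2.2.1}) (_ : i ∈ U) =>
        MeasurableSpace.comap (X i.1) inferInstance) i hi
    have hind := indep_iSup_of_disjoint hle hX.indep hST
    have hA : MeasurableSet[⨆ i ∈ S, MeasurableSpace.comap (X i.1) inferInstance]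
        (noneConcentrated E P δ X k) :=
      measurableSet_noneConcentrated δ k fun j hj ph d i hd =>
        hmeas S ⟨(j, ph, d, i), hd⟩ hj
    have hB : MeasurableSet[⨆ i ∈ T, MeasurableSpace.comap (X i.1) inferInstance]
        {ω | ¬ CopyConcentrated E P δ k (fun i => X i ω)} := by
      refine MeasurableSet.compl (MeasurableSet.inter ?_ ?_)
      · exact measurableSet_concentrated (fun d i hd => hmeas T ⟨(k, _, d, i), hd⟩ rfl) _
      · exact measurableSet_concentrated (fun d i hd => hmeas T ⟨(k, _, d, i), hd⟩ rfl) _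
    rw [hsplit, Indep_iff _ _ μ |>.1 hind _ _ hA hB, pow_succ,
      ENNReal.ofReal_mul (by positivity)]
    exact mul_le_mul' ih (hX.measure_not_copyConcentrated_le hP h0 h1 k)

theorem IsDuelOutcomes.ae_exists_copyConcentrated (hX : IsDuelOutcomes μ E P X)
    (hP : IsPreference E P) {δ : ℝ} (h0 : 0 < δ) (h1 : δ < 1 / 100) :
    ∀ᵐ ω ∂μ, ∃ k, CopyConcentrated E P δ k (fun i => X i ω) := by
  rw [ae_iff]
  have hlim : Filter.Tendsto (fun k : ℕ => ENNReal.ofReal ((1 / 50) ^ k)) Filter.atTop (nhds 0) := by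
    rw [← ENNReal.ofReal_zero]
    exact ENNReal.tendsto_ofReal (tendsto_pow_atTop_nhds_zero_of_lt_one (by norm_num) (by norm_num))
  refine le_antisymm (ge_of_tendsto' hlim fun k => ?_) zero_le
  refine (measure_mono fun ω hω => ?_).trans (hX.measure_noneConcentrated_le hP h0 h1 k)
  simp only [Set.mem_ofPred_eq, not_exists] at hω
  exact fun j _ => hω j

/-- The confidences δ/2^(k+1) sum to δ. Exploration failures are left out: they may delay an answer
but cannot make it wrong. -/
theorem IsDuelOutcomes.measure_exists_not_verify_le (hX : IsDuelOutcomes μ E P X)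
    (hP : IsPreference E P) {δ : ℝ} (h0 : 0 < δ) (h1 : δ < 1 / 100) :
    μ {ω | ∃ k, ¬ Concentrated E P (δ / 2 ^ (k + 1)) (fun i => X i ω) k .verify} ≤
      ENNReal.ofReal δ := by
  rw [Set.ofPred_exists]
  refine (measure_iUnion_le _).trans ?_
  have hs : HasSum (fun k : ℕ => δ / 2 ^ (k + 1)) δ := by
    have := hasSum_geometric_two' δ
    simpa [pow_succ, div_div, mul_comm] using this
  rw [← hs.tsum_eq, ENNReal.ofReal_tsum_of_nonneg (fun k => by positivity) hs.summable]
  refine ENNReal.tsum_le_tsum fun k => ?_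
  have hpow : (1 : ℝ) ≤ 2 ^ (k + 1) := one_le_pow₀ (by norm_num)
  have : δ / 2 ^ (k + 1) ≤ δ := div_le_self h0.le hpow
  rw [hs.tsum_eq]
  exact hX.measure_not_concentrated_le hP (by positivity) (by linarith) k _

end Probability

end CPEDB

end

/-! ### Numerical estimates and the complexity bound -/

section

open Finset

namespace CPEDB

variable {n ℓ : ℕ}

/-! ### Elementary estimates -/

/-- The tangent line to the logarithm at `a`. A large `a` gives a small slope, which lets a
logarithm of the unknown be absorbed by the unknown itself. -/
theorem log_le_div_add {y a : ℝ} (hy : 0 < y) (ha : 0 < a) :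
    Real.log y ≤ y / a - 1 + Real.log a := by
  have := Real.log_le_sub_one_of_pos (div_pos hy ha)
  rw [Real.log_div hy.ne' ha.ne'] at this
  linarith

theorem log_le_of_le_two_pow {y : ℝ} (hy : 0 < y) {m : ℕ} (h : y ≤ 2 ^ m) :
    Real.log y ≤ m * 0.6931471808 := by
  calc Real.log y ≤ Real.log (2 ^ m) := Real.log_le_log hy h
    _ = m * Real.log 2 := by rw [Real.log_pow]
    _ ≤ m * 0.6931471808 := by
      gcongr
      exact Real.log_two_lt_d9.le

theorem accuracy_sq_le {t : ℕ} (ht : 1 ≤ t) : accuracy t ^ 2 ≤ 1 / t := by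
  have h1 : t ≤ 4 ^ epoch t :=
    (Nat.le_pow_clog (by norm_num) t).trans (Nat.pow_le_pow_right (by norm_num) (le_max_right _ _))
  have h2 : accuracy t ^ 2 = 1 / (4 : ℝ) ^ epoch t := by
    unfold accuracy
    rw [div_pow, one_pow, ← pow_mul, mul_comm, pow_mul]
    norm_num
  rw [h2]
  have ht' : (0 : ℝ) < t := by exact_mod_cast ht
  apply one_div_le_one_div_of_le ht'
  exact_mod_cast h1

/-- Squaring with (a + b)² ≤ 2a² + 2b² gives Δ²t ≤ 16L + 8, with L the logarithm in the radius and 3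
log t inside L. Absorbing the latter leaves a bound linear in log K and log(1/Δ²). The `max K 1`
covers the case without duels. -/
theorem round_le_of_gap_le {K Δ : ℝ} (hK : K = 0 ∨ 1 ≤ K) (hΔ : 0 < Δ) (hΔ' : Δ ≤ 1 / 2) {t : ℕ}
    (ht : 1 ≤ t) (h : Δ ≤ 4 * radius K delta0 t t + 2 * accuracy t) :
    (t : ℝ) ≤ 600 * (Real.log (max K 1 / Δ ^ 2) / Δ ^ 2) := by
  have ht' : (1 : ℝ) ≤ t := by exact_mod_cast ht
  have ht0 : (0 : ℝ) < t := by linarith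
  have hK1 : 1 ≤ max K 1 := le_max_right _ _
  set u := Δ ^ 2 with hu
  have hupos : 0 < u := by positivity
  have hu4 : u ≤ 1 / 4 := by nlinarith
  set L := Real.log (4 * K * (t : ℝ) ^ 3 / delta0) with hL
  have hlogt : 0 ≤ Real.log t := Real.log_nonneg ht'
  have hlogK : 0 ≤ Real.log (max K 1) := Real.log_nonneg hK1
  have h400 : Real.log 400 ≤ 6.3 := by
    have := log_le_of_le_two_pow (y := 400) (by norm_num) (m := 9) (by norm_num)
    norm_num at this ⊢
    linarith
  have h400' : 0 ≤ Real.log 400 := Real.log_nonneg (by norm_num)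
  have h96 : Real.log 96 ≤ 4.9 := by
    have := log_le_of_le_two_pow (y := 96) (by norm_num) (m := 7) (by norm_num)
    norm_num at this ⊢
    linarith
  have hL0 : 0 ≤ L ∧ L ≤ Real.log 400 + Real.log (max K 1) + 3 * Real.log t := by
    rcases hK with rfl | hK
    · have : L = 0 := by simp [hL]
      rw [this]
      exact ⟨le_rfl, by linarith⟩
    · have hKpos : 0 < K := by linarith
      have : L = Real.log 400 + Real.log (max K 1) + 3 * Real.log t := by
        have hm : max K 1 = K := max_eq_left hK
        rw [hL, hm]
        have : 4 * K * (t : ℝ) ^ 3 / delta0 = 400 * K * (t : ℝ) ^ 3 := by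
          unfold delta0
          ring
        rw [this, Real.log_mul (by positivity) (by positivity), Real.log_mul (by norm_num)
          hKpos.ne', Real.log_pow]
        norm_num
      exact ⟨by rw [this]; linarith, this.le⟩
  have hr : radius K delta0 t t ^ 2 = L / (2 * t) := by
    unfold radius
    rw [Real.sq_sqrt]
    exact div_nonneg hL0.1 (by positivity)
  have hacc := accuracy_sq_le ht
  have hsq : u ≤ 32 * (L / (2 * t)) + 8 * (1 / t) := by
    have h1 : u ≤ (4 * radius K delta0 t t + 2 * accuracy t) ^ 2 := by
      rw [hu]
      gcongr
    rw [← hr]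
    nlinarith [sq_nonneg (4 * radius K delta0 t t - 2 * accuracy t)]
  have hut : u * t ≤ 16 * L + 8 := by
    have : (32 * (L / (2 * t)) + 8 * (1 / t)) * t = 16 * L + 8 := by
      field_simp
      ring
    calc u * t ≤ (32 * (L / (2 * t)) + 8 * (1 / t)) * t := by gcongr
      _ = _ := this
  -- The term 16 · 3 log t = 48 log t is at most Δ²t/2 plus constants and logarithms, because the
  -- slope at 96/u is u/96.
  have hlt := log_le_div_add ht0 (a := 96 / u) (by positivity)
  have h5 : Real.log (96 / u) = Real.log 96 + Real.log (1 / u) := by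
    rw [← Real.log_mul (by norm_num) (by positivity)]
    congr 1
    ring
  have h6 : (t : ℝ) / (96 / u) = u * t / 96 := by
    field_simp
  have h7 : Real.log (max K 1 / u) = Real.log (max K 1) + Real.log (1 / u) := by
    rw [← Real.log_mul (by positivity) (by positivity)]
    congr 1
    ring
  -- Gaps are at most 1/2, so log(1/Δ²) ≥ log 4, and additive constants can be absorbed.
  have h8 : 1.38 ≤ Real.log (1 / u) := by
    have h4 : Real.log 4 = 2 * Real.log 2 := by
      rw [show (4 : ℝ) = 2 ^ 2 by norm_num, Real.log_pow]
      norm_num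
    have : Real.log 4 ≤ Real.log (1 / u) := by
      apply Real.log_le_log (by norm_num)
      rw [le_div_iff₀ hupos]
      linarith
    linarith [Real.log_two_gt_d9]
  rw [h5, h6] at hlt
  rw [← mul_div_assoc, le_div_iff₀ hupos, h7]
  nlinarith [hL0.2]

/-- `H / 4` stands for the number of rival edges. The confidence δ/2^(k+1) contributes (k + 1) log
2, which is the source of the factor `k + 1`. -/
theorem verification_length_le {K H δ N : ℝ} (hK : 1 ≤ K) (hH : 4 ≤ H) (hδ : 0 < δ)
    (hδ' : δ < 1 / 100) (hN : 0 ≤ N) (k : ℕ)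
    (h : N ≤ H / 4 + 2 * Real.log (4 * K * (N + 1) ^ 3 / (δ / 2 ^ (k + 1))) * H) :
    N ≤ (k + 1) * (4 * (H * Real.log K) + 52 * (H * Real.log (H / δ))) := by
  have hKpos : 0 < K := by linarith
  have hHpos : 0 < H := by linarith
  have hlogK : 0 ≤ Real.log K := Real.log_nonneg hK
  have hlog2 : Real.log 2 ≤ 0.7 := by linarith [Real.log_two_lt_d9]
  have hlog2' : 0 ≤ Real.log 2 := Real.log_nonneg (by norm_num)
  have h4 : Real.log 4 ≤ 1.4 := by
    have := log_le_of_le_two_pow (y := 4) (by norm_num) (m := 2) (by norm_num)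
    norm_num at this ⊢
    linarith
  have h12 : Real.log 12 ≤ 2.8 := by
    have := log_le_of_le_two_pow (y := 12) (by norm_num) (m := 4) (by norm_num)
    norm_num at this ⊢
    linarith
  have hexpand : Real.log (4 * K * (N + 1) ^ 3 / (δ / 2 ^ (k + 1))) =
      Real.log 4 + Real.log K + 3 * Real.log (N + 1) - Real.log δ + (k + 1) * Real.log 2 := by
    rw [Real.log_div (by positivity) (by positivity), Real.log_mul (by positivity) (by positivity),
      Real.log_mul (by norm_num) hKpos.ne', Real.log_pow, Real.log_div hδ.ne' (by positivity),
      Real.log_pow]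
    push_cast
    ring
  -- At 12H the term 2H · 3 log(N + 1) costs (N + 1)/2, half of the left-hand side.
  have hlN := log_le_div_add (y := N + 1) (a := 12 * H) (by linarith) (by positivity)
  rw [Real.log_mul (by norm_num) hHpos.ne'] at hlN
  have hHδ : Real.log (H / δ) = Real.log H - Real.log δ := Real.log_div hHpos.ne' hδ.ne'
  have hlogH : 0 ≤ Real.log H := Real.log_nonneg (by linarith)
  have hlogδ : Real.log δ ≤ 0 := Real.log_nonpos hδ.le (by linarith)
  have hbig : 1 ≤ Real.log (H / δ) := by
    have h1 : (16 : ℝ) ≤ H / δ := by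
      rw [le_div_iff₀ hδ]
      nlinarith
    have h2 : Real.log 16 ≤ Real.log (H / δ) := Real.log_le_log (by norm_num) h1
    have h3 : Real.log 16 = 4 * Real.log 2 := by
      rw [show (16 : ℝ) = 2 ^ 4 by norm_num, Real.log_pow]
      norm_num
    linarith [Real.log_two_gt_d9]
  rw [hexpand] at h
  set Q := Real.log (H / δ) with hQ
  have hkpos : (0 : ℝ) ≤ k := Nat.cast_nonneg k
  have hbracket : Real.log 4 + Real.log K + 3 * Real.log (N + 1) - Real.log δ +
      (k + 1) * Real.log 2 ≤
      7 + Real.log K + (N + 1) / (4 * H) + 3 * Q + 0.7 * (k + 1) := by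
    have h1 : 3 * ((N + 1) / (12 * H)) = (N + 1) / (4 * H) := by
      field_simp
      ring
    have h2 : ((k : ℝ) + 1) * Real.log 2 ≤ 0.7 * (k + 1) := by nlinarith
    linarith
  have hmain : N ≤ H / 4 + 2 * (7 + Real.log K + (N + 1) / (4 * H) + 3 * Q + 0.7 * (k + 1)) * H := by
    refine h.trans ?_
    gcongr
  have hcancel : 2 * ((N + 1) / (4 * H)) * H = (N + 1) / 2 := by
    field_simp
    ring
  have h9 : N ≤ H / 2 + 28 * H + 4 * (H * Real.log K) + 1 + 12 * (H * Q) + 2.8 * (k + 1) * H := by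
    nlinarith
  have hHQ : H ≤ H * Q := by nlinarith
  have hHK : 0 ≤ H * Real.log K := by positivity
  have hHQk : 0 ≤ (k : ℝ) * (H * Q) := by positivity
  have hkHK : 0 ≤ (k : ℝ) * (H * Real.log K) := by positivity
  have hkH : (k : ℝ) * H ≤ k * (H * Q) := by gcongr
  nlinarith

/-! ### The complexity bound -/

section Complexity

variable {E : Finset (Edge n ℓ)} {P : EdgeMatrix n ℓ} {Ms : Finset (Edge n ℓ)}

/-- The term `ln(K / Δ²) / Δ²` of a pair of edges. -/
noncomputable def pairTerm (E : Finset (Edge n ℓ)) (P : EdgeMatrix n ℓ) (Ms : Finset (Edge n ℓ))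
    (d : Edge n ℓ × Edge n ℓ) : ℝ :=
  Real.log (numDuels E / (pairGap E P Ms d.1 d.2) ^ 2) / (pairGap E P Ms d.1 d.2) ^ 2

/-- The first summand of the complexity bound. -/
noncomputable def exploreBound (E : Finset (Edge n ℓ)) (P : EdgeMatrix n ℓ)
    (Ms : Finset (Edge n ℓ)) : ℝ :=
  ∑ j : Fin ℓ, ∑ d ∈ (edgesAt E j).offDiag, pairTerm E P Ms d

theorem complexityBound_eq (δ : ℝ) : complexityBound E P Ms δ =
    exploreBound E P Ms + hardness E P Ms * Real.log (hardness E P Ms / δ) := rfl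

variable (hℓ : 0 < ℓ) (hE : ∃ M, IsMatching E M ∧ M.card = ℓ) (hP : IsPreference E P)
  (hMs : IsCondorcetWinner E P Ms)

include hℓ hE hP hMs in
theorem pairGap_pos (e f : Edge n ℓ) : 0 < pairGap E P Ms e f :=
  lt_max_of_lt_left (condGap_pos hℓ hE hP hMs e)

theorem pairGap_le_half (hP : IsPreference E P) (e f : Edge n ℓ) : pairGap E P Ms e f ≤ 1 / 2 :=
  max_le (condGap_le_half hP e) (condGap_le_half hP f)

theorem one_le_numDuels {d : Edge n ℓ × Edge n ℓ} (hc : Comparable E d.1 d.2) (hne : d.1 ≠ d.2) :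
    1 ≤ numDuels E := by
  have hpos : 0 < (duels E).card := by
    rcases comparable_isDuel hc hne with h | h
    · exact Finset.card_pos.2 ⟨_, mem_duels.2 h⟩
    · exact Finset.card_pos.2 ⟨_, mem_duels.2 h⟩
  rw [numDuels_eq_card]
  exact_mod_cast hpos

include hℓ hE hP hMs in
-- Since K ≥ 1 and the gap is at most 1/2, every pair contributes at least a constant; this pays for
-- the additive 1 per duel in the sample count.
theorem one_le_pairTerm {d : Edge n ℓ × Edge n ℓ} (hc : Comparable E d.1 d.2) (hne : d.1 ≠ d.2) :
    1 ≤ pairTerm E P Ms d := by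
  have hK := one_le_numDuels hc hne
  have h1 := pairGap_pos hℓ hE hP hMs d.1 d.2
  have h2 := pairGap_le_half (Ms := Ms) hP d.1 d.2
  have hsq : pairGap E P Ms d.1 d.2 ^ 2 ≤ 1 / 4 := by nlinarith
  have hlog : Real.log 4 ≤ Real.log (numDuels E / pairGap E P Ms d.1 d.2 ^ 2) := by
    apply Real.log_le_log (by norm_num)
    rw [le_div_iff₀ (by positivity)]
    linarith
  have h4 : Real.log 4 = 2 * Real.log 2 := by
    rw [show (4 : ℝ) = 2 ^ 2 by norm_num, Real.log_pow]
    norm_num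
  unfold pairTerm
  rw [le_div_iff₀ (by positivity)]
  linarith [Real.log_two_gt_d9]

theorem mem_offDiag_edgesAt {j : Fin ℓ} {d : Edge n ℓ × Edge n ℓ} :
    d ∈ (edgesAt E j).offDiag ↔ Comparable E d.1 d.2 ∧ d.1 ≠ d.2 ∧ d.1.2 = j := by
  simp only [mem_offDiag, mem_edgesAt, Comparable]
  constructor
  · rintro ⟨⟨h1, rfl⟩, ⟨h2, h3⟩, h4⟩
    exact ⟨⟨h1, h2, h3.symm⟩, h4, rfl⟩
  · rintro ⟨⟨h1, h2, h3⟩, h4, rfl⟩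
    exact ⟨⟨h1, rfl⟩, ⟨h2, h3.symm⟩, h4⟩

include hℓ hE hP hMs in
theorem sum_duels_pairTerm_le : ∑ d ∈ duels E, pairTerm E P Ms d ≤ exploreBound E P Ms := by
  unfold exploreBound
  rw [sum_offDiag_eq_sum_duels]
  refine Finset.sum_le_sum fun d hd => ?_
  have hd := mem_duels.1 hd
  have := one_le_pairTerm hℓ hE hP hMs (d := d.swap) hd.1.symm
    (fun h => hd.fst_ne (congrArg Prod.fst h).symm)
  linarith

include hℓ hE hP hMs in
theorem exploreBound_nonneg : 0 ≤ exploreBound E P Ms :=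
  Finset.sum_nonneg fun _ _ => Finset.sum_nonneg fun d hd => by
    obtain ⟨h1, h2, -⟩ := mem_offDiag_edgesAt.1 hd
    linarith [one_le_pairTerm hℓ hE hP hMs (d := d) h1 h2]

include hℓ hE hP hMs in
theorem one_le_exploreBound (h : (duels E).Nonempty) : 1 ≤ exploreBound E P Ms := by
  refine le_trans ?_ (sum_duels_pairTerm_le hℓ hE hP hMs)
  obtain ⟨d, hd⟩ := h
  have hterm : ∀ d ∈ duels E, 1 ≤ pairTerm E P Ms d := fun d hd => by
    have hd := mem_duels.1 hd
    exact one_le_pairTerm hℓ hE hP hMs hd.1 (fun h => hd.fst_ne (congrArg Prod.fst h))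
  exact (hterm d hd).trans (Finset.single_le_sum
    (fun d hd => by linarith [hterm d hd]) hd)

/-- The round in which an edge is decided at the latest. -/
noncomputable def decisionRound (E : Finset (Edge n ℓ)) (P : EdgeMatrix n ℓ)
    (Ms : Finset (Edge n ℓ)) (e : Edge n ℓ) : ℝ :=
  600 * (Real.log (max (numDuels E) 1 / condGap E P Ms e ^ 2) / condGap E P Ms e ^ 2)

include hℓ hE hP hMs in
theorem decisionRound_nonneg (e : Edge n ℓ) : 0 ≤ decisionRound E P Ms e := by
  have h1 := condGap_pos hℓ hE hP hMs e
  have h2 := condGap_le_half (Ms := Ms) hP e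
  have hK : 1 ≤ max (numDuels E) 1 := le_max_right _ _
  have hlog : 0 ≤ Real.log (max (numDuels E) 1 / condGap E P Ms e ^ 2) := by
    apply Real.log_nonneg
    rw [le_div_iff₀ (by positivity)]
    nlinarith
  unfold decisionRound
  positivity

include hℓ hE hP hMs in
-- The pair gap is one of the two edge gaps, so the smaller deadline is at most the one computed
-- from the pair gap; no monotonicity is needed.
theorem sum_decisionRound_le :
    ∑ d ∈ duels E, (1 + min (decisionRound E P Ms d.1) (decisionRound E P Ms d.2)) ≤
      601 * exploreBound E P Ms := by
  refine le_trans ?_ (mul_le_mul_of_nonneg_left (sum_duels_pairTerm_le hℓ hE hP hMs)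
    (by norm_num))
  rw [Finset.mul_sum]
  refine Finset.sum_le_sum fun d hd => ?_
  have hd := mem_duels.1 hd
  have hne : d.1 ≠ d.2 := fun h => hd.fst_ne (congrArg Prod.fst h)
  have h1 := one_le_pairTerm hℓ hE hP hMs hd.1 hne
  have hK : max (numDuels E) 1 = numDuels E := max_eq_left (one_le_numDuels hd.1 hne)
  have h2 : min (decisionRound E P Ms d.1) (decisionRound E P Ms d.2) ≤
      600 * pairTerm E P Ms d := by
    unfold decisionRound pairTerm pairGap
    rw [hK]
    rcases max_choice (condGap E P Ms d.1) (condGap E P Ms d.2) with h | h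
    · rw [h]
      exact min_le_left _ _
    · rw [h]
      exact min_le_right _ _
  linarith

include hℓ hE hP hMs in
-- A matching through `e` cannot contain the winner's edge `f` at the same position, so it disagrees
-- with the winner about both edges. The factor ℓ/d in the verification gap is at least 1.
theorem pairGap_le_verGap {e f : Edge n ℓ} (h : (rivals E Ms e).Nonempty) (he : e ∉ Ms)
    (hf : f ∈ Ms) (hef : e.2 = f.2) : pairGap E P Ms e f ≤ verGap E P Ms e h := by
  unfold verGap
  rw [Finset.le_inf'_iff]
  intro M hM
  obtain ⟨hM, hne, heM⟩ := mem_rivals.1 hM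
  have hfM : f ∉ M := by
    intro hfM
    have hne : e ≠ f := fun h => he (h ▸ hf)
    exact ((maxMatchings_isMatching hM).2 e heM f hfM hne).2 hef
  have h1 := score_le_of_mem_flipMatchings (P := P) (mem_flipMatchings.2 ⟨hM, by tauto⟩ :
    M ∈ flipMatchings E Ms e)
  have h2 := score_le_of_mem_flipMatchings (P := P) (mem_flipMatchings.2 ⟨hM, by tauto⟩ :
    M ∈ flipMatchings E Ms f)
  have h3 := score_winner_lt hℓ hE hP hMs hM hne
  have h4 : (0 : ℝ) < numDiff Ms M := by
    exact_mod_cast numDiff_pos hE hMs.1 hM hne.symm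
  have h5 : (numDiff Ms M : ℝ) ≤ ℓ := by
    have : numDiff Ms M ≤ ℓ := by
      unfold numDiff
      exact (Finset.card_le_univ _).trans (by simp)
    exact_mod_cast this
  have h6 : 1 ≤ (ℓ : ℝ) / numDiff Ms M := by
    rwa [le_div_iff₀ h4, one_mul]
  refine (max_le (by linarith) (by linarith) : pairGap E P Ms e f ≤ 1 / 2 - score P M Ms).trans ?_
  nlinarith

include hℓ hE hP hMs in
theorem edgeHardness_le {e f : Edge n ℓ} (h : (rivals E Ms e).Nonempty) (he : e ∉ Ms)
    (hf : f ∈ Ms) (hef : e.2 = f.2) :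
    edgeHardness E P Ms e ≤ 1 / pairGap E P Ms e f ^ 2 := by
  unfold edgeHardness
  rw [dif_pos h]
  have h1 := pairGap_pos hℓ hE hP hMs e f
  have h2 := pairGap_le_verGap hℓ hE hP hMs h he hf hef
  gcongr

include hℓ hE hP hMs in
theorem four_le_edgeHardness {e : Edge n ℓ} (h : (rivals E Ms e).Nonempty) :
    4 ≤ edgeHardness E P Ms e := by
  have hpos := verGap_pos hℓ hE hP hMs h
  have hle : verGap E P Ms e h ≤ 1 / 2 := by
    obtain ⟨M, hM⟩ := h
    refine (verGap_le hM).trans ?_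
    obtain ⟨hM, hne, -⟩ := mem_rivals.1 hM
    have hd : (0 : ℝ) < numDiff Ms M := by
      exact_mod_cast numDiff_pos hE hMs.1 hM hne.symm
    have hl : (0 : ℝ) < ℓ := by exact_mod_cast hℓ
    -- Comparing with the constant matrix 1/2 shows that the deficit of a rival is at most 1/2 per
    -- differing position, so the normalised gap is at most 1/2.
    have hlow := score_le_score_add (P := P) (Q := fun _ _ => 1 / 2) (w := 1 / 2) hℓ hE hM hMs.1
      (fun e he => (hP.self he).symm) (fun a b _ _ _ _ _ => by linarith [hP.nonneg a b])
    obtain ⟨m, hm⟩ := exists_edgesAt_eq hE hM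
    obtain ⟨m', hm'⟩ := exists_edgesAt_eq hE hMs.1
    have hhalf : score (fun _ _ => 1 / 2) M Ms = 1 / 2 := by
      rw [score_eq_of_edgesAt _ hm hm']
      simp only [sum_const, card_univ, Fintype.card_fin, nsmul_eq_mul]
      field_simp
    rw [hhalf] at hlow
    calc (ℓ : ℝ) / numDiff Ms M * (1 / 2 - score P M Ms)
        ≤ (ℓ : ℝ) / numDiff Ms M * ((numDiff Ms M : ℝ) / ℓ * (1 / 2)) := by
          gcongr
          linarith
      _ = 1 / 2 := by field_simp
  unfold edgeHardness
  rw [dif_pos h, le_div_iff₀ (by positivity)]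
  nlinarith

include hℓ hE hP hMs in
-- The verification cost contains H log K, which the target bound does not. Pairing each rival edge
-- with the winner's edge at its position maps the rival edges injectively to pairs in the
-- exploration sum, whose terms dominate.
theorem hardness_mul_log_le {p : Edge n ℓ → Edge n ℓ} (hp : ∀ e, p e ∈ Ms)
    (hp' : ∀ e, (p e).2 = e.2) :
    hardness E P Ms * Real.log (max (numDuels E) 1) ≤ exploreBound E P Ms := by
  have hcomp : ∀ e ∈ rivalEdges E Ms, Comparable E e (p e) ∧ e ≠ p e := fun e he => by
    have h := mem_rivalEdges.1 he
    exact ⟨⟨h.1.1, maxMatchings_subset hMs.1 (hp e), (hp' e).symm⟩,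
      fun heq => h.1.2 (heq ▸ hp e)⟩
  have hterm : ∀ e ∈ rivalEdges E Ms,
      edgeHardness E P Ms e * Real.log (max (numDuels E) 1) ≤ pairTerm E P Ms (e, p e) := by
    intro e he
    obtain ⟨h1, h2⟩ := mem_rivalEdges.1 he
    have hK := one_le_numDuels (d := (e, p e)) (hcomp e he).1 (hcomp e he).2
    rw [max_eq_left hK]
    have h3 := edgeHardness_le hℓ hE hP hMs h2 h1.2 (hp e) (hp' e).symm
    have hpos := pairGap_pos hℓ hE hP hMs e (p e)
    have hhalf := pairGap_le_half (Ms := Ms) hP e (p e)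
    have hlog : Real.log (numDuels E) ≤ Real.log (numDuels E / pairGap E P Ms e (p e) ^ 2) := by
      apply Real.log_le_log (by linarith)
      rw [le_div_iff₀ (by positivity)]
      exact mul_le_of_le_one_right (by linarith) (by nlinarith)
    have hlog0 : 0 ≤ Real.log (numDuels E) := Real.log_nonneg hK
    calc edgeHardness E P Ms e * Real.log (numDuels E)
        ≤ 1 / pairGap E P Ms e (p e) ^ 2 *
          Real.log (numDuels E / pairGap E P Ms e (p e) ^ 2) := by gcongr
      _ = pairTerm E P Ms (e, p e) := by
        unfold pairTerm
        rw [one_div_mul_eq_div]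
  rw [hardness_eq_sum_rivalEdges, Finset.sum_mul]
  refine (Finset.sum_le_sum hterm).trans ?_
  rw [← Finset.sum_fiberwise (rivalEdges E Ms) Prod.snd]
  refine Finset.sum_le_sum fun j _ => ?_
  have hinj : Set.InjOn (fun e => (e, p e)) ((rivalEdges E Ms).filter (fun e => e.2 = j) :
      Set (Edge n ℓ)) := fun a _ b _ h => congrArg Prod.fst h
  rw [← Finset.sum_image (f := pairTerm E P Ms) (g := fun e => (e, p e)) hinj]
  refine Finset.sum_le_sum_of_subset_of_nonneg ?_ fun d hd _ => ?_
  · intro d hd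
    obtain ⟨e, he, rfl⟩ := Finset.mem_image.1 hd
    obtain ⟨he, hj⟩ := Finset.mem_filter.1 he
    exact mem_offDiag_edgesAt.2 ⟨(hcomp e he).1, (hcomp e he).2, hj⟩
  · obtain ⟨h1, h2, -⟩ := mem_offDiag_edgesAt.1 hd
    linarith [one_le_pairTerm hℓ hE hP hMs (d := d) h1 h2]

theorem hardness_nonneg : 0 ≤ hardness E P Ms := by
  rw [hardness_eq_sum]
  exact Finset.sum_nonneg fun e _ => edgeHardness_nonneg e

include hℓ hE hP hMs in
theorem card_rivalEdges_le : ((rivalEdges E Ms).card : ℝ) ≤ hardness E P Ms / 4 := by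
  rw [hardness_eq_sum_rivalEdges]
  have := Finset.card_nsmul_le_sum (rivalEdges E Ms) (edgeHardness E P Ms) 4 fun e he =>
    four_le_edgeHardness hℓ hE hP hMs (mem_rivalEdges.1 he).2
  rw [nsmul_eq_mul] at this
  linarith

include hℓ hE hP hMs in
theorem hardness_mul_log_nonneg {δ : ℝ} (hδ : 0 < δ) (hδ' : δ < 1 / 100) :
    0 ≤ hardness E P Ms * Real.log (hardness E P Ms / δ) := by
  rcases (rivalEdges E Ms).eq_empty_or_nonempty with h | h
  · rw [hardness_eq_sum_rivalEdges, h]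
    simp
  · have h1 : (1 : ℝ) ≤ (rivalEdges E Ms).card := by
      exact_mod_cast Finset.card_pos.2 h
    have h2 := card_rivalEdges_le hℓ hE hP hMs
    have h3 : 1 ≤ hardness E P Ms / δ := by
      rw [le_div_iff₀ hδ]
      linarith
    exact mul_nonneg (by linarith) (Real.log_nonneg h3)

/-- A bound on the number of samples of the verification phase of copy `k`. -/
noncomputable def verifyBound (E : Finset (Edge n ℓ)) (P : EdgeMatrix n ℓ)
    (Ms : Finset (Edge n ℓ)) (δ : ℝ) (k : ℕ) : ℝ :=
  (k + 1) * (4 * (hardness E P Ms * Real.log (max (numDuels E) 1)) +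
    52 * (hardness E P Ms * Real.log (hardness E P Ms / δ)))

include hℓ hE hP hMs in
theorem verifyBound_nonneg {δ : ℝ} (hδ : 0 < δ) (hδ' : δ < 1 / 100) (k : ℕ) :
    0 ≤ verifyBound E P Ms δ k := by
  have h1 := hardness_mul_log_nonneg hℓ hE hP hMs hδ hδ'
  have h2 : 0 ≤ hardness E P Ms * Real.log (max (numDuels E) 1) :=
    mul_nonneg hardness_nonneg (Real.log_nonneg (le_max_right _ _))
  unfold verifyBound
  positivity

include hℓ hE hP hMs in
theorem le_verifyBound {δ : ℝ} (hδ : 0 < δ) (hδ' : δ < 1 / 100) (k N : ℕ)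
    {p : Edge n ℓ → Edge n ℓ} (hp : ∀ e, p e ∈ Ms) (hp' : ∀ e, (p e).2 = e.2)
    (h : (N : ℝ) ≤ ∑ e ∈ rivalEdges E Ms, (1 + 2 * Real.log (4 * numDuels E * ((N : ℝ) + 1) ^ 3 /
      (δ / 2 ^ (k + 1))) * edgeHardness E P Ms e)) : (N : ℝ) ≤ verifyBound E P Ms δ k := by
  rcases (rivalEdges E Ms).eq_empty_or_nonempty with hS | ⟨e, he⟩
  · rw [hS, Finset.sum_empty] at h
    exact h.trans (verifyBound_nonneg hℓ hE hP hMs hδ hδ' k)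
  · have hcard : (1 : ℝ) ≤ (rivalEdges E Ms).card := by
      exact_mod_cast Finset.card_pos.2 ⟨e, he⟩
    have hle := card_rivalEdges_le hℓ hE hP hMs
    have he' := mem_rivalEdges.1 he
    have hK : 1 ≤ numDuels E := one_le_numDuels (d := (e, p e))
      ⟨he'.1.1, maxMatchings_subset hMs.1 (hp e), (hp' e).symm⟩ (fun heq => he'.1.2 (by
        have : e = p e := heq
        exact this ▸ hp e))
    unfold verifyBound
    rw [max_eq_left hK]
    refine verification_length_le hK (by linarith) hδ hδ' (Nat.cast_nonneg N) k (h.trans ?_)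
    rw [Finset.sum_add_distrib, ← Finset.mul_sum, ← hardness_eq_sum_rivalEdges]
    simp only [Finset.sum_const, nsmul_eq_mul, mul_one]
    gcongr

include hℓ hE hP hMs in
-- The constant is 601 for the exploration plus 4 for the H log K part of the verification.
theorem sample_bound_le {δ : ℝ} (hδ : 0 < δ) (hδ' : δ < 1 / 100) (k : ℕ)
    {p : Edge n ℓ → Edge n ℓ} (hp : ∀ e, p e ∈ Ms) (hp' : ∀ e, (p e).2 = e.2) :
    601 * exploreBound E P Ms + verifyBound E P Ms δ k ≤
      605 * ((k + 1) * complexityBound E P Ms δ) := by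
  have h1 := hardness_mul_log_le hℓ hE hP hMs hp hp'
  have h2 := hardness_mul_log_nonneg hℓ hE hP hMs hδ hδ'
  have h3 := exploreBound_nonneg hℓ hE hP hMs
  have hk : (0 : ℝ) ≤ k := Nat.cast_nonneg k
  rw [complexityBound_eq]
  unfold verifyBound
  have h4 : ((k : ℝ) + 1) * (4 * (hardness E P Ms * Real.log (max (numDuels E) 1)) +
      52 * (hardness E P Ms * Real.log (hardness E P Ms / δ))) ≤
      (k + 1) * (4 * exploreBound E P Ms +
      52 * (hardness E P Ms * Real.log (hardness E P Ms / δ))) := by gcongr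
  nlinarith [mul_nonneg hk h3, mul_nonneg hk h2]

end Complexity

end CPEDB

end

/-! ### The probability and the expectation for the parallel run -/

section

open Finset MeasureTheory

namespace CPEDB

variable {n ℓ : ℕ}

/-! ### The parallel run returns the winner after few samples -/

section Main

variable {I : Input n ℓ} {P : EdgeMatrix n ℓ} {Ms : Finset (Edge n ℓ)} {δ : ℝ}

theorem exists_partner (hI : I.Valid) (hMs : IsCondorcetWinner I.E P Ms) :
    ∃ p : Edge n ℓ → Edge n ℓ, (∀ e, p e ∈ Ms) ∧ ∀ e, (p e).2 = e.2 := by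
  obtain ⟨m, hm⟩ := exists_edgesAt_eq hI.exists_matching hMs.1
  exact ⟨fun e => (m e.2, e.2), fun e => (mem_of_edgesAt hm _).2 rfl, fun e => rfl⟩

theorem goodCopy (hℓ : 0 < ℓ) (hI : I.Valid) (hP : IsPreference I.E P)
    (hMs : IsCondorcetWinner I.E P Ms) (hδ : 0 < δ) (hδ' : δ < 1 / 100)
    {p : Edge n ℓ → Edge n ℓ} (hp : ∀ e, p e ∈ Ms) (hp' : ∀ e, (p e).2 = e.2)
    {x : Index n ℓ → Bool} {k : ℕ} (hx : CopyConcentrated I.E P δ k x) :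
    GoodCopy I P Ms (δ / 2 ^ (k + 1)) x k (decisionRound I.E P Ms)
      (601 * exploreBound I.E P Ms) (verifyBound I.E P Ms δ k) p where
  pos := hℓ
  valid := hI
  pref := hP
  winner := hMs
  partner e f hf hef := by
    by_contra hne
    exact ((maxMatchings_isMatching hMs.1).2 f hf (p e) (hp e) hne).2 (by rw [hp', hef])
  delta_pos := by positivity
  delta_le := by
    have hpow : (1 : ℝ) ≤ 2 ^ (k + 1) := one_le_pow₀ (by norm_num)
    exact (div_le_self hδ.le hpow).trans (by linarith)
  explore := hx.1
  verify := hx.2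
  tau_nonneg := decisionRound_nonneg hℓ hI.exists_matching hP hMs
  le_tau e _ t ht h := round_le_of_gap_le (numDuels_eq_zero_or I.E)
    (condGap_pos hℓ hI.exists_matching hP hMs e) (condGap_le_half hP e) ht h
  sum_le := sum_decisionRound_le hℓ hI.exists_matching hP hMs
  le_of_sum N hN := le_verifyBound hℓ hI.exists_matching hP hMs hδ hδ' k N hp hp' hN

/-- A bound on the number of samples of copy `k`. -/
noncomputable def copyBound (E : Finset (Edge n ℓ)) (P : EdgeMatrix n ℓ) (Ms : Finset (Edge n ℓ))
    (δ : ℝ) (k : ℕ) : ℕ :=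
  ⌊601 * exploreBound E P Ms + verifyBound E P Ms δ k⌋₊

theorem parallel_out_ne_none_of_copyConcentrated (hℓ : 0 < ℓ) (hI : I.Valid)
    (hP : IsPreference I.E P) (hMs : IsCondorcetWinner I.E P Ms) (hδ : 0 < δ) (hδ' : δ < 1 / 100)
    {x : Index n ℓ → Bool} {k : ℕ} (hx : CopyConcentrated I.E P δ k x) :
    (parallel I δ x ((copyBound I.E P Ms δ k + 1) * 2 ^ k)).out ≠ none := by
  obtain ⟨p, hp, hp'⟩ := exists_partner hI hMs
  exact (goodCopy hℓ hI hP hMs hδ hδ' hp hp' hx).parallel_out_ne_none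
    (verifyBound_nonneg hℓ hI.exists_matching hP hMs hδ hδ' k) (Nat.lt_floor_add_one _)

theorem returns_winner (hℓ : 0 < ℓ) (hI : I.Valid)
    (hP : IsPreference I.E P) (hMs : IsCondorcetWinner I.E P Ms) (hδ : 0 < δ) (hδ' : δ < 1 / 100)
    {x : Index n ℓ → Bool} {k : ℕ} (hx : CopyConcentrated I.E P δ k x)
    (hver : ∀ k, Concentrated I.E P (δ / 2 ^ (k + 1)) x k .verify) : Returns I δ x Ms := by
  obtain ⟨M, hM⟩ := Option.ne_none_iff_exists'.1
    (parallel_out_ne_none_of_copyConcentrated hℓ hI hP hMs hδ hδ' hx)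
  refine ⟨_, hM.trans ?_⟩
  rw [(parallel_sound hI hP hMs hver _).2 M hM]

variable {Ω : Type*} [MeasurableSpace Ω] {μ : Measure Ω} [IsProbabilityMeasure μ]
  {X : Index n ℓ → Ω → Bool}

/-- Almost surely some copy is concentrated, so an answer comes; off the event `V` it is the winner.
Only `V` has to be measurable, since the event of returning the winner is bounded from below by
monotonicity. -/
theorem measure_returns_winner_ge (hℓ : 0 < ℓ) (hI : I.Valid) (hP : IsPreference I.E P)
    (hMs : IsCondorcetWinner I.E P Ms) (hδ : 0 < δ) (hδ' : δ < 1 / 100)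
    (hX : IsDuelOutcomes μ I.E P X) :
    ENNReal.ofReal (1 - δ) ≤ μ {ω | Returns I δ (fun i => X i ω) Ms} := by
  set V : Set Ω := {ω | ∃ k, ¬ Concentrated I.E P (δ / 2 ^ (k + 1)) (fun i => X i ω) k .verify}
    with hV
  have hVm : MeasurableSet V := by
    rw [hV, Set.ofPred_exists]
    exact MeasurableSet.iUnion fun k =>
      (measurableSet_concentrated (fun _ _ _ => hX.measurable _) _).compl
  have hle : μ Vᶜ ≤ μ {ω | Returns I δ (fun i => X i ω) Ms} := by
    refine measure_mono_ae ?_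
    filter_upwards [hX.ae_exists_copyConcentrated hP hδ hδ'] with ω hω hωV
    obtain ⟨k, hk⟩ := hω
    refine returns_winner hℓ hI hP hMs hδ hδ' hk fun j => ?_
    by_contra hj
    exact hωV ⟨j, hj⟩
  refine le_trans ?_ hle
  rw [prob_compl_eq_one_sub hVm, ENNReal.ofReal_sub 1 hδ.le, ENNReal.ofReal_one]
  exact tsub_le_tsub_left (hX.measure_exists_not_verify_le hP hδ hδ') 1

/-- The first concentrated copy bounds the samples, and its index can be `k` only if all earlier
copies fail. The sum of indicators over all `k` majorises the cost without any measurability of the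
cost itself. -/
theorem lintegral_sampleComplexity_le_tsum (hℓ : 0 < ℓ) (hI : I.Valid) (hP : IsPreference I.E P)
    (hMs : IsCondorcetWinner I.E P Ms) (hδ : 0 < δ) (hδ' : δ < 1 / 100)
    (hX : IsDuelOutcomes μ I.E P X) :
    ∫⁻ ω, sampleComplexity I δ (fun i => X i ω) ∂μ ≤
      ∑' k : ℕ, ((2 * ((copyBound I.E P Ms δ k + 1) * 2 ^ k) : ℕ) : ENNReal) *
        ENNReal.ofReal ((1 / 50) ^ k) := by
  classical
  set c : ℕ → ENNReal := fun k => ((2 * ((copyBound I.E P Ms δ k + 1) * 2 ^ k) : ℕ) : ENNReal)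
    with hc
  have hm : ∀ k, MeasurableSet (noneConcentrated I.E P δ X k) := fun k =>
    measurableSet_noneConcentrated δ k fun _ _ _ _ _ _ => hX.measurable _
  calc ∫⁻ ω, sampleComplexity I δ (fun i => X i ω) ∂μ
      ≤ ∫⁻ ω, ∑' k, (noneConcentrated I.E P δ X k).indicator (fun _ => c k) ω ∂μ := by
        refine lintegral_mono_ae ?_
        filter_upwards [hX.ae_exists_copyConcentrated hP hδ hδ'] with ω hω
        have hfind := Nat.find_spec hω
        have hmin : ω ∈ noneConcentrated I.E P δ X (Nat.find hω) :=
          fun j hj => Nat.find_min hω hj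
        have h1 := sampleComplexity_le
          (parallel_out_ne_none_of_copyConcentrated hℓ hI hP hMs hδ hδ' hfind)
        refine h1.trans (le_trans ?_ (ENNReal.le_tsum (Nat.find hω)))
        rw [Set.indicator_of_mem hmin]
    _ = ∑' k, ∫⁻ ω, (noneConcentrated I.E P δ X k).indicator (fun _ => c k) ω ∂μ :=
        lintegral_tsum fun k => (measurable_const.indicator (hm k)).aemeasurable
    _ = ∑' k, c k * μ (noneConcentrated I.E P δ X k) := by
        refine tsum_congr fun k => ?_
        rw [lintegral_indicator_const (hm k)]
    _ ≤ _ := by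
        refine ENNReal.tsum_le_tsum fun k => ?_
        gcongr
        exact hX.measure_noneConcentrated_le hP hδ hδ' k

theorem lintegral_sampleComplexity_le_of_duels (hℓ : 0 < ℓ) (hI : I.Valid)
    (hP : IsPreference I.E P) (hMs : IsCondorcetWinner I.E P Ms) (hδ : 0 < δ) (hδ' : δ < 1 / 100)
    (hX : IsDuelOutcomes μ I.E P X) (hne : (duels I.E).Nonempty) :
    ∫⁻ ω, sampleComplexity I δ (fun i => X i ω) ∂μ ≤
      ENNReal.ofReal (1400 * complexityBound I.E P Ms δ) := by
  refine (lintegral_sampleComplexity_le_tsum hℓ hI hP hMs hδ hδ' hX).trans ?_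
  obtain ⟨p, hp, hp'⟩ := exists_partner hI hMs
  have hE := hI.exists_matching
  set D := complexityBound I.E P Ms δ with hD
  -- At least one duel makes the bound at least 1, which absorbs the extra resumption in `copyBound
  -- + 1` and the rounding.
  have hD1 : 1 ≤ D := by
    rw [hD, complexityBound_eq]
    linarith [one_le_exploreBound hℓ hE hP hMs hne, hardness_mul_log_nonneg hℓ hE hP hMs hδ hδ']
  have hgeom : HasSum (fun k : ℕ => 1212 * D * (4 / 50 : ℝ) ^ k) (1212 * D * (1 - 4 / 50)⁻¹) :=
    (hasSum_geometric_of_lt_one (by norm_num) (by norm_num)).mul_left _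
  have hterm : ∀ k : ℕ, ((2 * ((copyBound I.E P Ms δ k + 1) * 2 ^ k) : ℕ) : ENNReal) *
      ENNReal.ofReal ((1 / 50) ^ k) ≤ ENNReal.ofReal (1212 * D * (4 / 50 : ℝ) ^ k) := by
    intro k
    rw [← ENNReal.ofReal_natCast, ← ENNReal.ofReal_mul (Nat.cast_nonneg _)]
    apply ENNReal.ofReal_le_ofReal
    have hnn : 0 ≤ 601 * exploreBound I.E P Ms + verifyBound I.E P Ms δ k := by
      have h1 := exploreBound_nonneg hℓ hE hP hMs
      have h2 := verifyBound_nonneg hℓ hE hP hMs hδ hδ' k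
      positivity
    have h1 : (copyBound I.E P Ms δ k : ℝ) ≤ 605 * ((k + 1) * D) :=
      (Nat.floor_le hnn).trans (sample_bound_le hℓ hE hP hMs hδ hδ' k hp hp')
    -- One factor 2^k from this, one from the schedule and 50^(-k) from the failures give the ratio
    -- 4/50.
    have hk : ((k : ℝ) + 1) ≤ 2 ^ k := by
      exact_mod_cast Nat.lt_two_pow_self (n := k)
    have h2 : (copyBound I.E P Ms δ k : ℝ) + 1 ≤ 606 * (2 ^ k * D) := by
      have h3 : ((k : ℝ) + 1) * D ≤ 2 ^ k * D := by gcongr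
      have h4 : (1 : ℝ) ≤ 2 ^ k := one_le_pow₀ (by norm_num)
      have h5 : 1 ≤ 2 ^ k * D := one_le_mul_of_one_le_of_one_le h4 hD1
      linarith
    push_cast
    calc 2 * (((copyBound I.E P Ms δ k : ℝ) + 1) * 2 ^ k) * (1 / 50) ^ k
        ≤ 2 * (606 * (2 ^ k * D) * 2 ^ k) * (1 / 50) ^ k := by gcongr
      _ = 1212 * D * (2 ^ k * 2 ^ k * (1 / 50) ^ k) := by ring
      _ = 1212 * D * (4 / 50 : ℝ) ^ k := by
        rw [← mul_pow, ← mul_pow]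
        norm_num
  refine (ENNReal.tsum_le_tsum hterm).trans ?_
  rw [← ENNReal.ofReal_tsum_of_nonneg (fun k => by positivity) hgeom.summable, hgeom.tsum_eq]
  apply ENNReal.ofReal_le_ofReal
  have : (1 - 4 / 50 : ℝ)⁻¹ ≤ 1.1 := by norm_num
  nlinarith

/-- Here the complexity bound vanishes and cannot absorb a constant, so exactly zero samples are
required. Concentration holds vacuously, and the first copy answers when it is first resumed. -/
theorem sampleComplexity_eq_zero_of_no_duels (hℓ : 0 < ℓ) (hI : I.Valid)
    (hP : IsPreference I.E P) (hMs : IsCondorcetWinner I.E P Ms) (hδ : 0 < δ) (hδ' : δ < 1 / 100)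
    (hE : duels I.E = ∅) (x : Index n ℓ → Bool) : sampleComplexity I δ x = 0 := by
  obtain ⟨p, hp, hp'⟩ := exists_partner hI hMs
  have hno : ∀ d, ¬ IsDuel I.E d := fun d hd => by
    have := mem_duels.2 hd
    simp [hE] at this
  have hx : CopyConcentrated I.E P δ 0 x :=
    ⟨fun d hd => absurd hd (hno d), fun d hd => absurd hd (hno d)⟩
  have h1 : exploreBound I.E P Ms = 0 := by
    unfold exploreBound
    rw [sum_offDiag_eq_sum_duels, hE, Finset.sum_empty]
  have h2 : hardness I.E P Ms = 0 := by
    rw [hardness_eq_sum_rivalEdges]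
    refine Finset.sum_eq_zero fun e he => ?_
    exfalso
    obtain ⟨⟨heE, heM⟩, -⟩ := mem_rivalEdges.1 he
    have hne : e ≠ p e := fun h => heM (h ▸ hp e)
    rcases comparable_isDuel ⟨heE, maxMatchings_subset hMs.1 (hp e), (hp' e).symm⟩ hne with h | h
    · exact hno _ h
    · exact hno _ h
  refine (goodCopy hℓ hI hP hMs hδ hδ' hp hp' hx).sampleComplexity_eq_zero
    (verifyBound_nonneg hℓ hI.exists_matching hP hMs hδ hδ' 0) ?_
  unfold verifyBound
  rw [h1, h2]
  norm_num

theorem lintegral_sampleComplexity_le (hℓ : 0 < ℓ) (hI : I.Valid)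
    (hP : IsPreference I.E P) (hMs : IsCondorcetWinner I.E P Ms) (hδ : 0 < δ) (hδ' : δ < 1 / 100)
    (hX : IsDuelOutcomes μ I.E P X) :
    ∫⁻ ω, sampleComplexity I δ (fun i => X i ω) ∂μ ≤
      ENNReal.ofReal (1400 * complexityBound I.E P Ms δ) := by
  rcases (duels I.E).eq_empty_or_nonempty with hE | hE
  · simp [sampleComplexity_eq_zero_of_no_duels hℓ hI hP hMs hδ hδ' hE]
  · exact lintegral_sampleComplexity_le_of_duels hℓ hI hP hMs hδ hδ' hX hE

end Main

end CPEDB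

end

theorem theorem5 :
    ∃ C : ℝ, 0 < C ∧
      ∀ (n ℓ : ℕ), 0 < ℓ →
      ∀ (I : CPEDB.Input n ℓ), I.Valid →
      ∀ (P : CPEDB.EdgeMatrix n ℓ), CPEDB.IsPreference I.E P →
      ∀ (Ms : Finset (CPEDB.Edge n ℓ)), CPEDB.IsCondorcetWinner I.E P Ms →
      ∀ (δ : ℝ), 0 < δ → δ < 1 / 100 →
      ∀ (Ω : Type*) [MeasurableSpace Ω] (μ : MeasureTheory.Measure Ω)
        [MeasureTheory.IsProbabilityMeasure μ] (X : CPEDB.Index n ℓ → Ω → Bool),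
        CPEDB.IsDuelOutcomes μ I.E P X →
        ENNReal.ofReal (1 - δ) ≤ μ {ω | CPEDB.Returns I δ (fun i => X i ω) Ms} ∧
        ∫⁻ ω, CPEDB.sampleComplexity I δ (fun i => X i ω) ∂μ
          ≤ ENNReal.ofReal (C * CPEDB.complexityBound I.E P Ms δ) := by
  refine ⟨1400, by norm_num, ?_⟩
  intro n ℓ hℓ I hI P hP Ms hMs δ hδ hδ' Ω _ μ _ X hX
  exact ⟨CPEDB.measure_returns_winner_ge hℓ hI hP hMs hδ hδ' hX,
    CPEDB.lintegral_sampleComplexity_le hℓ hI hP hMs hδ hδ' hX⟩
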